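/- Let $n\ge 1$ and $1\le p\le\infty$. There are constants $C$ and $N$, depending only on $n$ and $p$, such that the following holds. Let $f$ be a (real or complex valued) distribution on $\mathbb{R}^n$ whose distributional gradient $\nabla f$ is an $L^p$ function, and let $\alpha>0$; if $p=\infty$, assume in addition that $\|\nabla f\|_\infty\le\alpha$. Then there are a countable (possibly finite or empty) family of cubes $(Q_i)$ with sides parallel to the axes, a function $g$ on $\mathbb{R}^n$ and functions $b_i$ on $\mathbb{R}^n$ vanishing outside $Q_i$, such that $$f=g+\sum_i b_i \quad\text{in the sense of distributions on } \mathbb{R}^n$$ (that is, the series converges unconditionally when tested against any test function), and: 1. the distributional gradient of $g$ satisfies $\|\nabla g\|_\infty\le C\alpha$, and $g$ is Lipschitz continuous with constant $C\alpha$; 2. $b_i\in W^{1,p}_0(Q_i)$, the closure of $C_c^\infty(Q_i)$ in $W^{1,p}(Q_i)$, and, if $p<\infty$, $\int_{Q_i}|\nabla b_i|^p\le C\alpha^p|Q_i|$ for every $i$; 3. if $p<\infty$, $\sum_i|Q_i|\le C\alpha^{-p}\int_{\mathbb{R}^n}|\nabla f|^p$; if $p=\infty$, the family of cubes is empty, so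 that $f=g$; 4. $\sum_i \mathbf{1}_{Q_i}\le N$ everywhere. -/

import Mathlib

open MeasureTheory TopologicalSpace
open scoped NNReal ENNReal Distributions LineDeriv

/-- The real Euclidean space `ℝⁿ`. -/
abbrev RSpace (n : ℕ) : Type := EuclideanSpace ℝ (Fin n)

/-- The `j`-th vector of the canonical basis of `ℝⁿ`. -/
noncomputable def basisVec {n : ℕ} (j : Fin n) : RSpace n := EuclideanSpace.single j 1

/-- The distributional gradient of the distribution `f` on `ℝⁿ` is the vector-valued locally
integrable function `F`: for every `j`, the distributional derivative `∂_j f` is integration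
against the `j`-th component of `F`. -/
def IsDistribGradient {n : ℕ} {𝕜 : Type*} [RCLike 𝕜] (f : 𝓓'((⊤ : Opens (RSpace n)), 𝕜))
    (F : RSpace n → EuclideanSpace 𝕜 (Fin n)) : Prop :=
  LocallyIntegrable F volume ∧
    ∀ (j : Fin n) (φ : 𝓓((⊤ : Opens (RSpace n)), ℝ)),
      (∂_{basisVec j} f) φ = ∫ x, φ x • F x j

/-- The locally integrable function `u` on the open set `U` has weak (distributional) gradient
`G`, a locally integrable vector-valued function on `U`. -/
def HasWeakGradient {n : ℕ} {𝕜 : Type*} [RCLike 𝕜] (U : Opens (RSpace n)) (u : RSpace n → 𝕜)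
    (G : RSpace n → EuclideanSpace 𝕜 (Fin n)) : Prop :=
  LocallyIntegrableOn u (U : Set (RSpace n)) volume ∧
  LocallyIntegrableOn G (U : Set (RSpace n)) volume ∧
    ∀ (j : Fin n) (φ : 𝓓(U, ℝ)),
      ∫ x in (U : Set (RSpace n)), (∂_{basisVec j} φ) x • u x =
        - ∫ x in (U : Set (RSpace n)), φ x • G x j

/-- The classical gradient of a smooth compactly supported function. -/
noncomputable def testGradient {n : ℕ} {𝕜 : Type*} [RCLike 𝕜] {U : Opens (RSpace n)}
    (φ : 𝓓(U, 𝕜)) (x : RSpace n) : EuclideanSpace 𝕜 (Fin n) :=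
  WithLp.toLp 2 fun j => (∂_{basisVec j} φ) x

/-- `u` belongs to the Sobolev space `W^{1,p}(U)`, and `G` is its weak gradient. -/
def MemW1p {n : ℕ} {𝕜 : Type*} [RCLike 𝕜] (U : Opens (RSpace n)) (p : ℝ≥0∞)
    (u : RSpace n → 𝕜) (G : RSpace n → EuclideanSpace 𝕜 (Fin n)) : Prop :=
  HasWeakGradient U u G ∧
    MemLp u p (volume.restrict (U : Set (RSpace n))) ∧
    MemLp G p (volume.restrict (U : Set (RSpace n)))

/-- `u` (extended by zero outside `U`) belongs to `W₀^{1,p}(U)`, the closure in `W^{1,p}(U)` of the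
smooth functions with compact support in `U`, and `G` is its weak gradient on `U`. -/
def MemW1pZero {n : ℕ} {𝕜 : Type*} [RCLike 𝕜] (U : Opens (RSpace n)) (p : ℝ≥0∞)
    (u : RSpace n → 𝕜) (G : RSpace n → EuclideanSpace 𝕜 (Fin n)) : Prop :=
  MemW1p U p u G ∧ (∀ x, x ∉ U → u x = 0) ∧
    ∀ ε : ℝ≥0∞, 0 < ε → ∃ φ : 𝓓(U, 𝕜),
      eLpNorm (fun x => u x - φ x) p (volume.restrict (U : Set (RSpace n))) ≤ ε ∧
      eLpNorm (fun x => G x - testGradient φ x) p (volume.restrict (U : Set (RSpace n))) ≤ ε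

/-- The open cube with centre `c`, side length `ℓ` and sides parallel to the axes. -/
def openCube {n : ℕ} (c : RSpace n) (ℓ : ℝ) : Opens (RSpace n) where
  carrier := {x | ∀ j, |x j - c j| < ℓ / 2}
  is_open' := by
    simp only [Set.ofPred_forall]
    exact isOpen_iInter_of_finite fun j => isOpen_lt (by fun_prop) continuous_const

/-! The proof combines the Lipschitz approximation of a Sobolev function on the good set of a
maximal function with a Whitney localization of the error.

The distribution is first realized as a locally integrable function `u`. Subtracting a test function
from an average of its translates gives an explicit divergence (`translateAverage_sub_eq`), so the
distribution sees that difference only through `F`. With a smooth weight this represents the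
distribution by a function; with a Dirac mass it bounds the increment of `u` over `h` by `n‖h‖`
times the mean of `‖F‖` over the segment (`IncrementBound`). Averaging that bound over pairs of
points in a ball yields the Poincaré inequality and the comparison of averages over nested balls.

For `p < ∞` let `E` be the closed set where the maximal function of `‖F‖^p` is at most `α^p`. The
weak-type estimate bounds the volume of `Eᶜ`. At points of `E` the averages of `u` over shrinking
balls converge geometrically, and the limits are Lipschitz on `E` with constant comparable to `α`.
Let `g` be a Lipschitz extension of these limits to the whole space; by Lebesgue differentiation `g
= u` almost everywhere on `E`. Taking `g` to be an extension, instead of gluing averages with the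
partition of unity, makes its gradient bound immediate: no cancellation in a sum of gradients of
cutoffs is needed.

The error `u - g` lives on `Eᶜ`, which has finite measure and is covered by Whitney cubes with
bounded overlap. With a subordinate partition of unity `χ_b`, the pieces are `χ_b (u - g)`. Each
cube of scale `r` lies in a ball of radius comparable to `r` centred at a point of `E`; there the
`L^p` norm of `u - g` is at most a constant times `r α` times the `p`-th root of the volume, which
absorbs the factor `1/r` from `∇χ_b`. Mollification puts each piece in `W₀^{1,p}`, and dominated
convergence sums the pieces against a test function.

For `p = ∞` every point is good, so `u = g` almost everywhere and there are no cubes. -/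

section TranslateAverage

/-! ### Averages of translates of a test function. -/

variable {n : ℕ} {Z : Type*} [MeasurableSpace Z] {ν : Measure Z}

theorem integrable_smul_translate {F : Type*} [NormedAddCommGroup F] [NormedSpace ℝ F]
    {s : Z → RSpace n} {k : Z → ℝ} (hs : Measurable s) (hk : Integrable k ν)
    {φ : RSpace n → F} (hφ : Continuous φ) (hc : HasCompactSupport φ) (y : RSpace n) :
    Integrable (fun z => k z • φ (y - s z)) ν := by
  obtain ⟨C, hC⟩ := hφ.bounded_above_of_compact_support hc
  refine (hk.norm.mul_const C).mono' (hk.aestronglyMeasurable.smul (hφ.comp_aestronglyMeasurable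
    ((measurable_const.sub hs).aestronglyMeasurable))) (Filter.Eventually.of_forall fun z => ?_)
  rw [norm_smul]; gcongr; exact hC _

theorem hasFDerivAt_integral_translate {F : Type*} [NormedAddCommGroup F] [NormedSpace ℝ F]
    {s : Z → RSpace n} {k : Z → ℝ} (hs : Measurable s) (hk : Integrable k ν)
    {φ : RSpace n → F} (hφ : ContDiff ℝ 1 φ) (hc : HasCompactSupport φ) (y : RSpace n) :
    HasFDerivAt (fun y => ∫ z, k z • φ (y - s z) ∂ν)
      (∫ z, k z • fderiv ℝ φ (y - s z) ∂ν) y := by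
  have hd : Continuous (fderiv ℝ φ) := hφ.continuous_fderiv one_ne_zero
  obtain ⟨C, hC⟩ := hd.bounded_above_of_compact_support (hc.fderiv ℝ)
  refine hasFDerivAt_integral_of_dominated_of_fderiv_le (s := Set.univ)
    (F' := fun y z => k z • fderiv ℝ φ (y - s z))
    (bound := fun z => ‖k z‖ * C) Filter.univ_mem
    (Filter.Eventually.of_forall fun y =>
      (integrable_smul_translate hs hk hφ.continuous hc y).aestronglyMeasurable)
    (integrable_smul_translate hs hk hφ.continuous hc y)
    (integrable_smul_translate hs hk hd (hc.fderiv ℝ) y).aestronglyMeasurable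
    (Filter.Eventually.of_forall fun z x _ => ?_) (hk.norm.mul_const C)
    (Filter.Eventually.of_forall fun z x _ => ?_)
  · rw [norm_smul]; gcongr; exact hC _
  · have h1 : HasFDerivAt φ (fderiv ℝ φ (x - s z)) (x - s z) :=
      (hφ.differentiable one_ne_zero _).hasFDerivAt
    have h2 : HasFDerivAt (fun x => φ (x - s z)) (fderiv ℝ φ (x - s z)) x := by
      have h3 := h1.comp x ((hasFDerivAt_id x).sub_const (s z))
      rwa [ContinuousLinearMap.comp_id] at h3
    exact h2.const_smul _

/-- Differentiating replaces `φ` by `fderiv ℝ φ`, an average of the same form with values in another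
space; hence the induction on `m` quantifies over all target spaces. -/
theorem contDiff_integral_translate
    {s : Z → RSpace n} {k : Z → ℝ} (hs : Measurable s) (hk : Integrable k ν) (m : ℕ) :
    ∀ {F : Type} [NormedAddCommGroup F] [NormedSpace ℝ F]
    {φ : RSpace n → F}, ContDiff ℝ m φ → HasCompactSupport φ →
    ContDiff ℝ m (fun y => ∫ z, k z • φ (y - s z) ∂ν) := by
  induction m with
  | zero =>
    intro F _ _ φ hφ hc
    obtain ⟨C, hC⟩ := hφ.continuous.bounded_above_of_compact_support hc
    refine contDiff_zero.2 (continuous_of_dominated (bound := fun z => ‖k z‖ * C)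
      (fun y => (integrable_smul_translate hs hk hφ.continuous hc y).aestronglyMeasurable)
      (fun y => Filter.Eventually.of_forall fun z => ?_) (hk.norm.mul_const C)
      (Filter.Eventually.of_forall fun z => ?_))
    · rw [norm_smul]; gcongr; exact hC _
    · exact (hφ.continuous.comp (continuous_id.sub continuous_const)).const_smul _
  | succ m ih =>
    intro F _ _ φ hφ hc
    refine contDiff_succ_iff_hasFDerivAt.2 ⟨fun y => ∫ z, k z • fderiv ℝ φ (y - s z) ∂ν, ?_, ?_⟩
    · exact ih (hφ.fderiv_right (by norm_cast)) (hc.fderiv ℝ)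
    · exact hasFDerivAt_integral_translate hs hk (hφ.of_le (by norm_cast; omega)) hc

theorem exists_support_bound {n : ℕ} {F : Type*} [Zero F] {φ : RSpace n → F}
    (hc : HasCompactSupport φ) : ∃ R, ∀ x, φ x ≠ 0 → ‖x‖ ≤ R := by
  obtain ⟨R, hR⟩ := hc.isCompact.isBounded.exists_norm_le
  exact ⟨R, fun x hx => hR x (subset_tsupport _ hx)⟩

/-- The test function `y ↦ ∫ k(z) φ(y - s(z)) dν(z)`. -/
noncomputable def translateAverage (φ : 𝓓((⊤ : Opens (RSpace n)), ℝ)) (s : Z → RSpace n)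
    (k : Z → ℝ) (R : ℝ) (hs : Measurable s) (hk : Integrable k ν)
    (hR : ∀ᵐ z ∂ν, k z ≠ 0 → ‖s z‖ ≤ R) : 𝓓((⊤ : Opens (RSpace n)), ℝ) where
  toFun y := ∫ z, k z • φ (y - s z) ∂ν
  contDiff' := contDiff_infty.2 fun m => contDiff_integral_translate hs hk m
    (contDiff_infty.1 φ.contDiff m) φ.hasCompactSupport
  hasCompactSupport' := by
    obtain ⟨R', hR'⟩ := exists_support_bound φ.hasCompactSupport
    refine HasCompactSupport.of_support_subset_isCompact (isCompact_closedBall 0 (R' + R)) ?_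
    intro y hy
    by_contra hn
    refine hy (integral_eq_zero_of_ae ?_)
    filter_upwards [hR] with z hz
    by_contra h0
    have h0' : k z ≠ 0 ∧ φ (y - s z) ≠ 0 := by simpa [not_or] using h0
    refine hn ?_
    rw [mem_closedBall_zero_iff]
    calc ‖y‖ = ‖(y - s z) + s z‖ := by simp
      _ ≤ _ := (norm_add_le _ _).trans (add_le_add (hR' _ h0'.2) (hz h0'.1))
  tsupport_subset' := by simp

theorem lineDeriv_testFunction {F : Type*} [NormedAddCommGroup F] [NormedSpace ℝ F]
    {U : Opens (RSpace n)} (φ : 𝓓(U, F)) (v x : RSpace n) :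
    (∂_{v} φ) x = fderiv ℝ φ x v := by
  have : (∂_{v} φ) x = TestFunction.lineDerivCLM ℝ v φ x := rfl
  rw [this, TestFunction.lineDerivCLM_eq_fderivCLM, TestFunction.fderivCLM_apply, if_pos]
  simp

theorem lineDeriv_translateAverage (φ : 𝓓((⊤ : Opens (RSpace n)), ℝ)) (s : Z → RSpace n)
    (k : Z → ℝ) (R : ℝ) (hs : Measurable s) (hk : Integrable k ν)
    (hR : ∀ᵐ z ∂ν, k z ≠ 0 → ‖s z‖ ≤ R) (v y : RSpace n) :
    (∂_{v} (translateAverage φ s k R hs hk hR)) y = ∫ z, k z • fderiv ℝ φ (y - s z) v ∂ν := by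
  rw [lineDeriv_testFunction]
  have hφ : ContDiff ℝ 1 φ := φ.contDiff.of_le (by simp)
  have h := (hasFDerivAt_integral_translate hs hk hφ φ.hasCompactSupport y).fderiv
  have h' : fderiv ℝ (translateAverage φ s k R hs hk hR) y
      = ∫ z, k z • fderiv ℝ φ (y - s z) ∂ν := h
  rw [h', ContinuousLinearMap.integral_apply]
  · rfl
  · exact integrable_smul_translate hs hk (hφ.continuous_fderiv one_ne_zero)
      (φ.hasCompactSupport.fderiv ℝ) y

end TranslateAverage

/-! ### Fubini and duality for translates. -/

section Fubini

variable {n : ℕ} {𝕜 : Type*} [RCLike 𝕜]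

theorem locallyIntegrable_of_forall_testFunction_smul {a : RSpace n → 𝕜}
    (h : ∀ φ : 𝓓((⊤ : Opens (RSpace n)), ℝ), Integrable (fun x => φ x • a x)) :
    LocallyIntegrable a := by
  intro x
  let β : ContDiffBump x := ⟨1, 2, one_pos, one_lt_two⟩
  let φ : 𝓓((⊤ : Opens (RSpace n)), ℝ) := ⟨β, β.contDiff, β.hasCompactSupport, by simp⟩
  refine ⟨Metric.closedBall x 1, Metric.closedBall_mem_nhds x one_pos, ?_⟩
  refine ((h φ).integrableOn (s := Metric.closedBall x 1)).congr_fun (fun y hy => ?_)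
    Metric.isClosed_closedBall.measurableSet
  have : φ y = 1 := β.one_of_mem_closedBall hy
  simp [this]

theorem integrable_testFunction_smul {φ : RSpace n → ℝ} (hφ : Continuous φ)
    (hc : HasCompactSupport φ) {F : Type*} [NormedAddCommGroup F] [NormedSpace ℝ F]
    {H : RSpace n → F} (hH : LocallyIntegrable H) :
    Integrable (fun x => φ x • H x) :=
  hH.integrable_smul_left_of_hasCompactSupport hφ hc

variable {Z : Type*} [MeasurableSpace Z] {ν : Measure Z}

/-- Where the integrand is nonzero, `y` lies in the fixed ball of radius `R' + R`, so a product of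
an integrable function of `z` and one of `y` dominates it. -/
theorem integrable_prod_translate [SFinite ν] {φ : RSpace n → ℝ} (hφ : Continuous φ)
    (hc : HasCompactSupport φ) {s : Z → RSpace n}
    {k : Z → ℝ} {R : ℝ} (hs : Measurable s) (hk : Integrable k ν)
    (hR : ∀ᵐ z ∂ν, k z ≠ 0 → ‖s z‖ ≤ R) {H : RSpace n → 𝕜} (hm : StronglyMeasurable H)
    (hH : LocallyIntegrable H) :
    Integrable (fun p : Z × RSpace n => k p.1 • (φ (p.2 - s p.1) • H p.2)) (ν.prod volume) := by
  obtain ⟨R', hR'⟩ := exists_support_bound hc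
  obtain ⟨C, hC⟩ := hφ.bounded_above_of_compact_support hc
  have hb : Integrable (fun p : Z × RSpace n =>
      ‖k p.1‖ * (C * (Metric.closedBall 0 (R' + R)).indicator (fun y => ‖H y‖) p.2))
      (ν.prod volume) := by
    refine hk.norm.mul_prod (g := fun y => C * (Metric.closedBall 0 (R' + R)).indicator
      (fun y => ‖H y‖) y) (Integrable.const_mul ?_ C)
    rw [integrable_indicator_iff Metric.isClosed_closedBall.measurableSet]
    exact (hH.integrableOn_isCompact (isCompact_closedBall 0 (R' + R))).norm
  refine hb.mono' ?_ ?_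
  · refine (hk.aestronglyMeasurable.comp_fst).smul (AEStronglyMeasurable.smul ?_ ?_)
    · exact hφ.comp_aestronglyMeasurable
        (measurable_snd.sub (hs.comp measurable_fst)).aestronglyMeasurable
    · exact (hm.comp_measurable measurable_snd).aestronglyMeasurable
  · have : ∀ᵐ p : Z × RSpace n ∂(ν.prod volume), k p.1 ≠ 0 → ‖s p.1‖ ≤ R :=
      Measure.quasiMeasurePreserving_fst.ae hR
    filter_upwards [this] with p hp
    rw [norm_smul, norm_smul]
    by_cases h0 : k p.1 = 0
    · simp [h0]
    by_cases h1 : φ (p.2 - s p.1) = 0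
    · rw [h1]
      simp only [norm_zero, zero_mul, mul_zero]
      refine mul_nonneg (norm_nonneg _) (mul_nonneg ((norm_nonneg _).trans (hC 0)) ?_)
      exact Set.indicator_nonneg (fun _ _ => norm_nonneg _) _
    have hmem : p.2 ∈ Metric.closedBall (0 : RSpace n) (R' + R) := by
      rw [mem_closedBall_zero_iff]
      calc ‖p.2‖ = ‖(p.2 - s p.1) + s p.1‖ := by simp
        _ ≤ _ := (norm_add_le _ _).trans (add_le_add (hR' _ h1) (hp h0))
    rw [Set.indicator_of_mem hmem]
    gcongr
    exact hC _

/-- This is the previous integrand after the measure-preserving shear `(z, x) ↦ (z, x + s z)`. -/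
theorem integrable_prod_translate' [SFinite ν] {φ : RSpace n → ℝ} (hφ : Continuous φ)
    (hc : HasCompactSupport φ) {s : Z → RSpace n}
    {k : Z → ℝ} {R : ℝ} (hs : Measurable s) (hk : Integrable k ν)
    (hR : ∀ᵐ z ∂ν, k z ≠ 0 → ‖s z‖ ≤ R) {H : RSpace n → 𝕜} (hm : StronglyMeasurable H)
    (hH : LocallyIntegrable H) :
    Integrable (fun p : Z × RSpace n => k p.1 • (φ p.2 • H (p.2 + s p.1))) (ν.prod volume) := by
  have hmp : MeasurePreserving (fun p : Z × RSpace n => (p.1, p.2 + s p.1))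
      (ν.prod volume) (ν.prod volume) :=
    (MeasurePreserving.id ν).skew_product (g := fun z x => x + s z)
      (measurable_snd.add (hs.comp measurable_fst))
      (Filter.Eventually.of_forall fun z => (measurePreserving_add_right volume (s z)).map_eq)
  have := hmp.integrable_comp_of_integrable (integrable_prod_translate hφ hc hs hk hR hm hH)
  simpa [Function.comp_def] using this

theorem integral_translate_smul_eq [SFinite ν] {φ : RSpace n → ℝ} (hφ : Continuous φ)
    (hc : HasCompactSupport φ) {s : Z → RSpace n}
    {k : Z → ℝ} {R : ℝ} (hs : Measurable s) (hk : Integrable k ν)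
    (hR : ∀ᵐ z ∂ν, k z ≠ 0 → ‖s z‖ ≤ R) {H : RSpace n → 𝕜} (hm : StronglyMeasurable H)
    (hH : LocallyIntegrable H) :
    ∫ y, (∫ z, k z • φ (y - s z) ∂ν) • H y = ∫ z, (∫ y, k z • (φ (y - s z) • H y)) ∂ν := by
  rw [integral_integral_swap (integrable_prod_translate hφ hc hs hk hR hm hH)]
  refine integral_congr_ae (Filter.Eventually.of_forall fun y => ?_)
  simp only [← smul_assoc]
  exact (integral_smul_const _ _).symm

/-- Averaging translates of a test function is dual to averaging translates. -/
theorem integral_translate_smul [SFinite ν] {s : Z → RSpace n}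
    {k : Z → ℝ} {R : ℝ} (hs : Measurable s) (hk : Integrable k ν)
    (hR : ∀ᵐ z ∂ν, k z ≠ 0 → ‖s z‖ ≤ R) {H : RSpace n → 𝕜} (hm : StronglyMeasurable H)
    (hH : LocallyIntegrable H) :
    LocallyIntegrable (fun x => ∫ z, k z • H (x + s z) ∂ν) ∧
    ∀ φ : RSpace n → ℝ, Continuous φ → HasCompactSupport φ →
      ∫ y, (∫ z, k z • φ (y - s z) ∂ν) • H y = ∫ x, φ x • ∫ z, k z • H (x + s z) ∂ν := by
  have e : ∀ (φ : RSpace n → ℝ) (x : RSpace n), ∫ z, k z • (φ x • H (x + s z)) ∂ν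
      = φ x • ∫ z, k z • H (x + s z) ∂ν := fun φ x => by
    rw [← integral_smul]
    simp_rw [smul_comm (φ x)]
  constructor
  · refine locallyIntegrable_of_forall_testFunction_smul fun φ => ?_
    have := (integrable_prod_translate' φ.continuous φ.hasCompactSupport hs hk hR hm
      hH).integral_prod_right
    simpa only [e] using this
  · intro φ hφ hc
    rw [integral_translate_smul_eq hφ hc hs hk hR hm hH]
    simp_rw [← e]
    rw [← integral_integral_swap (f := fun z x => k z • (φ x • H (x + s z)))
      (integrable_prod_translate' hφ hc hs hk hR hm hH)]
    refine integral_congr_ae (Filter.Eventually.of_forall fun z => ?_)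
    simpa using (integral_add_right_eq_self (μ := volume)
      (fun y => k z • (φ (y - s z) • H y)) (s z)).symm

end Fubini

/-! ### The difference between a test function and its averages as a divergence. -/

section Transport

variable {n : ℕ}

theorem sum_smul_basisVec (w : RSpace n) : ∑ j, w j • basisVec j = w := by
  ext i
  simp [basisVec, Finset.sum_apply, Pi.single_apply]

theorem norm_coord_le {𝕜 : Type*} [RCLike 𝕜] (v : EuclideanSpace 𝕜 (Fin n)) (j : Fin n) :
    ‖v j‖ ≤ ‖v‖ := PiLp.norm_apply_le v j

/-- Lebesgue measure on the unit interval. -/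
noncomputable abbrev unitMeasure : Measure ℝ := volume.restrict (Set.Icc (0 : ℝ) 1)

theorem integral_unitMeasure_deriv {φ : RSpace n → ℝ} (hφ : ContDiff ℝ 1 φ) (y w : RSpace n) :
    ∫ t, fderiv ℝ φ (y - t • w) w ∂unitMeasure = φ y - φ (y - w) := by
  have hd : ∀ t : ℝ, HasDerivAt (fun t : ℝ => -φ (y - t • w)) (fderiv ℝ φ (y - t • w) w) t := by
    intro t
    have h1 : HasFDerivAt φ (fderiv ℝ φ (y - t • w)) (y - t • w) :=
      (hφ.differentiable one_ne_zero _).hasFDerivAt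
    have h2 : HasDerivAt (fun t : ℝ => y - t • w) (-w) t := by
      simpa using ((hasDerivAt_id t).smul_const w).const_sub y
    have h3 := (h1.comp_hasDerivAt t h2).neg
    rwa [map_neg, neg_neg] at h3
  rw [integral_Icc_eq_integral_Ioc, ← intervalIntegral.integral_of_le zero_le_one,
    intervalIntegral.integral_eq_sub_of_hasDerivAt (fun t _ => hd t)]
  · simp; ring
  · refine Continuous.intervalIntegrable ?_ _ _
    have := hφ.continuous_fderiv one_ne_zero
    fun_prop

variable {Z : Type*} [MeasurableSpace Z] {μ : Measure Z}

section Field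

variable {w : Z → RSpace n} {η : Z → ℝ} {R : ℝ}

theorem integrable_coord_mul (hw : Measurable w) (hη : Integrable η μ)
    (hR : ∀ᵐ z ∂μ, η z ≠ 0 → ‖w z‖ ≤ R) (j : Fin n) : Integrable (fun z => w z j * η z) μ := by
  have hwj : Measurable fun z => w z j := by fun_prop
  refine (hη.norm.const_mul R).mono' (hwj.aestronglyMeasurable.mul hη.aestronglyMeasurable) ?_
  filter_upwards [hR] with z hz
  rw [norm_mul]
  by_cases h : η z = 0
  · simp [h]
  · gcongr
    exact (norm_coord_le _ _).trans (hz h)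

theorem integrable_coord_mul_prod [SFinite μ] (hw : Measurable w) (hη : Integrable η μ)
    (hR : ∀ᵐ z ∂μ, η z ≠ 0 → ‖w z‖ ≤ R) (j : Fin n) :
    Integrable (fun p : ℝ × Z => w p.2 j * η p.2) (unitMeasure.prod μ) :=
  (integrable_coord_mul hw hη hR j).comp_snd unitMeasure

/-- The segment from `0` to `w z` stays in every centred ball containing `w z`, so the radius `R`
also serves the transport field. -/
theorem norm_smul_le_of_unitMeasure (hR : ∀ᵐ z ∂μ, η z ≠ 0 → ‖w z‖ ≤ R) (j : Fin n) :
    ∀ᵐ p : ℝ × Z ∂(unitMeasure.prod μ), w p.2 j * η p.2 ≠ 0 → ‖p.1 • w p.2‖ ≤ R := by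
  have h1 : ∀ᵐ p : ℝ × Z ∂(unitMeasure.prod μ), p.1 ∈ Set.Icc (0 : ℝ) 1 :=
    Measure.quasiMeasurePreserving_fst.ae (ae_restrict_mem measurableSet_Icc)
  have h2 : ∀ᵐ p : ℝ × Z ∂(unitMeasure.prod μ), η p.2 ≠ 0 → ‖w p.2‖ ≤ R :=
    Measure.quasiMeasurePreserving_snd.ae hR
  filter_upwards [h1, h2] with p hp hp' h0
  rw [norm_smul, Real.norm_of_nonneg hp.1]
  exact (mul_le_of_le_one_left (norm_nonneg _) hp.2).trans (hp' (right_ne_zero_of_mul h0))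

variable [SFinite μ] (hw : Measurable w) (hη : Integrable η μ)
  (hR : ∀ᵐ z ∂μ, η z ≠ 0 → ‖w z‖ ≤ R)

/-- The vector field whose divergence compares a test function with an average of its
translates. -/
noncomputable def transportField (φ : 𝓓((⊤ : Opens (RSpace n)), ℝ)) (j : Fin n) :
    𝓓((⊤ : Opens (RSpace n)), ℝ) :=
  translateAverage (ν := unitMeasure.prod μ) φ (fun p : ℝ × Z => p.1 • w p.2)
    (fun p => w p.2 j * η p.2) R (measurable_fst.smul (hw.comp measurable_snd))
    (integrable_coord_mul_prod hw hη hR j) (norm_smul_le_of_unitMeasure hR j)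

/-- By the fundamental theorem of calculus, `φ(y - w) - φ(y)` is minus the integral over `t ∈ [0,
1]` of the derivative of `φ` at `y - t w` in direction `w`. Expanding `w` in coordinates and moving
`w_j` into the weight produces a divergence. -/
theorem translateAverage_sub_eq (φ : 𝓓((⊤ : Opens (RSpace n)), ℝ)) :
    translateAverage φ w η R hw hη hR - (∫ z, η z ∂μ) • φ =
      ∑ j, -(∂_{basisVec j} (transportField hw hη hR φ j)) := by
  ext y
  have hφ : ContDiff ℝ 1 φ := φ.contDiff.of_le (by simp)
  have hd := hφ.continuous_fderiv one_ne_zero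
  have hs : Measurable (fun p : ℝ × Z => p.1 • w p.2) :=
    measurable_fst.smul (hw.comp measurable_snd)
  have hi : ∀ j, Integrable (fun p : ℝ × Z =>
      (w p.2 j * η p.2) • fderiv ℝ φ (y - p.1 • w p.2) (basisVec j)) (unitMeasure.prod μ) :=
    fun j => integrable_smul_translate (φ := fun x => fderiv ℝ φ x (basisVec j)) hs
      (integrable_coord_mul_prod hw hη hR j) (by fun_prop)
      (by exact (φ.hasCompactSupport.fderiv ℝ).comp_left (g := fun L => L (basisVec j)) (by simp)) y
  have hsum : ∀ p : ℝ × Z, ∑ j, (w p.2 j * η p.2) • fderiv ℝ φ (y - p.1 • w p.2) (basisVec j)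
      = η p.2 * fderiv ℝ φ (y - p.1 • w p.2) (w p.2) := by
    intro p
    conv_rhs => rw [← sum_smul_basisVec (w p.2)]
    rw [map_sum, Finset.mul_sum]
    refine Finset.sum_congr rfl fun j _ => ?_
    rw [sum_smul_basisVec, map_smul, smul_eq_mul, smul_eq_mul]
    ring
  have hl : (∑ j, -(∂_{basisVec j} (transportField hw hη hR φ j))) y =
      -∑ j, (∂_{basisVec j} (transportField hw hη hR φ j)) y := by
    rw [Finset.sum_neg_distrib]
    simp
  have hint : Integrable (fun p : ℝ × Z => η p.2 * fderiv ℝ φ (y - p.1 • w p.2) (w p.2))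
      (unitMeasure.prod μ) := by
    have := integrable_finsetSum Finset.univ (fun j _ => hi j)
    simpa only [hsum] using this
  rw [hl]
  simp only [transportField, lineDeriv_translateAverage]
  rw [← integral_finsetSum _ (fun j _ => hi j)]
  simp only [hsum]
  rw [integral_prod_symm _ hint]
  simp only [integral_const_mul, integral_unitMeasure_deriv hφ]
  have e1 : (translateAverage φ w η R hw hη hR - (∫ z, η z ∂μ) • φ) y
      = (∫ z, η z • φ (y - w z) ∂μ) - (∫ z, η z ∂μ) * φ y := rfl
  rw [e1, ← integral_mul_const, ← integral_sub, ← integral_neg]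
  · refine integral_congr_ae (Filter.Eventually.of_forall fun z => ?_)
    simp only [smul_eq_mul]; ring
  · exact integrable_smul_translate hw hη φ.continuous φ.hasCompactSupport y
  · exact hη.mul_const _

theorem IsDistribGradient.apply_translateAverage_sub {𝕜 : Type*} [RCLike 𝕜]
    {f : 𝓓'((⊤ : Opens (RSpace n)), 𝕜)} {F : RSpace n → EuclideanSpace 𝕜 (Fin n)}
    (hf : IsDistribGradient f F) (φ : 𝓓((⊤ : Opens (RSpace n)), ℝ)) :
    f (translateAverage φ w η R hw hη hR) - (∫ z, η z ∂μ) • f φ =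
      ∑ j, ∫ y, transportField hw hη hR φ j y • F y j := by
  rw [← map_smul, ← map_sub, translateAverage_sub_eq, map_sum]
  refine Finset.sum_congr rfl fun j _ => ?_
  rw [← hf.2 j, Distribution.lineDerivOp_apply_apply]

end Field

end Transport

/-! ### From the distribution to a function with controlled increments. -/

section Representation

variable {n : ℕ} {𝕜 : Type*} [RCLike 𝕜]

theorem LocallyIntegrable.coord {F : RSpace n → EuclideanSpace 𝕜 (Fin n)}
    (hF : LocallyIntegrable F) (j : Fin n) : LocallyIntegrable fun x => F x j := by
  intro x
  obtain ⟨s, hs, hi⟩ := hF x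
  exact ⟨s, hs, (EuclideanSpace.proj (𝕜 := 𝕜) j).integrable_comp hi⟩

theorem StronglyMeasurable.coord {F : RSpace n → EuclideanSpace 𝕜 (Fin n)}
    (hF : StronglyMeasurable F) (j : Fin n) : StronglyMeasurable fun x => F x j :=
  (EuclideanSpace.proj (𝕜 := 𝕜) j).continuous.comp_stronglyMeasurable hF

theorem IsDistribGradient.congr_ae {f : 𝓓'((⊤ : Opens (RSpace n)), 𝕜)}
    {F F' : RSpace n → EuclideanSpace 𝕜 (Fin n)} (hf : IsDistribGradient f F)
    (h : F =ᵐ[volume] F') : IsDistribGradient f F' := by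
  refine ⟨hf.1.congr h, fun j φ => ?_⟩
  rw [hf.2]
  refine integral_congr_ae ?_
  filter_upwards [h] with x hx
  rw [hx]

/-- Convolution is commutative. This allows the transport identity to be applied twice to the same
convolution, with the roles of `φ` and `η` exchanged. -/
theorem translateAverage_comm (φ η : 𝓓((⊤ : Opens (RSpace n)), ℝ)) {R R' : ℝ}
    (hφ : Integrable φ) (hη : Integrable η)
    (hR : ∀ᵐ z, η z ≠ 0 → ‖z‖ ≤ R) (hR' : ∀ᵐ z, φ z ≠ 0 → ‖z‖ ≤ R') :
    translateAverage φ (fun z => z) η R measurable_id hη hR =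
      translateAverage η (fun z => z) φ R' measurable_id hφ hR' := by
  ext y
  have := integral_sub_left_eq_self (fun z => φ z • η (y - z)) volume y
  change ∫ z, η z • φ (y - z) = ∫ z, φ z • η (y - z)
  rw [← this]
  simp [mul_comm]

/-- Pairing an average with weight `φ` of translates of `η` defines a function of `φ`. -/
theorem exists_pairing_weight (η : 𝓓((⊤ : Opens (RSpace n)), ℝ)) (j : Fin n)
    {H : RSpace n → 𝕜} (hm : StronglyMeasurable H) (hH : LocallyIntegrable H) :
    ∃ a : RSpace n → 𝕜, LocallyIntegrable a ∧
      ∀ (φ : 𝓓((⊤ : Opens (RSpace n)), ℝ)) (R : ℝ) (hφ : Integrable φ)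
        (hR : ∀ᵐ z, φ z ≠ 0 → ‖z‖ ≤ R),
        ∫ y, transportField (w := fun z => z) measurable_id hφ hR η j y • H y =
          ∫ x, φ x • a x := by
  -- The test function `φ` enters the transport field only through the weight `w_j φ(w)`;
  -- integrating out `y` and then `t` leaves the factor multiplying `φ(w)`.
  set a : RSpace n → 𝕜 := fun w => w j • ∫ t, (∫ y, η (y - t • w) • H y) ∂unitMeasure
  have hint : ∀ (φ : 𝓓((⊤ : Opens (RSpace n)), ℝ)) (R : ℝ) (hφ : Integrable φ)
      (hR : ∀ᵐ z, φ z ≠ 0 → ‖z‖ ≤ R), Integrable (fun p : ℝ × RSpace n =>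
        ∫ y, (p.2 j * φ p.2) • (η (y - p.1 • p.2) • H y)) (unitMeasure.prod volume) :=
    fun φ R hφ hR => (integrable_prod_translate η.continuous η.hasCompactSupport
      (measurable_fst.smul measurable_snd)
      (integrable_coord_mul_prod (w := fun z => z) measurable_id hφ hR j)
      (norm_smul_le_of_unitMeasure hR j) hm hH).integral_prod_left
  have e : ∀ (φ : 𝓓((⊤ : Opens (RSpace n)), ℝ)) (w : RSpace n),
      ∫ t, (∫ y, (w j * φ w) • (η (y - t • w) • H y)) ∂unitMeasure = φ w • a w := by
    intro φ w
    simp only [integral_smul, a]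
    rw [smul_smul, mul_comm]
  have hφi : ∀ φ : 𝓓((⊤ : Opens (RSpace n)), ℝ), Integrable φ := fun φ =>
    φ.continuous.integrable_of_hasCompactSupport φ.hasCompactSupport
  refine ⟨a, locallyIntegrable_of_forall_testFunction_smul fun φ => ?_, fun φ R hφ hR => ?_⟩
  · obtain ⟨R, hR⟩ := exists_support_bound φ.hasCompactSupport
    have := (hint φ R (hφi φ) (Filter.Eventually.of_forall hR)).integral_prod_right
    simpa only [e] using this
  · have h1 := integral_translate_smul_eq η.continuous η.hasCompactSupport
      (s := fun p : ℝ × RSpace n => p.1 • p.2) (measurable_fst.smul measurable_snd)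
      (integrable_coord_mul_prod (w := fun z => z) measurable_id hφ hR j)
      (norm_smul_le_of_unitMeasure hR j) hm hH
    refine h1.trans ?_
    rw [integral_prod_symm _ (hint φ R hφ hR)]
    simp only [e]

theorem pairing_transportField {Z : Type*} [MeasurableSpace Z] {μ : Measure Z} [SFinite μ]
    {w : Z → RSpace n} {η : Z → ℝ} {R : ℝ} (hw : Measurable w) (hη : Integrable η μ)
    (hR : ∀ᵐ z ∂μ, η z ≠ 0 → ‖w z‖ ≤ R) (j : Fin n)
    {H : RSpace n → 𝕜} (hm : StronglyMeasurable H) (hH : LocallyIntegrable H) :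
    LocallyIntegrable (fun x => ∫ p : ℝ × Z, (w p.2 j * η p.2) • H (x + p.1 • w p.2)
      ∂(unitMeasure.prod μ)) ∧
    ∀ φ : 𝓓((⊤ : Opens (RSpace n)), ℝ), ∫ y, transportField hw hη hR φ j y • H y =
      ∫ x, φ x • ∫ p : ℝ × Z, (w p.2 j * η p.2) • H (x + p.1 • w p.2)
        ∂(unitMeasure.prod μ) := by
  have h := integral_translate_smul (ν := unitMeasure.prod μ)
    (s := fun p : ℝ × Z => p.1 • w p.2) (measurable_fst.smul (hw.comp measurable_snd))
    (integrable_coord_mul_prod hw hη hR j) (norm_smul_le_of_unitMeasure hR j) hm hH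
  exact ⟨h.1, fun φ => h.2 φ φ.continuous φ.hasCompactSupport⟩

/-- A distribution whose gradient is a locally integrable function is itself a locally
integrable function. -/
theorem IsDistribGradient.exists_function {f : 𝓓'((⊤ : Opens (RSpace n)), 𝕜)}
    {F : RSpace n → EuclideanSpace 𝕜 (Fin n)} (hf : IsDistribGradient f F)
    (hm : StronglyMeasurable F) :
    ∃ u : RSpace n → 𝕜, StronglyMeasurable u ∧ LocallyIntegrable u ∧
      ∀ φ : 𝓓((⊤ : Opens (RSpace n)), ℝ), f φ = ∫ x, φ x • u x := by
  suffices h : ∃ u : RSpace n → 𝕜, LocallyIntegrable u ∧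
      ∀ φ : 𝓓((⊤ : Opens (RSpace n)), ℝ), f φ = ∫ x, φ x • u x by
    obtain ⟨u, hu, hfu⟩ := h
    have hae := hu.aestronglyMeasurable.ae_eq_mk
    refine ⟨_, hu.aestronglyMeasurable.stronglyMeasurable_mk, hu.congr hae, fun φ => ?_⟩
    rw [hfu]
    refine integral_congr_ae ?_
    filter_upwards [hae] with x hx
    rw [← hx]
  let β : ContDiffBump (0 : RSpace n) := ⟨1, 2, one_pos, one_lt_two⟩
  let η : 𝓓((⊤ : Opens (RSpace n)), ℝ) :=
    ⟨β.normed volume, β.contDiff_normed, β.hasCompactSupport_normed, by simp⟩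
  have hη1 : ∫ x, η x = 1 := β.integral_normed
  have hi : ∀ φ : 𝓓((⊤ : Opens (RSpace n)), ℝ), Integrable φ := fun φ =>
    φ.continuous.integrable_of_hasCompactSupport φ.hasCompactSupport
  obtain ⟨Rη, hRη'⟩ := exists_support_bound η.hasCompactSupport
  have hRη : ∀ᵐ z, η z ≠ 0 → ‖z‖ ≤ Rη := Filter.Eventually.of_forall hRη'
  choose a ha haφ using fun j : Fin n => exists_pairing_weight η j (StronglyMeasurable.coord hm j)
    (LocallyIntegrable.coord hf.1 j)
  have hB := fun j : Fin n => pairing_transportField (w := fun z : RSpace n => z) measurable_id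
    (hi η) hRη j (StronglyMeasurable.coord hm j) (LocallyIntegrable.coord hf.1 j)
  set b : Fin n → RSpace n → 𝕜 := fun j x => ∫ p : ℝ × RSpace n,
    (p.2 j * η p.2) • F (x + p.1 • p.2) j ∂(unitMeasure.prod volume)
  have hb : ∀ j, LocallyIntegrable (b j) := fun j => (hB j).1
  -- Since `∫ η = 1`, the transport identity compares `f (φ * η)` with `f φ` through the `b j`; with
  -- the roles exchanged it compares the same number with `(∫ φ) f η` through the `a j`. Subtracting
  -- expresses `f φ` as the pairing of `φ` with this function.
  refine ⟨fun x => f η + ∑ j, (a j x - b j x), ?_, fun φ => ?_⟩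
  · exact (locallyIntegrable_const _).add
      (locallyIntegrable_finsetSum _ fun j _ => (ha j).sub (hb j))
  obtain ⟨Rφ, hRφ'⟩ := exists_support_bound φ.hasCompactSupport
  have hRφ : ∀ᵐ z, φ z ≠ 0 → ‖z‖ ≤ Rφ := Filter.Eventually.of_forall hRφ'
  have h1 := hf.apply_translateAverage_sub (w := fun z => z) measurable_id (hi η) hRη φ
  have h2 := hf.apply_translateAverage_sub (w := fun z => z) measurable_id (hi φ) hRφ η
  rw [translateAverage_comm φ η (hi φ) (hi η) hRη hRφ, hη1, one_smul] at h1
  have h3 : ∀ j, ∫ y, transportField (w := fun z : RSpace n => z) measurable_id (hi η) hRη φ j y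
      • F y j = ∫ x, φ x • b j x := fun j => (hB j).2 φ
  simp only [h3] at h1
  simp only [fun j => haφ j φ Rφ (hi φ) hRφ] at h2
  have h4 : f φ = (∫ z, φ z) • f η + ((∑ j, ∫ x, φ x • a j x) - ∑ j, ∫ x, φ x • b j x) := by
    rw [← h1, ← h2]; abel
  have hia : ∀ j, Integrable fun x => φ x • a j x := fun j =>
    integrable_testFunction_smul φ.continuous φ.hasCompactSupport (ha j)
  have hib : ∀ j, Integrable fun x => φ x • b j x := fun j =>
    integrable_testFunction_smul φ.continuous φ.hasCompactSupport (hb j)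
  have hiab : ∀ j, Integrable fun x => φ x • a j x - φ x • b j x := fun j => (hia j).sub (hib j)
  rw [h4, ← Finset.sum_sub_distrib]
  simp only [smul_add, Finset.smul_sum, smul_sub]
  rw [integral_add ((hi φ).smul_const _)
    (integrable_finsetSum _ fun j _ => hiab j), integral_smul_const,
    integral_finsetSum _ fun j _ => hiab j]
  congr 1
  refine Finset.sum_congr rfl fun j _ => ?_
  rw [integral_sub (hia j) (hib j)]

theorem IsDistribGradient.hasWeakGradient {f : 𝓓'((⊤ : Opens (RSpace n)), 𝕜)}
    {F : RSpace n → EuclideanSpace 𝕜 (Fin n)} (hf : IsDistribGradient f F)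
    {u : RSpace n → 𝕜} (hu : LocallyIntegrable u)
    (hfu : ∀ φ : 𝓓((⊤ : Opens (RSpace n)), ℝ), f φ = ∫ x, φ x • u x) :
    HasWeakGradient ⊤ u F := by
  refine ⟨hu.locallyIntegrableOn _, hf.1.locallyIntegrableOn _, fun j φ => ?_⟩
  simp only [Opens.coe_top, Measure.restrict_univ]
  rw [← hf.2 j φ, ← hfu, Distribution.lineDerivOp_apply_apply, map_neg, neg_neg]

/-- For a Dirac mass at the translation `h`, the transport identity says that `u(x + h) - u(x)` is
the sum over `j` of `h_j` times the integral of `F_j(x + t h)` over `[0, 1]`, almost everywhere.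
Bounding each coordinate by the norm costs the factor `n`. -/
theorem IsDistribGradient.enorm_translate_sub_le {f : 𝓓'((⊤ : Opens (RSpace n)), 𝕜)}
    {F : RSpace n → EuclideanSpace 𝕜 (Fin n)} (hf : IsDistribGradient f F)
    (hm : StronglyMeasurable F) {u : RSpace n → 𝕜} (hu : LocallyIntegrable u)
    (hum : StronglyMeasurable u)
    (hfu : ∀ φ : 𝓓((⊤ : Opens (RSpace n)), ℝ), f φ = ∫ x, φ x • u x) (h : RSpace n) :
    ∀ᵐ x, ‖u (x + h) - u x‖ₑ ≤ n * ‖h‖ₑ * ∫⁻ t in Set.Icc (0 : ℝ) 1, ‖F (x + t • h)‖ₑ := by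
  have hη : Integrable (fun _ : Unit => (1 : ℝ)) (Measure.dirac ()) := integrable_const _
  have hR : ∀ᵐ z ∂(Measure.dirac ()), (fun _ : Unit => (1 : ℝ)) z ≠ 0 →
      ‖(fun _ : Unit => h) z‖ ≤ ‖h‖ := Filter.Eventually.of_forall fun _ _ => le_rfl
  have hB := fun j : Fin n => pairing_transportField (w := fun _ : Unit => h) measurable_const
    hη hR j (StronglyMeasurable.coord hm j) (LocallyIntegrable.coord hf.1 j)
  set b : Fin n → RSpace n → 𝕜 := fun j x => ∫ p : ℝ × Unit,
    (h j * 1) • F (x + p.1 • h) j ∂(unitMeasure.prod (Measure.dirac ())) with hbdef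
  have hb : ∀ j, LocallyIntegrable (b j) := fun j => (hB j).1
  have hS := integral_translate_smul (ν := Measure.dirac ()) (s := fun _ : Unit => h)
    measurable_const hη hR hum hu
  simp only [integral_dirac, one_smul] at hS
  have hae : ∀ᵐ x, u (x + h) - u x = ∑ j, b j x := by
    refine ae_eq_of_integral_contDiff_smul_eq (hS.1.sub hu)
      (locallyIntegrable_finsetSum _ fun j _ => hb j) fun g hg hgc => ?_
    let φ : 𝓓((⊤ : Opens (RSpace n)), ℝ) := ⟨g, hg, hgc, by simp⟩
    have h1 := hf.apply_translateAverage_sub (w := fun _ : Unit => h) measurable_const hη hR φ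
    have h3 : ∀ j, ∫ y, transportField (w := fun _ : Unit => h) measurable_const hη hR φ j y
        • F y j = ∫ x, g x • b j x := fun j => (hB j).2 φ
    have h4 : ∀ y, translateAverage φ (fun _ : Unit => h) (fun _ => (1 : ℝ)) ‖h‖ measurable_const
        hη hR y = g (y - h) := fun y => by
      change ∫ z : Unit, (1 : ℝ) • g (y - h) ∂(Measure.dirac ()) = _
      simp
    rw [hfu, hfu] at h1
    simp only [h3, h4, integral_dirac, one_smul] at h1
    rw [hS.2 g hg.continuous hgc] at h1
    have hφg : ∀ x, φ x = g x := fun _ => rfl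
    simp only [hφg] at h1
    have hi1 := integrable_testFunction_smul hg.continuous hgc hS.1
    have hi2 := integrable_testFunction_smul hg.continuous hgc hu
    have hi3 := fun j => integrable_testFunction_smul hg.continuous hgc (hb j)
    simp only [Finset.smul_sum, smul_sub, integral_finsetSum _ fun j _ => hi3 j]
    rw [integral_sub hi1 hi2, h1]
  filter_upwards [hae] with x hx
  rw [hx]
  have hbj : ∀ j, ‖b j x‖ₑ ≤ ‖h‖ₑ * ∫⁻ t in Set.Icc (0 : ℝ) 1, ‖F (x + t • h)‖ₑ := by
    intro j
    have hmeas : AEMeasurable (fun t : ℝ => ‖F (x + t • h)‖ₑ) unitMeasure :=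
      (hm.comp_measurable (g := fun t : ℝ => x + t • h) (by fun_prop)).aestronglyMeasurable.enorm
    have hmeas2 : AEMeasurable (fun p : ℝ × Unit => ‖F (x + p.1 • h)‖ₑ)
        (unitMeasure.prod (Measure.dirac ())) :=
      (hm.comp_measurable (g := fun p : ℝ × Unit => x + p.1 • h)
        (by fun_prop)).aestronglyMeasurable.enorm
    calc ‖b j x‖ₑ ≤ ∫⁻ p : ℝ × Unit, ‖(h j * 1) • F (x + p.1 • h) j‖ₑ
            ∂(unitMeasure.prod (Measure.dirac ())) := enorm_integral_le_lintegral_enorm _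
      _ ≤ ∫⁻ p : ℝ × Unit, ‖h‖ₑ * ‖F (x + p.1 • h)‖ₑ
            ∂(unitMeasure.prod (Measure.dirac ())) := by
          refine lintegral_mono fun p => ?_
          rw [mul_one, enorm_smul]
          gcongr
          · exact enorm_le_iff_norm_le.2 (norm_coord_le h j)
          · exact enorm_le_iff_norm_le.2 (norm_coord_le _ j)
      _ = _ := by
          rw [lintegral_const_mul'' _ hmeas2, lintegral_prod _ hmeas2]
          simp
  calc ‖∑ j, b j x‖ₑ ≤ ∑ j, ‖b j x‖ₑ := enorm_sum_le _ _
    _ ≤ ∑ _j : Fin n, ‖h‖ₑ * ∫⁻ t in Set.Icc (0 : ℝ) 1, ‖F (x + t • h)‖ₑ :=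
        Finset.sum_le_sum fun j _ => hbj j
    _ = _ := by simp [mul_assoc]

end Representation

/-! ### Poincaré inequality and comparison of averages. -/

section Poincare

theorem lintegral_rpow_le_of_isProbabilityMeasure {X : Type*} [MeasurableSpace X] (μ : Measure X)
    [IsProbabilityMeasure μ] {f : X → ℝ≥0∞} (hf : AEMeasurable f μ) {q : ℝ} (hq : 1 ≤ q) :
    (∫⁻ x, f x ∂μ) ^ q ≤ ∫⁻ x, f x ^ q ∂μ := by
  have h := eLpNorm'_le_eLpNorm'_of_exponent_le one_pos hq μ hf.aestronglyMeasurable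
  simp only [eLpNorm', enorm_eq_self, ENNReal.rpow_one, div_one, one_div] at h
  have := ENNReal.rpow_le_rpow h (zero_le_one.trans hq)
  rwa [← ENNReal.rpow_mul, inv_mul_cancel₀ (by positivity), ENNReal.rpow_one] at this

theorem setLAverage_rpow_le {X : Type*} [MeasurableSpace X] {μ : Measure X} {s : Set X}
    (h0 : μ s ≠ 0) (ht : μ s ≠ ∞) {f : X → ℝ≥0∞} (hf : AEMeasurable f (μ.restrict s)) {q : ℝ}
    (hq : 1 ≤ q) :
    ((μ s)⁻¹ * ∫⁻ x in s, f x ∂μ) ^ q ≤ (μ s)⁻¹ * ∫⁻ x in s, f x ^ q ∂μ := by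
  have : IsProbabilityMeasure ((μ s)⁻¹ • μ.restrict s) :=
    ⟨by simp [ENNReal.inv_mul_cancel h0 ht]⟩
  have := lintegral_rpow_le_of_isProbabilityMeasure ((μ s)⁻¹ • μ.restrict s)
    (hf.smul_measure _) hq
  simpa [lintegral_smul_measure] using this

variable {n : ℕ} {𝕜 : Type*} [RCLike 𝕜]

/-- The increments of `u` are controlled by the averages of `F` along segments. -/
def IncrementBound (u : RSpace n → 𝕜) (F : RSpace n → EuclideanSpace 𝕜 (Fin n)) : Prop :=
  ∀ h, ∀ᵐ x, ‖u (x + h) - u x‖ₑ ≤ n * ‖h‖ₑ * ∫⁻ t in Set.Icc (0 : ℝ) 1, ‖F (x + t • h)‖ₑ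

/-- Jensen on the unit interval moves the power inside. By convexity `x + t h` stays in `B` when
both `x` and `x + h` do, and translation invariance then bounds each `t`-slice by the integral over
`B`. -/
theorem IncrementBound.lintegral_inter_le {u : RSpace n → 𝕜}
    {F : RSpace n → EuclideanSpace 𝕜 (Fin n)} (hT : IncrementBound u F)
    (hF : StronglyMeasurable F) {q : ℝ} (hq : 1 ≤ q) {B : Set (RSpace n)} (hB : Convex ℝ B)
    (hBm : MeasurableSet B) (h : RSpace n) :
    ∫⁻ x in B ∩ {x | x + h ∈ B}, ‖u (x + h) - u x‖ₑ ^ q ≤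
      (n * ‖h‖ₑ) ^ q * ∫⁻ x in B, ‖F x‖ₑ ^ q := by
  have hq0 : 0 ≤ q := zero_le_one.trans hq
  have hsm : MeasurableSet (B ∩ {x | x + h ∈ B}) := hBm.inter ((measurable_add_const h) hBm)
  have hprob : IsProbabilityMeasure unitMeasure := ⟨by simp [unitMeasure]⟩
  have hF2 : Measurable fun p : RSpace n × ℝ => ‖F (p.1 + p.2 • h)‖ₑ ^ q :=
    ((hF.comp_measurable (g := fun p : RSpace n × ℝ => p.1 + p.2 • h)
      (by fun_prop)).enorm).pow_const q
  have hF1 : Measurable fun x => ‖F x‖ₑ ^ q := hF.enorm.pow_const q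
  calc ∫⁻ x in B ∩ {x | x + h ∈ B}, ‖u (x + h) - u x‖ₑ ^ q
      ≤ ∫⁻ x in B ∩ {x | x + h ∈ B}, (n * ‖h‖ₑ) ^ q *
          ∫⁻ t, ‖F (x + t • h)‖ₑ ^ q ∂unitMeasure := by
        refine lintegral_mono_ae (ae_restrict_of_ae ?_)
        filter_upwards [hT h] with x hx
        refine (ENNReal.rpow_le_rpow hx hq0).trans ?_
        rw [ENNReal.mul_rpow_of_nonneg _ _ hq0]
        gcongr
        exact lintegral_rpow_le_of_isProbabilityMeasure unitMeasure
          (hF.comp_measurable (g := fun t : ℝ => x + t • h)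
            (by fun_prop)).enorm.aemeasurable hq
    _ = (n * ‖h‖ₑ) ^ q * ∫⁻ t, (∫⁻ x in B ∩ {x | x + h ∈ B}, ‖F (x + t • h)‖ₑ ^ q)
          ∂unitMeasure := by
        rw [lintegral_const_mul _ hF2.lintegral_prod_right']
        rw [lintegral_lintegral_swap hF2.aemeasurable]
    _ ≤ (n * ‖h‖ₑ) ^ q * ∫⁻ _t, (∫⁻ x in B, ‖F x‖ₑ ^ q) ∂unitMeasure := by
        gcongr _ * ?_
        refine lintegral_mono_ae ?_
        filter_upwards [ae_restrict_mem measurableSet_Icc] with t ht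
        have key : ∫⁻ x, B.indicator (fun x => ‖F x‖ₑ ^ q) (x + t • h) =
            ∫⁻ x in B, ‖F x‖ₑ ^ q := by
          rw [lintegral_add_right_eq_self (fun x => B.indicator (fun x => ‖F x‖ₑ ^ q) x) (t • h),
            lintegral_indicator hBm]
        rw [← key, ← lintegral_indicator hsm]
        refine lintegral_mono fun x => ?_
        by_cases hx : x ∈ B ∩ {x | x + h ∈ B}
        · rw [Set.indicator_of_mem hx, Set.indicator_of_mem]
          have := hB hx.1 hx.2 (sub_nonneg.2 ht.2) ht.1 (by ring)
          convert this using 1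
          simp only [smul_add, sub_smul, one_smul]
          abel
        · rw [Set.indicator_of_notMem hx]; exact zero_le
    _ = _ := by simp

/-- Substitute `y = x + h` and integrate in `x` first: two points of a ball of radius `r` differ by
at most `2 r`, so only such `h` contribute. -/
theorem IncrementBound.lintegral_lintegral_le {u : RSpace n → 𝕜}
    {F : RSpace n → EuclideanSpace 𝕜 (Fin n)} (hT : IncrementBound u F)
    (hF : StronglyMeasurable F) (hu : StronglyMeasurable u) {q : ℝ} (hq : 1 ≤ q)
    (c : RSpace n) {r : ℝ} :
    ∫⁻ x in Metric.closedBall c r, ∫⁻ y in Metric.closedBall c r, ‖u x - u y‖ₑ ^ q ≤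
      (n * ENNReal.ofReal (2 * r)) ^ q * volume (Metric.closedBall (0 : RSpace n) (2 * r)) *
        ∫⁻ x in Metric.closedBall c r, ‖F x‖ₑ ^ q := by
  set B := Metric.closedBall c r with hBdef
  have hq0 : 0 ≤ q := zero_le_one.trans hq
  have hBm : MeasurableSet B := Metric.isClosed_closedBall.measurableSet
  have hBc : Convex ℝ B := convex_closedBall c r
  have hsm : ∀ h, MeasurableSet (B ∩ {x | x + h ∈ B}) := fun h =>
    hBm.inter ((measurable_add_const h) hBm)
  set f : RSpace n → RSpace n → ℝ≥0∞ := fun x h =>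
    {p : RSpace n × RSpace n | p.1 ∈ B ∧ p.1 + p.2 ∈ B}.indicator
      (fun p => ‖u (p.1 + p.2) - u p.1‖ₑ ^ q) (x, h) with hf
  have hset : MeasurableSet {p : RSpace n × RSpace n | p.1 ∈ B ∧ p.1 + p.2 ∈ B} :=
    (measurable_fst hBm).inter ((measurable_fst.add measurable_snd) hBm)
  have hin : ∀ x h, x ∈ B → x + h ∈ B → f x h = ‖u (x + h) - u x‖ₑ ^ q := fun x h hx hx' =>
    Set.indicator_of_mem (s := {p : RSpace n × RSpace n | p.1 ∈ B ∧ p.1 + p.2 ∈ B})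
      (a := (x, h)) ⟨hx, hx'⟩ _
  have hout : ∀ x h, ¬(x ∈ B ∧ x + h ∈ B) → f x h = 0 := fun x h hx =>
    Set.indicator_of_notMem (s := {p : RSpace n × RSpace n | p.1 ∈ B ∧ p.1 + p.2 ∈ B})
      (a := (x, h)) hx _
  have hfm : Measurable (Function.uncurry f) := by
    have : Measurable fun p : RSpace n × RSpace n => ‖u (p.1 + p.2) - u p.1‖ₑ ^ q :=
      ((hu.comp_measurable (measurable_fst.add measurable_snd)).sub
        (hu.comp_measurable measurable_fst)).enorm.pow_const q
    exact this.indicator hset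
  have e : ∫⁻ x in B, ∫⁻ y in B, ‖u x - u y‖ₑ ^ q = ∫⁻ x, ∫⁻ h, f x h := by
    rw [← lintegral_indicator hBm]
    refine lintegral_congr fun x => ?_
    by_cases hx : x ∈ B
    · rw [Set.indicator_of_mem hx, ← lintegral_indicator hBm,
        ← lintegral_add_left_eq_self _ x]
      refine lintegral_congr fun h => ?_
      by_cases hx' : x + h ∈ B
      · rw [Set.indicator_of_mem hx', hin x h hx hx', enorm_sub_rev]
      · rw [Set.indicator_of_notMem hx', hout x h (fun h' => hx' h'.2)]
    · rw [Set.indicator_of_notMem hx]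
      simp [hout x _ (fun h' => hx h'.1)]
  rw [e, lintegral_lintegral_swap hfm.aemeasurable]
  calc ∫⁻ h, ∫⁻ x, f x h ≤ ∫⁻ h in Metric.closedBall (0 : RSpace n) (2 * r),
        (n * ENNReal.ofReal (2 * r)) ^ q * ∫⁻ x in B, ‖F x‖ₑ ^ q := by
        rw [← lintegral_indicator Metric.isClosed_closedBall.measurableSet]
        refine lintegral_mono fun h => ?_
        by_cases hh : h ∈ Metric.closedBall (0 : RSpace n) (2 * r)
        · rw [Set.indicator_of_mem hh]
          have e2 : ∀ x, f x h =
              (B ∩ {x | x + h ∈ B}).indicator (fun x => ‖u (x + h) - u x‖ₑ ^ q) x := fun x => by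
            by_cases hx : x ∈ B ∩ {x | x + h ∈ B}
            · rw [Set.indicator_of_mem hx, hin x h hx.1 hx.2]
            · rw [Set.indicator_of_notMem hx, hout x h hx]
          simp only [e2]
          rw [lintegral_indicator (hsm h)]
          refine (hT.lintegral_inter_le hF hq hBc hBm h).trans ?_
          gcongr
          rw [← ofReal_norm]
          exact ENNReal.ofReal_le_ofReal (mem_closedBall_zero_iff.1 hh)
        · rw [Set.indicator_of_notMem hh, nonpos_iff_eq_zero]
          have : ∀ x, f x h = 0 := fun x => by
            refine hout x h (fun hx => hh ?_)
            rw [mem_closedBall_zero_iff]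
            have h1 := Metric.mem_closedBall.1 hx.1
            have h2 := Metric.mem_closedBall.1 hx.2
            calc ‖h‖ = dist (x + h) x := by simp [dist_eq_norm]
              _ ≤ dist (x + h) c + dist x c := dist_triangle_right _ _ _
              _ ≤ _ := by linarith
          simp [this]
    _ = _ := by
        rw [setLIntegral_const]; ring

theorem setAverage_sub_const {S : Set (RSpace n)} (h0 : volume S ≠ 0) (ht : volume S ≠ ∞)
    {u : RSpace n → 𝕜} (hu : IntegrableOn u S) (c : 𝕜) :
    ‖(⨍ y in S, u y) - c‖ₑ ≤ (volume S)⁻¹ * ∫⁻ y in S, ‖u y - c‖ₑ := by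
  have hr : volume.real S ≠ 0 := (ENNReal.toReal_pos h0 ht).ne'
  have e : (⨍ y in S, u y) - c = (volume.real S)⁻¹ • ∫ y in S, (u y - c) := by
    rw [integral_sub hu (integrableOn_const ht), setAverage_eq, smul_sub, setIntegral_const,
      inv_smul_smul₀ hr]
  rw [e, enorm_smul]
  gcongr
  · rw [enorm_inv hr, Measure.real, Real.enorm_of_nonneg ENNReal.toReal_nonneg,
      ENNReal.ofReal_toReal ht]
  · exact enorm_integral_le_lintegral_enorm _

variable {u : RSpace n → 𝕜} {F : RSpace n → EuclideanSpace 𝕜 (Fin n)}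

theorem volume_closedBall_ne_zero (z : RSpace n) {r : ℝ} (hr : 0 < r) :
    volume (Metric.closedBall z r) ≠ 0 := (Metric.measure_closedBall_pos volume z hr).ne'

theorem volume_closedBall_ne_top (z : RSpace n) (r : ℝ) :
    volume (Metric.closedBall z r) ≠ ∞ := measure_closedBall_lt_top.ne

theorem volume_closedBall_mul (z z' : RSpace n) {κ r : ℝ} (hκ : 0 ≤ κ) (hr : 0 ≤ r) :
    volume (Metric.closedBall z (κ * r)) =
      ENNReal.ofReal (κ ^ n) * volume (Metric.closedBall z' r) := by
  rw [Measure.addHaar_closedBall_mul _ _ hκ hr, Measure.addHaar_closedBall_center volume z']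
  simp

/-- The `L^q` Poincaré inequality on balls. -/
theorem IncrementBound.poincare (hT : IncrementBound u F)
    (hF : StronglyMeasurable F) (hu : StronglyMeasurable u) (hui : LocallyIntegrable u)
    {q : ℝ} (hq : 1 ≤ q) (c : RSpace n) {r : ℝ} (hr : 0 < r) :
    ∫⁻ x in Metric.closedBall c r, ‖u x - ⨍ y in Metric.closedBall c r, u y‖ₑ ^ q ≤
      (n * ENNReal.ofReal (2 * r)) ^ q * 2 ^ n *
        ∫⁻ x in Metric.closedBall c r, ‖F x‖ₑ ^ q := by
  have hq0 : 0 ≤ q := zero_le_one.trans hq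
  set B := Metric.closedBall c r with hBdef
  have h0 := volume_closedBall_ne_zero c hr
  have ht := volume_closedBall_ne_top c r
  have hui' : IntegrableOn u B := hui.integrableOn_isCompact (isCompact_closedBall c r)
  have hm2 : Measurable fun p : RSpace n × RSpace n => ‖u p.1 - u p.2‖ₑ ^ q :=
    ((hu.comp_measurable measurable_fst).sub
        (hu.comp_measurable measurable_snd)).enorm.pow_const q
  have hvol : volume (Metric.closedBall (0 : RSpace n) (2 * r)) = 2 ^ n * volume B := by
    rw [volume_closedBall_mul 0 c zero_le_two hr.le, ENNReal.ofReal_pow zero_le_two]; simp [hBdef]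
  calc ∫⁻ x in B, ‖u x - ⨍ y in B, u y‖ₑ ^ q
      ≤ ∫⁻ x in B, (volume B)⁻¹ * ∫⁻ y in B, ‖u x - u y‖ₑ ^ q := by
        refine lintegral_mono fun x => ?_
        rw [enorm_sub_rev]
        refine (ENNReal.rpow_le_rpow (setAverage_sub_const h0 ht hui' (u x)) hq0).trans ?_
        refine (setLAverage_rpow_le h0 ht ?_ hq).trans_eq ?_
        · exact (hu.sub stronglyMeasurable_const).enorm.aemeasurable
        · simp_rw [enorm_sub_rev (u x)]; rfl
    _ = (volume B)⁻¹ * ∫⁻ x in B, ∫⁻ y in B, ‖u x - u y‖ₑ ^ q :=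
        lintegral_const_mul _ hm2.lintegral_prod_right'
    _ ≤ (volume B)⁻¹ * ((n * ENNReal.ofReal (2 * r)) ^ q *
          volume (Metric.closedBall (0 : RSpace n) (2 * r)) * ∫⁻ x in B, ‖F x‖ₑ ^ q) := by
        gcongr
        exact hT.lintegral_lintegral_le hF hu hq c
    _ = ((volume B)⁻¹ * volume B) * ((n * ENNReal.ofReal (2 * r)) ^ q * 2 ^ n *
          ∫⁻ x in B, ‖F x‖ₑ ^ q) := by rw [hvol]; ring
    _ = _ := by rw [ENNReal.inv_mul_cancel h0 ht, one_mul]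

/-- The difference of averages is at most a double average of `‖u x - u y‖` over the two balls;
enlarging the smaller to the bigger reduces it to the double integral. The factor `(2κ)^n` compares
the ball of radius `2r` of admissible increments with the ball of radius `s ≥ r/κ`. -/
theorem IncrementBound.enorm_average_sub_le (hT : IncrementBound u F)
    (hF : StronglyMeasurable F) (hu : StronglyMeasurable u) (hui : LocallyIntegrable u)
    {α : ℝ≥0∞} {z z' : RSpace n} {r s κ : ℝ} (hs : 0 < s) (hr : 0 < r) (hκ : r ≤ κ * s)
    (hz : ∫⁻ x in Metric.closedBall z r, ‖F x‖ₑ ≤ α * volume (Metric.closedBall z r))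
    (hsub : Metric.closedBall z' s ⊆ Metric.closedBall z r) :
    ‖(⨍ y in Metric.closedBall z r, u y) - ⨍ y in Metric.closedBall z' s, u y‖ₑ ≤
      n * ENNReal.ofReal (2 * r) * ENNReal.ofReal ((2 * κ) ^ n) * α := by
  set B := Metric.closedBall z r
  set S := Metric.closedBall z' s
  have hB0 := volume_closedBall_ne_zero z hr
  have hBt := volume_closedBall_ne_top z r
  have hS0 := volume_closedBall_ne_zero z' hs
  have hSt := volume_closedBall_ne_top z' s
  have hκ0 : 0 ≤ κ := by
    by_contra h
    have : κ * s ≤ 0 := mul_nonpos_of_nonpos_of_nonneg (by linarith) hs.le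
    linarith
  have huB : IntegrableOn u B := hui.integrableOn_isCompact (isCompact_closedBall _ _)
  have huS : IntegrableOn u S := hui.integrableOn_isCompact (isCompact_closedBall _ _)
  have hm2 : Measurable fun p : RSpace n × RSpace n => ‖u p.1 - u p.2‖ₑ :=
    ((hu.comp_measurable measurable_fst).sub (hu.comp_measurable measurable_snd)).enorm
  have hD := hT.lintegral_lintegral_le hF hu le_rfl z (r := r)
  simp only [ENNReal.rpow_one] at hD
  have hvol : volume (Metric.closedBall (0 : RSpace n) (2 * r)) ≤
      ENNReal.ofReal ((2 * κ) ^ n) * volume S := by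
    rw [← volume_closedBall_mul 0 z' (by positivity) hs.le]
    exact measure_mono (Metric.closedBall_subset_closedBall (by nlinarith))
  calc ‖(⨍ y in B, u y) - ⨍ y in S, u y‖ₑ
      ≤ (volume S)⁻¹ * ∫⁻ x in S, ‖u x - ⨍ y in B, u y‖ₑ := by
        rw [enorm_sub_rev]; exact setAverage_sub_const hS0 hSt huS _
    _ ≤ (volume S)⁻¹ * ∫⁻ x in B, ‖u x - ⨍ y in B, u y‖ₑ := by
        gcongr
    _ ≤ (volume S)⁻¹ * ∫⁻ x in B, (volume B)⁻¹ * ∫⁻ y in B, ‖u x - u y‖ₑ := by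
        gcongr with x
        rw [enorm_sub_rev]
        refine (setAverage_sub_const hB0 hBt huB (u x)).trans_eq ?_
        simp_rw [enorm_sub_rev (u x)]
        rfl
    _ = (volume S)⁻¹ * ((volume B)⁻¹ * ∫⁻ x in B, ∫⁻ y in B, ‖u x - u y‖ₑ) := by
        rw [lintegral_const_mul _ hm2.lintegral_prod_right']
    _ ≤ (volume S)⁻¹ * ((volume B)⁻¹ * (n * ENNReal.ofReal (2 * r) *
          (ENNReal.ofReal ((2 * κ) ^ n) * volume S) * (α * volume B))) := by
        gcongr
        exact hD.trans (by gcongr)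
    _ = ((volume S)⁻¹ * volume S) * ((volume B)⁻¹ * volume B) *
          (n * ENNReal.ofReal (2 * r) * ENNReal.ofReal ((2 * κ) ^ n) * α) := by ring
    _ = _ := by rw [ENNReal.inv_mul_cancel hS0 hSt, ENNReal.inv_mul_cancel hB0 hBt, one_mul,
                  one_mul]

end Poincare

/-! ### Lipschitz approximation on the good set. -/

section LipschitzExtension

variable {n : ℕ} {𝕜 : Type*} [RCLike 𝕜]

/-- The real and imaginary parts are extended separately with the same constant, whence the factor
2. -/
theorem LipschitzOnWith.extend_rclike {X : Type*} [PseudoMetricSpace X] {f : X → 𝕜} {s : Set X}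
    {K : ℝ≥0} (hf : LipschitzOnWith K f s) :
    ∃ g : X → 𝕜, LipschitzWith (2 * K) g ∧ Set.EqOn f g s := by
  have hre : LipschitzOnWith K (fun x => RCLike.re (f x)) s :=
    LipschitzOnWith.of_dist_le_mul fun x hx y hy => by
      rw [Real.dist_eq, ← map_sub]
      exact (RCLike.abs_re_le_norm _).trans (dist_eq_norm (f x) (f y) ▸ hf.dist_le_mul x hx y hy)
  have him : LipschitzOnWith K (fun x => RCLike.im (f x)) s :=
    LipschitzOnWith.of_dist_le_mul fun x hx y hy => by
      rw [Real.dist_eq, ← map_sub]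
      exact (RCLike.abs_im_le_norm _).trans (dist_eq_norm (f x) (f y) ▸ hf.dist_le_mul x hx y hy)
  obtain ⟨g₁, hg₁, he₁⟩ := hre.extend_real
  obtain ⟨g₂, hg₂, he₂⟩ := him.extend_real
  refine ⟨fun x => (g₁ x : 𝕜) + g₂ x * RCLike.I, LipschitzWith.of_dist_le_mul fun x y => ?_,
    fun x hx => ?_⟩
  · have h1 := hg₁.dist_le_mul x y
    have h2 := hg₂.dist_le_mul x y
    rw [Real.dist_eq] at h1 h2
    rw [dist_eq_norm]
    have e : (g₁ x : 𝕜) + g₂ x * RCLike.I - (g₁ y + g₂ y * RCLike.I) =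
        ((g₁ x - g₁ y : ℝ) : 𝕜) + ((g₂ x - g₂ y : ℝ) : 𝕜) * RCLike.I := by push_cast; ring
    rw [e]
    refine (norm_add_le _ _).trans ?_
    rw [norm_mul, RCLike.norm_ofReal, RCLike.norm_ofReal]
    have h3 : ‖(RCLike.I : 𝕜)‖ ≤ 1 := by
      by_cases h : (RCLike.I : 𝕜) = 0
      · simp [h]
      · rw [RCLike.norm_I_of_ne_zero h]
    have := mul_le_of_le_one_right (abs_nonneg (g₂ x - g₂ y)) h3
    push_cast
    linarith
  · simp only [← he₁ hx, ← he₂ hx]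
    exact (RCLike.re_add_im (f x)).symm

variable {u : RSpace n → 𝕜} {F : RSpace n → EuclideanSpace 𝕜 (Fin n)}

theorem IncrementBound.norm_average_sub_le (hT : IncrementBound u F)
    (hF : StronglyMeasurable F) (hu : StronglyMeasurable u) (hui : LocallyIntegrable u)
    {α : ℝ≥0} {z z' : RSpace n} {r s κ : ℝ} (hs : 0 < s) (hr : 0 < r) (hκ0 : 0 ≤ κ)
    (hκ : r ≤ κ * s)
    (hz : ∫⁻ x in Metric.closedBall z r, ‖F x‖ₑ ≤ α * volume (Metric.closedBall z r))
    (hsub : Metric.closedBall z' s ⊆ Metric.closedBall z r) :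
    ‖(⨍ y in Metric.closedBall z r, u y) - ⨍ y in Metric.closedBall z' s, u y‖ ≤
      n * (2 * r) * (2 * κ) ^ n * α := by
  have h := hT.enorm_average_sub_le hF hu hui hs hr hκ hz hsub
  rw [← ofReal_norm] at h
  have e : (n : ℝ≥0∞) * ENNReal.ofReal (2 * r) * ENNReal.ofReal ((2 * κ) ^ n) * α =
      ENNReal.ofReal (n * (2 * r) * (2 * κ) ^ n * α) := by
    rw [ENNReal.ofReal_mul (by positivity), ENNReal.ofReal_mul (by positivity),
      ENNReal.ofReal_mul (by positivity)]
    simp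
  rw [e] at h
  exact (ENNReal.ofReal_le_ofReal_iff (by positivity)).1 h

/-- A constant depending only on the dimension. -/
noncomputable def averageConst (n : ℕ) : ℝ≥0 := 4 * n * 4 ^ n

/-- Consecutive dyadic averages differ by at most a constant times `α` times the radius, so they
form a geometric Cauchy sequence. -/
theorem IncrementBound.exists_limit_average (hT : IncrementBound u F)
    (hF : StronglyMeasurable F) (hu : StronglyMeasurable u) (hui : LocallyIntegrable u)
    {α : ℝ≥0} {z : RSpace n}
    (hz : ∀ r, 0 < r →
      ∫⁻ x in Metric.closedBall z r, ‖F x‖ₑ ≤ α * volume (Metric.closedBall z r)) :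
    ∃ c, ∀ r, 0 < r → ‖(⨍ y in Metric.closedBall z r, u y) - c‖ ≤ averageConst n * α * r := by
  set A : ℝ → 𝕜 := fun r => ⨍ y in Metric.closedBall z r, u y with hA
  have hdiff : ∀ {κ r s : ℝ}, 0 < s → s ≤ r → 0 ≤ κ → r ≤ κ * s →
      ‖A r - A s‖ ≤ n * (2 * r) * (2 * κ) ^ n * α := fun {κ r s} hs hsr hκ0 hκ =>
    hT.norm_average_sub_le hF hu hui hs (hs.trans_le hsr) hκ0 hκ (hz r (hs.trans_le hsr))
      (Metric.closedBall_subset_closedBall hsr)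
  have hlim : ∀ r, 0 < r → ∃ c, Filter.Tendsto (fun k : ℕ => A (r / 2 ^ k)) Filter.atTop (nhds c)
      ∧ ‖A r - c‖ ≤ averageConst n * α * r := by
    intro r hr
    have hstep : ∀ k : ℕ, dist (A (r / 2 ^ k)) (A (r / 2 ^ (k + 1))) ≤
        (averageConst n * α * r) / 2 / 2 ^ k := by
      intro k
      rw [dist_eq_norm]
      -- Halving the radius means `κ = 2`, which gives `2 n 4^n α` times the radius; `averageConst`
      -- is twice the dimensional factor, so that the geometric sum is exactly `averageConst n * α *
      -- r`.
      refine (hdiff (κ := 2) (by positivity) ?_ zero_le_two ?_).trans_eq ?_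
      · exact div_le_div_of_nonneg_left hr.le (by positivity)
          (pow_le_pow_right₀ one_le_two (Nat.le_succ k))
      · rw [pow_succ]; field_simp; rfl
      · simp only [averageConst]; push_cast; field_simp; ring
    obtain ⟨c, hc⟩ := cauchySeq_tendsto_of_complete (cauchySeq_of_le_geometric_two hstep)
    refine ⟨c, hc, ?_⟩
    have := dist_le_of_le_geometric_two_of_tendsto₀ hstep hc
    simpa [dist_eq_norm] using this
  obtain ⟨c, hc, -⟩ := hlim 1 one_pos
  refine ⟨c, fun r hr => ?_⟩
  obtain ⟨c', hc', hcr⟩ := hlim r hr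
  -- The dyadic limit could depend on the starting radius `r`. The radii `r / 2^k` and `1 / 2^k`
  -- have a fixed ratio, so one comparison of averages, with `κ` equal to that ratio, shows that the
  -- limits agree.
  have hdist : Filter.Tendsto (fun k : ℕ => A (r / 2 ^ k) - A (1 / 2 ^ k)) Filter.atTop
      (nhds 0) := by
    obtain ⟨D, hD⟩ : ∃ D : ℝ, ∀ k : ℕ, ‖A (r / 2 ^ k) - A (1 / 2 ^ k)‖ ≤ D / 2 ^ k := by
      rcases le_total 1 r with h | h
      · refine ⟨n * (2 * r) * (2 * r) ^ n * α, fun k => ?_⟩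
        refine (hdiff (κ := r) (by positivity) (by gcongr) hr.le ?_).trans_eq ?_
        · field_simp; rfl
        · field_simp
      · refine ⟨n * (2 * 1) * (2 * (1 / r)) ^ n * α, fun k => ?_⟩
        rw [norm_sub_rev]
        refine (hdiff (κ := 1 / r) (by positivity) (by gcongr) (by positivity) ?_).trans_eq ?_
        · field_simp; rfl
        · field_simp
    refine squeeze_zero_norm hD ?_
    have := (tendsto_pow_atTop_nhds_zero_of_lt_one (r := (1 / 2 : ℝ)) (by norm_num)
      (by norm_num)).const_mul D
    simpa [div_eq_mul_inv] using this
  have : c' - c = 0 := tendsto_nhds_unique (hc'.sub hc) hdist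
  rwa [← sub_eq_zero.1 this]

/-- For good points at distance `d`, compare each limit with an average over a ball of radius
comparable to `d`. On `E` the extension is the limit of averages of `u`, hence `u` itself at
Lebesgue points. -/
theorem IncrementBound.exists_lipschitz (hT : IncrementBound u F)
    (hF : StronglyMeasurable F) (hu : StronglyMeasurable u) (hui : LocallyIntegrable u)
    {α : ℝ≥0} {E : Set (RSpace n)} (hE : ∀ z ∈ E, ∀ r, 0 < r →
      ∫⁻ x in Metric.closedBall z r, ‖F x‖ₑ ≤ α * volume (Metric.closedBall z r)) :
    ∃ g : RSpace n → 𝕜, LipschitzWith (8 * averageConst n * α) g ∧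
      (∀ z ∈ E, ∀ r, 0 < r →
        ‖(⨍ y in Metric.closedBall z r, u y) - g z‖ ≤ averageConst n * α * r) ∧
      ∀ᵐ z, z ∈ E → g z = u z := by
  choose! c hc using fun z (hz : z ∈ E) => hT.exists_limit_average hF hu hui (hE z hz)
  have hlip : LipschitzOnWith (4 * averageConst n * α) c E := by
    refine LipschitzOnWith.of_dist_le_mul fun z hz z' hz' => ?_
    rcases eq_or_ne z z' with rfl | hne
    · simp
    have hd : 0 < dist z z' := dist_pos.2 hne
    -- The ball of radius `2d` about `z` contains the ball of radius `d` about `z'`. In units of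
    -- `averageConst n * α * d` the three errors are 2, 1 and 1, which gives the constant 4 on `E`.
    have h1 := hc z hz (2 * dist z z') (by positivity)
    have h2 := hc z' hz' (dist z z') hd
    have h3 := hT.norm_average_sub_le hF hu hui hd (by positivity) zero_le_two le_rfl
      (hE z hz (2 * dist z z') (by positivity)) (z' := z')
      (Metric.closedBall_subset_closedBall' (by rw [dist_comm z']; linarith))
    set a := ⨍ y in Metric.closedBall z (2 * dist z z'), u y
    set b := ⨍ y in Metric.closedBall z' (dist z z'), u y
    rw [dist_eq_norm (c z)]
    have h4 : (n : ℝ) * (2 * (2 * dist z z')) * (2 * 2) ^ n * α =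
        averageConst n * α * dist z z' := by
      simp only [averageConst]; push_cast; norm_num; ring
    rw [h4] at h3
    calc ‖c z - c z'‖ = ‖-(a - c z) + (a - b) + (b - c z')‖ := by congr 1; abel
      _ ≤ ‖a - c z‖ + ‖a - b‖ + ‖b - c z'‖ := by
          refine (norm_add_le _ _).trans (add_le_add_left ((norm_add_le _ _).trans ?_) _)
          rw [norm_neg]
      _ ≤ _ := by push_cast; linarith
  obtain ⟨g, hg, hgE⟩ := hlip.extend_rclike
  have hgE' : ∀ z ∈ E, ∀ r, 0 < r →
      ‖(⨍ y in Metric.closedBall z r, u y) - g z‖ ≤ averageConst n * α * r := fun z hz r hr => by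
    rw [← hgE hz]; exact hc z hz r hr
  refine ⟨g, ?_, hgE', ?_⟩
  · rwa [show 8 * averageConst n * α = 2 * (4 * averageConst n * α) by ring]
  filter_upwards [IsUnifLocDoublingMeasure.ae_tendsto_average volume hui 1] with z hz hzE
  have hδ : Filter.Tendsto (fun k : ℕ => 1 / ((k : ℝ) + 1)) Filter.atTop
      (nhdsWithin 0 (Set.Ioi 0)) :=
    tendsto_nhdsWithin_iff.2 ⟨tendsto_one_div_add_atTop_nhds_zero_nat,
      Filter.Eventually.of_forall fun k => by
        change 0 < 1 / ((k : ℝ) + 1)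
        positivity⟩
  have h1 := hz (fun _ => z) (fun k : ℕ => 1 / ((k : ℝ) + 1)) hδ
    (Filter.Eventually.of_forall fun k => Metric.mem_closedBall_self (by positivity))
  refine tendsto_nhds_unique ?_ h1
  rw [tendsto_iff_norm_sub_tendsto_zero]
  refine squeeze_zero (fun _ => norm_nonneg _) (fun k => hgE' z hzE _ (by positivity)) ?_
  simpa using (tendsto_one_div_add_atTop_nhds_zero_nat (𝕜 := ℝ)).const_mul (averageConst n * α : ℝ)

end LipschitzExtension

/-! ### The good set of the maximal function and the weak-type estimate. -/

section GoodSet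

variable {n : ℕ} {V : Type*} [NormedAddCommGroup V]

/-- The set of points where the maximal function of `‖F‖ ^ q` is at most `α ^ q`. -/
def goodSet (F : RSpace n → V) (q : ℝ) (α : ℝ≥0) : Set (RSpace n) :=
  {z | ∀ r, 0 < r → ∫⁻ x in Metric.closedBall z r, ‖F x‖ₑ ^ q ≤
    (α : ℝ≥0∞) ^ q * volume (Metric.closedBall z r)}

/-- The condition fails strictly at a bad point for some radius `r`, hence still fails for a
slightly larger radius by continuity of the volume; the larger balls about nearby centres contain
the original one. -/
theorem isClosed_goodSet (F : RSpace n → V) {q : ℝ} (hq : 0 ≤ q) (α : ℝ≥0) :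
    IsClosed (goodSet F q α) := by
  rw [← isOpen_compl_iff, Metric.isOpen_iff]
  intro z hz
  simp only [goodSet, Set.mem_compl_iff, Set.mem_ofPred_eq, not_forall, not_le] at hz
  obtain ⟨r, hr, hlt⟩ := hz
  have hvol : ∀ (z' : RSpace n) (s : ℝ), 0 ≤ s → volume (Metric.closedBall z' s) =
      ENNReal.ofReal (s ^ n) * volume (Metric.ball (0 : RSpace n) 1) := fun z' s hs => by
    rw [Measure.addHaar_closedBall _ _ hs]; simp
  have hαt : (α : ℝ≥0∞) ^ q ≠ ∞ := ENNReal.rpow_ne_top_of_nonneg hq ENNReal.coe_ne_top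
  have hcont : Continuous fun s : ℝ => (α : ℝ≥0∞) ^ q *
      (ENNReal.ofReal (s ^ n) * volume (Metric.ball (0 : RSpace n) 1)) :=
    (ENNReal.continuous_const_mul hαt).comp ((ENNReal.continuous_mul_const
      measure_ball_lt_top.ne).comp (ENNReal.continuous_ofReal.comp (continuous_id.pow n)))
  rw [hvol z r hr.le] at hlt
  have hev := (hcont.tendsto r).eventually (gt_mem_nhds hlt)
  obtain ⟨ε, hε, hball⟩ := Metric.eventually_nhds_iff.1 hev
  have hs := hball (y := r + ε / 2) (by simp [abs_of_pos hε]; linarith)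
  refine ⟨ε / 2, by positivity, fun z' hz' hgood => ?_⟩
  have h1 := hgood (r + ε / 2) (by positivity)
  rw [hvol z' _ (by positivity)] at h1
  have h2 : ∫⁻ x in Metric.closedBall z r, ‖F x‖ₑ ^ q ≤
      ∫⁻ x in Metric.closedBall z' (r + ε / 2), ‖F x‖ₑ ^ q :=
    lintegral_mono_set (Metric.closedBall_subset_closedBall'
      (by rw [dist_comm]; have := Metric.mem_ball.1 hz'; linarith))
  exact absurd (h2.trans h1) (not_le.2 hs)

theorem lintegral_enorm_le_of_mem_goodSet {F : RSpace n → V} (hF : StronglyMeasurable F) {q : ℝ}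
    (hq : 1 ≤ q) {α : ℝ≥0} {z : RSpace n} (hz : z ∈ goodSet F q α) {r : ℝ} (hr : 0 < r) :
    ∫⁻ x in Metric.closedBall z r, ‖F x‖ₑ ≤ α * volume (Metric.closedBall z r) := by
  have hq0 : 0 < q := one_pos.trans_le hq
  have h0 := volume_closedBall_ne_zero z hr
  have ht := volume_closedBall_ne_top z r
  have h1 := setLAverage_rpow_le h0 ht hF.enorm.aemeasurable hq
  have h2 : (volume (Metric.closedBall z r))⁻¹ * ∫⁻ x in Metric.closedBall z r, ‖F x‖ₑ ^ q ≤
      (α : ℝ≥0∞) ^ q := by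
    rw [ENNReal.inv_mul_le_iff h0 ht, mul_comm]
    exact hz r hr
  have h3 := (ENNReal.rpow_le_rpow_iff hq0).1 (h1.trans h2)
  rwa [ENNReal.inv_mul_le_iff h0 ht, mul_comm] at h3

/-- Weak-type bound for the maximal function: each bad point has a ball whose volume is controlled
by the integral of `‖F‖^q` over it, and Vitali selects disjoint ones whose 5-fold enlargements cover
the bad set. -/
theorem volume_compl_goodSet_le (hn : 1 ≤ n) {F : RSpace n → V} {q : ℝ} (hq : 0 ≤ q)
    {α : ℝ≥0} (hα : 0 < α) (hF : ∫⁻ x, ‖F x‖ₑ ^ q ≠ ∞) :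
    volume (goodSet F q α)ᶜ ≤ 5 ^ n * (α : ℝ≥0∞) ^ (-q) * ∫⁻ x, ‖F x‖ₑ ^ q := by
  set T := ∫⁻ x, ‖F x‖ₑ ^ q
  have hα0 : (α : ℝ≥0∞) ^ q ≠ 0 := by
    simp [ENNReal.rpow_eq_zero_iff, hα.ne']
  have hαt : (α : ℝ≥0∞) ^ q ≠ ∞ := ENNReal.rpow_ne_top_of_nonneg hq ENNReal.coe_ne_top
  have hbad : ∀ z ∈ (goodSet F q α)ᶜ, ∃ r, 0 < r ∧ (α : ℝ≥0∞) ^ q *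
      volume (Metric.closedBall z r) < ∫⁻ x in Metric.closedBall z r, ‖F x‖ₑ ^ q := by
    intro z hz
    simpa only [goodSet, Set.mem_compl_iff, Set.mem_ofPred_eq, not_forall, not_le,
      exists_prop] using hz
  choose! r hr hlt using hbad
  have hvol : ∀ z ∈ (goodSet F q α)ᶜ, volume (Metric.closedBall z (r z)) ≤
      (α : ℝ≥0∞) ^ (-q) * ∫⁻ x in Metric.closedBall z (r z), ‖F x‖ₑ ^ q := by
    intro z hz
    rw [ENNReal.rpow_neg, ← ENNReal.inv_mul_le_iff (ENNReal.inv_ne_zero.2 hαt)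
      (ENNReal.inv_ne_top.2 hα0), inv_inv]
    exact (hlt z hz).le
  -- Vitali needs bounded radii. Finiteness of the total integral bounds `r^n`, and `r ≤ r^n` when
  -- `1 ≤ r` and `n ≥ 1`.
  obtain ⟨R, hR⟩ : ∃ R, ∀ z ∈ (goodSet F q α)ᶜ, r z ≤ R := by
    set ω := volume (Metric.ball (0 : RSpace n) 1) with hω
    have hω0 : ω ≠ 0 := (Metric.measure_ball_pos _ _ one_pos).ne'
    have hωt : ω ≠ ∞ := measure_ball_lt_top.ne
    have hbt : (α : ℝ≥0∞) ^ (-q) * T / ω ≠ ∞ := by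
      refine ENNReal.div_ne_top (ENNReal.mul_ne_top ?_ hF) hω0
      rw [ENNReal.rpow_neg]; exact ENNReal.inv_ne_top.2 hα0
    refine ⟨max 1 ((α : ℝ≥0∞) ^ (-q) * T / ω).toReal, fun z hz => ?_⟩
    have h1 : volume (Metric.closedBall z (r z)) ≤ (α : ℝ≥0∞) ^ (-q) * T :=
      (hvol z hz).trans (by gcongr; exact setLIntegral_le_lintegral _ _)
    rw [Measure.addHaar_closedBall _ _ (hr z hz).le, ← hω, finrank_euclideanSpace_fin,
      ← ENNReal.le_div_iff_mul_le (Or.inl hω0) (Or.inl hωt)] at h1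
    have h2 := (ENNReal.ofReal_le_iff_le_toReal hbt).1 h1
    rcases le_total (r z) 1 with h | h
    · exact h.trans (le_max_left _ _)
    · exact ((le_self_pow₀ h (by omega)).trans h2).trans (le_max_right _ _)
  obtain ⟨v, hvt, hdisj, hcov⟩ := Vitali.exists_disjoint_subfamily_covering_enlargement_closedBall
    (goodSet F q α)ᶜ (fun z => z) r R hR 5 (by norm_num)
  have hcount : v.Countable := hdisj.countable_of_nonempty_interior fun z hz => by
    rw [interior_closedBall _ (hr z (hvt hz)).ne']
    exact Metric.nonempty_ball.2 (hr z (hvt hz))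
  have hsub : (goodSet F q α)ᶜ ⊆ ⋃ b ∈ v, Metric.closedBall b (5 * r b) := by
    intro z hz
    obtain ⟨b, hb, hsub⟩ := hcov z hz
    exact Set.mem_biUnion hb (hsub (Metric.mem_closedBall_self (hr z hz).le))
  have : Countable v := hcount
  calc volume (goodSet F q α)ᶜ ≤ volume (⋃ b ∈ v, Metric.closedBall b (5 * r b)) :=
        measure_mono hsub
    _ ≤ ∑' b : v, volume (Metric.closedBall (b : RSpace n) (5 * r b)) :=
        measure_biUnion_le _ hcount _
    _ ≤ ∑' b : v, 5 ^ n * (α : ℝ≥0∞) ^ (-q) *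
          ∫⁻ x in Metric.closedBall (b : RSpace n) (r b), ‖F x‖ₑ ^ q := by
        refine ENNReal.tsum_le_tsum fun b => ?_
        rw [volume_closedBall_mul (b : RSpace n) (b : RSpace n) (by norm_num)
          (hr b (hvt b.2)).le, ENNReal.ofReal_pow (by norm_num), mul_assoc]
        gcongr
        · simp
        · exact hvol b (hvt b.2)
    _ = 5 ^ n * (α : ℝ≥0∞) ^ (-q) *
          ∫⁻ x in ⋃ b ∈ v, Metric.closedBall b (r b), ‖F x‖ₑ ^ q := by
        rw [ENNReal.tsum_mul_left, lintegral_biUnion hcount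
          (fun b _ => Metric.isClosed_closedBall.measurableSet) hdisj]
    _ ≤ _ := by gcongr; exact setLIntegral_le_lintegral _ _

end GoodSet

/-! ### Whitney cubes of the complement of a closed set. -/

section Whitney

variable {n : ℕ}

theorem norm_le_sum_abs (w : RSpace n) : ‖w‖ ≤ ∑ j, |w j| := by
  conv_lhs => rw [← sum_smul_basisVec w]
  refine (norm_sum_le _ _).trans (Finset.sum_le_sum fun j _ => ?_)
  rw [norm_smul, basisVec, PiLp.norm_single]
  simp

theorem openCube_subset_closedBall (c : RSpace n) (ℓ : ℝ) :
    (openCube c ℓ : Set (RSpace n)) ⊆ Metric.closedBall c (n * (ℓ / 2)) := by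
  intro x hx
  rw [Metric.mem_closedBall, dist_eq_norm]
  refine (norm_le_sum_abs _).trans ?_
  calc ∑ j, |(x - c) j| ≤ ∑ _j : Fin n, ℓ / 2 := Finset.sum_le_sum fun j _ => (hx j).le
    _ = _ := by simp

theorem closedBall_subset_openCube (c : RSpace n) {ℓ ρ : ℝ} (h : ρ < ℓ / 2) :
    Metric.closedBall c ρ ⊆ (openCube c ℓ : Set (RSpace n)) := by
  intro x hx j
  rw [Metric.mem_closedBall, dist_eq_norm] at hx
  exact ((norm_coord_le (x - c) j).trans hx).trans_lt h

/-- The radius of the Whitney ball centred at `x`. -/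
noncomputable def whitneyRadius (E : Set (RSpace n)) (x : RSpace n) : ℝ :=
  Metric.infDist x E / (14 * n)

variable {E : Set (RSpace n)}

theorem infDist_pos_of_mem_compl (hE : IsClosed E) (hne : E.Nonempty) {x : RSpace n} (hx : x ∈ Eᶜ) :
    0 < Metric.infDist x E := (hE.notMem_iff_infDist_pos hne).1 hx

theorem whitneyRadius_pos (hn : 1 ≤ n) (hE : IsClosed E) (hne : E.Nonempty) {x : RSpace n}
    (hx : x ∈ Eᶜ) : 0 < whitneyRadius E x := by
  have h1 := infDist_pos_of_mem_compl hE hne hx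
  have h2 : (0 : ℝ) < n := by exact_mod_cast hn
  unfold whitneyRadius
  positivity

theorem infDist_eq (hn : 1 ≤ n) (x : RSpace n) :
    Metric.infDist x E = 14 * n * whitneyRadius E x := by
  have h2 : (0 : ℝ) < n := by exact_mod_cast hn
  unfold whitneyRadius
  field_simp

theorem whitneyRadius_le (hn : 1 ≤ n) (x : RSpace n) :
    14 * whitneyRadius E x ≤ Metric.infDist x E := by
  have h2 : (1 : ℝ) ≤ n := by exact_mod_cast hn
  have h3 : 0 ≤ whitneyRadius E x := by
    unfold whitneyRadius
    have := Metric.infDist_nonneg (x := x) (s := E)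
    positivity
  rw [infDist_eq hn]
  nlinarith

/-- The Whitney cube centred at `b`. -/
noncomputable abbrev whitneyCube (E : Set (RSpace n)) (b : RSpace n) : Opens (RSpace n) :=
  openCube b (14 * whitneyRadius E b)

/-- The half side `7r` leaves room for the balls of radius `5r` that cover and those of radius `6r`
that carry the cutoffs. The Euclidean circumscribed ball has radius at most `7nr`; dividing the
distance by `14n` makes this half the distance to `E`. -/
theorem dist_le_of_mem_whitneyCube (hn : 1 ≤ n) {b x : RSpace n} (hx : x ∈ whitneyCube E b) :
    dist x b ≤ Metric.infDist b E / 2 := by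
  have := openCube_subset_closedBall _ _ hx
  rw [Metric.mem_closedBall] at this
  rw [infDist_eq hn]
  linarith

theorem infDist_bounds_of_mem_whitneyCube (hn : 1 ≤ n) {b x : RSpace n}
    (hx : x ∈ whitneyCube E b) :
    Metric.infDist b E ≤ 2 * Metric.infDist x E ∧
      Metric.infDist x E ≤ 3 / 2 * Metric.infDist b E := by
  have h := dist_le_of_mem_whitneyCube hn hx
  have h1 := Metric.infDist_le_infDist_add_dist (x := b) (y := x) (s := E)
  have h2 := Metric.infDist_le_infDist_add_dist (x := x) (y := b) (s := E)
  rw [dist_comm] at h1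
  constructor <;> linarith

/-- The distance from a common point to `E` is comparable to that from either centre; the factor is
`3 = 2 · 3/2`. -/
theorem whitneyRadius_le_of_mem (hn : 1 ≤ n) {b b' x : RSpace n}
    (hx : x ∈ whitneyCube E b) (hx' : x ∈ whitneyCube E b') :
    whitneyRadius E b ≤ 3 * whitneyRadius E b' := by
  have h1 := (infDist_bounds_of_mem_whitneyCube hn hx).1
  have h2 := (infDist_bounds_of_mem_whitneyCube hn hx').2
  have h3 : (0 : ℝ) < n := by exact_mod_cast hn
  have h4 : Metric.infDist b E ≤ 3 * Metric.infDist b' E := by linarith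
  rw [infDist_eq hn, infDist_eq hn b'] at h4
  have h5 : 14 * (n : ℝ) * whitneyRadius E b ≤ 14 * n * (3 * whitneyRadius E b') := by linarith
  exact le_of_mul_le_mul_left h5 (by positivity)

theorem whitneyCube_subset_compl (hn : 1 ≤ n) (hE : IsClosed E) (hne : E.Nonempty) {b : RSpace n}
    (hb : b ∈ Eᶜ) : (whitneyCube E b : Set (RSpace n)) ⊆ Eᶜ := by
  intro x hx
  have h1 := infDist_bounds_of_mem_whitneyCube hn hx
  have h2 := infDist_pos_of_mem_compl hE hne hb
  exact (hE.notMem_iff_infDist_pos hne).2 (by linarith [h1.1])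

/-- The ball about `x` of radius equal to its distance from `E` misses `E`, so its volume is at most
that of `Eᶜ`. -/
theorem exists_infDist_le (hn : 1 ≤ n)
    (hvol : volume Eᶜ ≠ ∞) : ∃ R, ∀ x ∈ Eᶜ, Metric.infDist x E ≤ R := by
  set ω := volume (Metric.ball (0 : RSpace n) 1) with hω
  have hω0 : ω ≠ 0 := (Metric.measure_ball_pos _ _ one_pos).ne'
  have hωt : ω ≠ ∞ := measure_ball_lt_top.ne
  have : Nontrivial (RSpace n) :=
    Module.nontrivial_of_finrank_pos (R := ℝ) (by rw [finrank_euclideanSpace_fin]; omega)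
  refine ⟨max 1 (volume Eᶜ / ω).toReal, fun x _ => ?_⟩
  have hsub : Metric.ball x (Metric.infDist x E) ⊆ Eᶜ := fun y hy hyE => by
    have h1 := Metric.infDist_le_dist_of_mem (x := x) hyE
    rw [Metric.mem_ball, dist_comm] at hy
    linarith
  have h1 := measure_mono (μ := volume) hsub
  rw [Measure.addHaar_ball _ _ Metric.infDist_nonneg, ← hω, finrank_euclideanSpace_fin,
    ← ENNReal.le_div_iff_mul_le (Or.inl hω0) (Or.inl hωt)] at h1
  have h2 := (ENNReal.ofReal_le_iff_le_toReal (ENNReal.div_ne_top hvol hω0)).1 h1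
  rcases le_total (Metric.infDist x E) 1 with h | h
  · exact h.trans (le_max_left _ _)
  · exact ((le_self_pow₀ h (by omega)).trans h2).trans (le_max_right _ _)

/-- `v` is the set of centres of a Whitney covering of the complement of `E`. -/
structure IsWhitney (E v : Set (RSpace n)) : Prop where
  subset : v ⊆ Eᶜ
  countable : v.Countable
  disjoint : v.PairwiseDisjoint fun b => Metric.closedBall b (whitneyRadius E b)
  cover : ∀ x ∈ Eᶜ, ∃ b ∈ v, x ∈ Metric.closedBall b (5 * whitneyRadius E b)

theorem exists_isWhitney (hn : 1 ≤ n) (hE : IsClosed E) (hne : E.Nonempty)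
    (hvol : volume Eᶜ ≠ ∞) : ∃ v, IsWhitney E v := by
  obtain ⟨R, hR⟩ := exists_infDist_le hn hvol
  have hpos : ∀ b ∈ Eᶜ, 0 < whitneyRadius E b := fun b hb => whitneyRadius_pos hn hE hne hb
  obtain ⟨v, hv, hdisj, hcov⟩ := Vitali.exists_disjoint_subfamily_covering_enlargement_closedBall
    Eᶜ (fun z => z) (whitneyRadius E) R
    (fun x hx => by
      have h1 := whitneyRadius_le (E := E) hn x
      have h2 := hR x hx
      have h3 := hpos x hx
      linarith) 5 (by norm_num)
  refine ⟨v, hv, hdisj.countable_of_nonempty_interior fun z hz => ?_, hdisj, fun x hx => ?_⟩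
  · rw [interior_closedBall _ (hpos z (hv hz)).ne']
    exact Metric.nonempty_ball.2 (hpos z (hv hz))
  · obtain ⟨b, hb, hsub⟩ := hcov x hx
    exact ⟨b, hb, hsub (Metric.mem_closedBall_self (hpos x hx).le)⟩

/-- Packing argument: if `d` is the distance from `x` to `E`, the disjoint Whitney balls of the
cubes containing `x` have radius at least `d/(21n)` and lie in the ball of radius `2d` about `x`.
The ratio of these radii is `42n`. -/
theorem IsWhitney.card_le (hn : 1 ≤ n) (hE : IsClosed E) (hne : E.Nonempty) {v : Set (RSpace n)}
    (hv : IsWhitney E v) (x : RSpace n) (s : Finset (RSpace n)) (hs : ∀ b ∈ s, b ∈ v)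
    (hx : ∀ b ∈ s, x ∈ whitneyCube E b) : s.card ≤ (42 * n) ^ n := by
  rcases s.eq_empty_or_nonempty with rfl | ⟨b₀, hb₀⟩
  · simp
  have hn' : (0 : ℝ) < n := by exact_mod_cast hn
  set d := Metric.infDist x E with hd
  have hd0 : 0 < d := by
    have h1 := (infDist_bounds_of_mem_whitneyCube hn (hx b₀ hb₀)).1
    have h2 := infDist_pos_of_mem_compl hE hne (hv.subset (hs b₀ hb₀))
    linarith
  have hsub : ∀ b ∈ s, Metric.closedBall b (whitneyRadius E b) ⊆ Metric.closedBall x (2 * d) := by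
    intro b hb
    refine Metric.closedBall_subset_closedBall' ?_
    have h1 := dist_le_of_mem_whitneyCube hn (hx b hb)
    have h2 := whitneyRadius_le (E := E) hn b
    have h3 := (infDist_bounds_of_mem_whitneyCube hn (hx b hb)).1
    rw [dist_comm]
    linarith
  have hsmall : ∀ b ∈ s, volume (Metric.closedBall x (d / (21 * n))) ≤
      volume (Metric.closedBall b (whitneyRadius E b)) := by
    intro b hb
    rw [Measure.addHaar_closedBall_center volume x, Measure.addHaar_closedBall_center volume b]
    refine measure_mono (Metric.closedBall_subset_closedBall ?_)
    have h3 := (infDist_bounds_of_mem_whitneyCube hn (hx b hb)).2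
    rw [div_le_iff₀ (by positivity)]
    rw [infDist_eq hn b] at h3
    linarith
  have hvolx0 := volume_closedBall_ne_zero x (r := d / (21 * n)) (by positivity)
  have hvolxt := volume_closedBall_ne_top x (d / (21 * n))
  have key : (s.card : ℝ≥0∞) * volume (Metric.closedBall x (d / (21 * n))) ≤
      ((42 * n) ^ n : ℕ) * volume (Metric.closedBall x (d / (21 * n))) := by
    calc (s.card : ℝ≥0∞) * volume (Metric.closedBall x (d / (21 * n)))
        = ∑ _b ∈ s, volume (Metric.closedBall x (d / (21 * n))) := by simp
      _ ≤ ∑ b ∈ s, volume (Metric.closedBall b (whitneyRadius E b)) := Finset.sum_le_sum hsmall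
      _ = volume (⋃ b ∈ s, Metric.closedBall b (whitneyRadius E b)) :=
          (measure_biUnion_finset (fun b hb b' hb' => hv.disjoint (hs b hb) (hs b' hb'))
            fun b _ => Metric.isClosed_closedBall.measurableSet).symm
      _ ≤ volume (Metric.closedBall x (2 * d)) := measure_mono (Set.iUnion₂_subset hsub)
      _ = _ := by
          rw [show 2 * d = (42 * n) * (d / (21 * n)) by field_simp; norm_num,
            volume_closedBall_mul x x (by positivity) (by positivity),
            ENNReal.ofReal_pow (by positivity)]
          congr 1
          rw [ENNReal.ofReal_mul (by norm_num)]
          simp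
  have := (ENNReal.mul_le_mul_iff_left hvolx0 hvolxt).1 key
  exact_mod_cast this

theorem Set.encard_le_of_forall_finset {X : Type*} {S : Set X} {N : ℕ}
    (h : ∀ s : Finset X, (s : Set X) ⊆ S → s.card ≤ N) : S.encard ≤ N := by
  by_contra hlt
  rw [not_le] at hlt
  obtain ⟨t, htS, ht⟩ := Set.exists_subset_encard_eq (Order.add_one_le_of_lt hlt)
  have hfin : t.Finite := Set.finite_of_encard_eq_coe (k := N + 1) (by simpa using ht)
  have h1 := h hfin.toFinset (by simpa using htS)
  have h2 : ((hfin.toFinset.card : ℕ) : ℕ∞) = N + 1 := by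
    rw [← Set.encard_coe_eq_coe_finsetCard]; simpa using ht
  have h3 : hfin.toFinset.card = N + 1 := by exact_mod_cast h2
  omega

theorem IsWhitney.encard_le (hn : 1 ≤ n) (hE : IsClosed E) (hne : E.Nonempty) {v : Set (RSpace n)}
    (hv : IsWhitney E v) (x : RSpace n) :
    {b : v | x ∈ whitneyCube E b}.encard ≤ ((42 * n) ^ n : ℕ) := by
  refine Set.encard_le_of_forall_finset fun s hs => ?_
  rw [← Finset.card_map (Function.Embedding.subtype _)]
  refine hv.card_le hn hE hne x _ ?_ ?_
  · intro b hb
    obtain ⟨a, -, rfl⟩ := Finset.mem_map.1 hb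
    exact a.2
  · intro b hb
    obtain ⟨a, ha, rfl⟩ := Finset.mem_map.1 hb
    exact hs ha

/-- Each cube lies in the `7n`-fold enlargement of its Whitney ball, and the Whitney balls are
disjoint subsets of `Eᶜ`. -/
theorem IsWhitney.tsum_volume_le (hn : 1 ≤ n) (hE : IsClosed E) (hne : E.Nonempty)
    {v : Set (RSpace n)} (hv : IsWhitney E v) :
    ∑' b : v, volume (whitneyCube E b : Set (RSpace n)) ≤ (7 * n) ^ n * volume Eᶜ := by
  have hn' : (0 : ℝ) < n := by exact_mod_cast hn
  have hpos : ∀ b : v, 0 < whitneyRadius E b := fun b =>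
    whitneyRadius_pos hn hE hne (hv.subset b.2)
  have : Countable v := hv.countable
  calc ∑' b : v, volume (whitneyCube E b : Set (RSpace n))
      ≤ ∑' b : v, (7 * n) ^ n * volume (Metric.closedBall (b : RSpace n) (whitneyRadius E b)) := by
        refine ENNReal.tsum_le_tsum fun b => ?_
        refine (measure_mono (openCube_subset_closedBall _ _)).trans_eq ?_
        rw [show n * (14 * whitneyRadius E b / 2) = (7 * n) * whitneyRadius E (b : RSpace n) by ring,
          volume_closedBall_mul (b : RSpace n) b (by positivity) (hpos b).le,
          ENNReal.ofReal_pow (by positivity), ENNReal.ofReal_mul (by norm_num)]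
        simp
    _ = (7 * n) ^ n * volume (⋃ b ∈ v, Metric.closedBall b (whitneyRadius E b)) := by
        rw [ENNReal.tsum_mul_left, measure_biUnion hv.countable hv.disjoint
          fun b _ => Metric.isClosed_closedBall.measurableSet]
    _ ≤ _ := by
        gcongr
        refine Set.iUnion₂_subset fun b hb => ?_
        refine subset_trans (closedBall_subset_openCube b ?_)
          (whitneyCube_subset_compl hn hE hne (hv.subset hb))
        linarith [hpos ⟨b, hb⟩]

end Whitney

/-! ### Smooth partition of unity subordinate to the Whitney cubes. -/

section Partition

variable {n : ℕ}

/-- The partition of unity obtained from a sequence of bump functions. -/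
noncomputable def orderedPartition (Ψ : ℕ → RSpace n → ℝ) (k : ℕ) (x : RSpace n) : ℝ :=
  Ψ k x * ∏ j ∈ Finset.range k, (1 - Ψ j x)

variable {Ψ : ℕ → RSpace n → ℝ}

theorem contDiff_prod_one_sub (hΨ : ∀ k, ContDiff ℝ (⊤ : ℕ∞) (Ψ k)) (k : ℕ) :
    ContDiff ℝ (⊤ : ℕ∞) fun x => ∏ j ∈ Finset.range k, (1 - Ψ j x) :=
  contDiff_prod fun j _ => contDiff_const.sub (hΨ j)

theorem contDiff_orderedPartition (hΨ : ∀ k, ContDiff ℝ (⊤ : ℕ∞) (Ψ k)) (k : ℕ) :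
    ContDiff ℝ (⊤ : ℕ∞) (orderedPartition Ψ k) :=
  (hΨ k).mul (contDiff_prod_one_sub hΨ k)

theorem prod_one_sub_mem (h01 : ∀ k x, Ψ k x ∈ Set.Icc (0 : ℝ) 1) (k : ℕ) (x : RSpace n) :
    ∏ j ∈ Finset.range k, (1 - Ψ j x) ∈ Set.Icc (0 : ℝ) 1 :=
  ⟨Finset.prod_nonneg fun j _ => sub_nonneg.2 (h01 j x).2,
    Finset.prod_le_one (fun j _ => sub_nonneg.2 (h01 j x).2)
      fun j _ => by linarith [(h01 j x).1]⟩

theorem orderedPartition_nonneg (h01 : ∀ k x, Ψ k x ∈ Set.Icc (0 : ℝ) 1) (k : ℕ) (x : RSpace n) :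
    0 ≤ orderedPartition Ψ k x :=
  mul_nonneg (h01 k x).1 (prod_one_sub_mem h01 k x).1

theorem orderedPartition_le_one (h01 : ∀ k x, Ψ k x ∈ Set.Icc (0 : ℝ) 1) (k : ℕ) (x : RSpace n) :
    orderedPartition Ψ k x ≤ 1 :=
  mul_le_one₀ (h01 k x).2 (prod_one_sub_mem h01 k x).1 (prod_one_sub_mem h01 k x).2

/-- For factors bounded by 1 the Leibniz rule adds derivative norms without multiplying constants,
so products of many cutoffs cost only the sum of their derivative norms. -/
theorem norm_fderiv_mul_le {a b : RSpace n → ℝ} {x : RSpace n} (ha : DifferentiableAt ℝ a x)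
    (hb : DifferentiableAt ℝ b x) (ha1 : |a x| ≤ 1) (hb1 : |b x| ≤ 1) :
    ‖fderiv ℝ (fun y => a y * b y) x‖ ≤ ‖fderiv ℝ a x‖ + ‖fderiv ℝ b x‖ := by
  rw [fderiv_fun_mul ha hb]
  refine (norm_add_le _ _).trans ?_
  rw [norm_smul, norm_smul, add_comm]
  gcongr
  · exact mul_le_of_le_one_left (norm_nonneg _) hb1
  · exact mul_le_of_le_one_left (norm_nonneg _) ha1

theorem norm_fderiv_prod_one_sub_le (hΨ : ∀ k, ContDiff ℝ (⊤ : ℕ∞) (Ψ k))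
    (h01 : ∀ k x, Ψ k x ∈ Set.Icc (0 : ℝ) 1) (k : ℕ) (x : RSpace n) :
    ‖fderiv ℝ (fun x => ∏ j ∈ Finset.range k, (1 - Ψ j x)) x‖ ≤
      ∑ j ∈ Finset.range k, ‖fderiv ℝ (Ψ j) x‖ := by
  have hd : ∀ j, DifferentiableAt ℝ (Ψ j) x := fun j => (hΨ j).differentiable (by simp) x
  induction k with
  | zero => simp
  | succ k ih =>
    simp only [Finset.prod_range_succ, Finset.sum_range_succ]
    refine (norm_fderiv_mul_le ((contDiff_prod_one_sub hΨ k).differentiable (by simp) x)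
      ((hd k).const_sub 1) ?_ ?_).trans (add_le_add ih ?_)
    · exact abs_le.2 ⟨by linarith [(prod_one_sub_mem h01 k x).1], (prod_one_sub_mem h01 k x).2⟩
    · exact abs_le.2 ⟨by linarith [(h01 k x).2], by linarith [(h01 k x).1]⟩
    · rw [fderiv_const_sub, norm_neg]

theorem norm_fderiv_orderedPartition_le (hΨ : ∀ k, ContDiff ℝ (⊤ : ℕ∞) (Ψ k))
    (h01 : ∀ k x, Ψ k x ∈ Set.Icc (0 : ℝ) 1) (k : ℕ) (x : RSpace n) :
    ‖fderiv ℝ (orderedPartition Ψ k) x‖ ≤ ∑ j ∈ Finset.range (k + 1), ‖fderiv ℝ (Ψ j) x‖ := by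
  rw [Finset.sum_range_succ, add_comm]
  refine (norm_fderiv_mul_le ((hΨ k).differentiable (by simp) x)
    ((contDiff_prod_one_sub hΨ k).differentiable (by simp) x) ?_ ?_).trans
    (add_le_add_right (norm_fderiv_prod_one_sub_le hΨ h01 k x) _)
  · exact abs_le.2 ⟨by linarith [(h01 k x).1], (h01 k x).2⟩
  · exact abs_le.2 ⟨by linarith [(prod_one_sub_mem h01 k x).1], (prod_one_sub_mem h01 k x).2⟩

theorem sum_orderedPartition (m : ℕ) (x : RSpace n) :
    ∑ k ∈ Finset.range m, orderedPartition Ψ k x = 1 - ∏ j ∈ Finset.range m, (1 - Ψ j x) := by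
  induction m with
  | zero => simp
  | succ m ih =>
    rw [Finset.sum_range_succ, ih, Finset.prod_range_succ, orderedPartition]
    ring

/-- The sum telescopes to one minus a product, and the product vanishes as soon as one cutoff equals
1; all later terms are zero too. -/
theorem hasSum_orderedPartition {x : RSpace n} {m : ℕ} (hm : Ψ m x = 1) :
    HasSum (fun k => orderedPartition Ψ k x) 1 := by
  have h1 : ∑ k ∈ Finset.range (m + 1), orderedPartition Ψ k x = 1 := by
    rw [sum_orderedPartition, Finset.prod_range_succ, hm]; simp
  rw [← h1]
  refine hasSum_sum_of_ne_finset_zero fun k hk => ?_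
  have hmk : m ∈ Finset.range k := by
    simp only [Finset.mem_range] at hk ⊢; omega
  rw [orderedPartition, Finset.prod_eq_zero hmk (by rw [hm, sub_self]), mul_zero]

/-- A reference bump function, equal to `1` on the ball of radius `5` and supported in the ball
of radius `6`. -/
noncomputable def referenceBump (n : ℕ) : ContDiffBump (0 : RSpace n) :=
  ⟨5, 6, by norm_num, by norm_num⟩

/-- The reference bump function rescaled to a ball. -/
noncomputable def scaledBump (b : RSpace n) (r : ℝ) (x : RSpace n) : ℝ :=
  referenceBump n (r⁻¹ • (x - b))

theorem contDiff_scaledBump (b : RSpace n) (r : ℝ) : ContDiff ℝ (⊤ : ℕ∞) (scaledBump b r) :=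
  (referenceBump n).contDiff.comp (by fun_prop)

theorem scaledBump_mem_Icc (b : RSpace n) (r : ℝ) (x : RSpace n) :
    scaledBump b r x ∈ Set.Icc (0 : ℝ) 1 :=
  ⟨(referenceBump n).nonneg, (referenceBump n).le_one⟩

theorem scaledBump_eq_one {b : RSpace n} {r : ℝ} (hr : 0 < r) {x : RSpace n}
    (hx : x ∈ Metric.closedBall b (5 * r)) : scaledBump b r x = 1 := by
  refine (referenceBump n).one_of_mem_closedBall ?_
  rw [mem_closedBall_zero_iff, norm_smul, norm_inv, Real.norm_of_nonneg hr.le,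
    inv_mul_le_iff₀ hr, ← dist_eq_norm]
  rw [Metric.mem_closedBall] at hx
  change dist x b ≤ r * 5
  linarith

theorem tsupport_scaledBump_subset (b : RSpace n) {r : ℝ} (hr : 0 < r) :
    tsupport (scaledBump b r) ⊆ Metric.closedBall b (6 * r) := by
  refine closure_minimal (fun x hx => ?_) Metric.isClosed_closedBall
  have h1 : r⁻¹ • (x - b) ∈ Function.support (referenceBump n) := hx
  rw [ContDiffBump.support_eq, mem_ball_zero_iff, norm_smul, norm_inv, Real.norm_of_nonneg hr.le,
    inv_mul_lt_iff₀ hr, ← dist_eq_norm] at h1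
  rw [Metric.mem_closedBall]
  have h2 : dist x b < r * 6 := h1
  linarith

theorem exists_norm_fderiv_scaledBump_le (n : ℕ) :
    ∃ C : ℝ, 0 ≤ C ∧ ∀ (b : RSpace n) (r : ℝ) (x : RSpace n), 0 < r →
      ‖fderiv ℝ (scaledBump b r) x‖ ≤ C / r := by
  have hcd : ContDiff ℝ 1 (referenceBump n) := (referenceBump n).contDiff
  obtain ⟨C, hC⟩ := (hcd.continuous_fderiv one_ne_zero).bounded_above_of_compact_support
    ((referenceBump n).hasCompactSupport.fderiv ℝ)
  refine ⟨C, (norm_nonneg _).trans (hC 0), fun b r x hr => ?_⟩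
  have h1 : HasFDerivAt (referenceBump n) (fderiv ℝ (referenceBump n) (r⁻¹ • (x - b)))
      (r⁻¹ • (x - b)) := (hcd.differentiable one_ne_zero _).hasFDerivAt
  have h2 : HasFDerivAt (fun x => r⁻¹ • (x - b)) (r⁻¹ • ContinuousLinearMap.id ℝ (RSpace n)) x :=
    ((hasFDerivAt_id x).sub_const b).const_smul r⁻¹
  have h3 := (h1.comp x h2).fderiv
  have h4 : fderiv ℝ (scaledBump b r) x = (fderiv ℝ (referenceBump n) (r⁻¹ • (x - b))).comp
      (r⁻¹ • ContinuousLinearMap.id ℝ (RSpace n)) := h3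
  rw [h4, ContinuousLinearMap.comp_smul, ContinuousLinearMap.comp_id, norm_smul, norm_inv,
    Real.norm_of_nonneg hr.le, div_eq_inv_mul]
  gcongr
  exact hC _

/-- A smooth partition of unity of the complement of `E` subordinate to Whitney cubes. -/
structure IsWhitneyPartition (E v : Set (RSpace n)) (M : ℝ) (χ : v → RSpace n → ℝ) : Prop where
  contDiff : ∀ b, ContDiff ℝ (⊤ : ℕ∞) (χ b)
  tsupport_subset : ∀ b : v, tsupport (χ b) ⊆ Metric.closedBall b (6 * whitneyRadius E b)
  nonneg : ∀ b x, 0 ≤ χ b x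
  le_one : ∀ b x, χ b x ≤ 1
  norm_fderiv_le : ∀ (b : v) x, ‖fderiv ℝ (χ b) x‖ ≤ M / whitneyRadius E b
  hasSum : ∀ x ∈ Eᶜ, HasSum (fun b => χ b x) 1

/-- At a point of a cube, at most `(42n)^n` cutoffs have nonzero derivative, and their radii are
comparable up to the factor 3. This gives a bound `M` independent of `E` and `v`. -/
theorem exists_isWhitneyPartition (hn : 1 ≤ n) : ∃ M : ℝ, 0 ≤ M ∧
    ∀ E v : Set (RSpace n), IsClosed E → E.Nonempty → IsWhitney E v →
      ∃ χ : v → RSpace n → ℝ, IsWhitneyPartition E v M χ := by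
  obtain ⟨C, hC0, hC⟩ := exists_norm_fderiv_scaledBump_le n
  refine ⟨((42 * n) ^ n : ℕ) * (3 * C), by positivity, fun E v hE hne hv => ?_⟩
  have hpos : ∀ b : v, 0 < whitneyRadius E b := fun b =>
    whitneyRadius_pos hn hE hne (hv.subset b.2)
  have : Countable v := hv.countable
  obtain ⟨e, he⟩ := exists_injective_nat v
  set ψ : v → RSpace n → ℝ := fun b => scaledBump b (whitneyRadius E b) with hψdef
  -- Indices outside the range of the enumeration carry the zero cutoff, which contributes the
  -- factor 1 to the products; finite and infinite `v` are treated alike.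
  set Ψ : ℕ → RSpace n → ℝ := Function.extend e ψ 0 with hΨdef
  have hΨe : ∀ b, Ψ (e b) = ψ b := fun b => he.extend_apply ψ 0 b
  have hΨ0 : ∀ k, k ∉ Set.range e → Ψ k = 0 := fun k hk =>
    Function.extend_apply' (f := e) ψ (0 : ℕ → RSpace n → ℝ) k hk
  have hΨ : ∀ k, ContDiff ℝ (⊤ : ℕ∞) (Ψ k) := fun k => by
    by_cases hk : k ∈ Set.range e
    · obtain ⟨b, rfl⟩ := hk
      rw [hΨe]; exact contDiff_scaledBump _ _
    · rw [hΨ0 k hk]; exact contDiff_const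
  have h01 : ∀ k x, Ψ k x ∈ Set.Icc (0 : ℝ) 1 := fun k x => by
    by_cases hk : k ∈ Set.range e
    · obtain ⟨b, rfl⟩ := hk
      rw [hΨe]; exact scaledBump_mem_Icc _ _ _
    · rw [hΨ0 k hk]; simp
  have hts : ∀ b : v, tsupport (orderedPartition Ψ (e b)) ⊆
      Metric.closedBall b (6 * whitneyRadius E b) := fun b => by
    refine subset_trans ?_ (tsupport_scaledBump_subset (b : RSpace n) (hpos b))
    have : orderedPartition Ψ (e b) = ψ b * fun x => ∏ j ∈ Finset.range (e b), (1 - Ψ j x) := by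
      funext x; rw [orderedPartition, hΨe]; rfl
    rw [this]
    exact tsupport_mul_subset_left
  have hcube : ∀ b : v, Metric.closedBall (b : RSpace n) (6 * whitneyRadius E b) ⊆
      (whitneyCube E b : Set (RSpace n)) := fun b =>
    closedBall_subset_openCube _ (by linarith [hpos b])
  refine ⟨fun b => orderedPartition Ψ (e b), fun b => contDiff_orderedPartition hΨ _, hts,
    fun b x => orderedPartition_nonneg h01 _ x, fun b x => orderedPartition_le_one h01 _ x,
    fun b x => ?_, fun x hx => ?_⟩
  · by_cases hx : x ∈ whitneyCube E (b : RSpace n)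
    · refine (norm_fderiv_orderedPartition_le hΨ h01 _ x).trans ?_
      classical
      set T := (Finset.range (e b + 1)).filter fun j => fderiv ℝ (Ψ j) x ≠ 0
      have hT : ∀ j ∈ T, ∃ b' : v, x ∈ whitneyCube E b' ∧ e b' = j := by
        intro j hj
        have hj0 := (Finset.mem_filter.1 hj).2
        by_cases hk : j ∈ Set.range e
        · obtain ⟨b', rfl⟩ := hk
          refine ⟨b', hcube b' (tsupport_scaledBump_subset _ (hpos b') ?_), rfl⟩
          rw [hΨe] at hj0
          exact support_fderiv_subset ℝ hj0
        · rw [hΨ0 j hk] at hj0; simp at hj0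
      have hcard : T.card ≤ (42 * n) ^ n := by
        have h1 : (T : Set ℕ) ⊆ e '' {b' : v | x ∈ whitneyCube E b'} := fun j hj => by
          obtain ⟨b', hb', rfl⟩ := hT j hj
          exact ⟨b', hb', rfl⟩
        have h2 := (Set.encard_le_encard h1).trans ((Set.encard_image_le _ _).trans
          (hv.encard_le hn hE hne x))
        rw [Set.encard_coe_eq_coe_finsetCard] at h2
        exact_mod_cast h2
      have hterm : ∀ j ∈ T, ‖fderiv ℝ (Ψ j) x‖ ≤ 3 * C / whitneyRadius E b := by
        intro j hj
        obtain ⟨b', hb', rfl⟩ := hT j hj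
        rw [hΨe]
        refine (hC _ _ _ (hpos b')).trans ?_
        have := whitneyRadius_le_of_mem hn hx hb'
        rw [div_le_div_iff₀ (hpos b') (hpos b)]
        nlinarith
      calc ∑ j ∈ Finset.range (e b + 1), ‖fderiv ℝ (Ψ j) x‖ = ∑ j ∈ T, ‖fderiv ℝ (Ψ j) x‖ := by
            refine (Finset.sum_filter_of_ne fun j _ hj => ?_).symm
            simpa using hj
        _ ≤ T.card • (3 * C / whitneyRadius E b) := Finset.sum_le_card_nsmul _ _ _ hterm
        _ ≤ ((42 * n) ^ n : ℕ) • (3 * C / whitneyRadius E b) := by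
            refine nsmul_le_nsmul_left ?_ hcard
            have := hpos b
            positivity
        _ = _ := by rw [nsmul_eq_mul]; ring
    · have : fderiv ℝ (orderedPartition Ψ (e b)) x = 0 := by
        by_contra h0
        exact hx (hcube b (hts b (support_fderiv_subset ℝ h0)))
      rw [this, norm_zero]
      have := hpos b
      positivity
  · obtain ⟨b, hb, hxb⟩ := hv.cover x hx
    have hb1 : Ψ (e ⟨b, hb⟩) x = 1 := by
      rw [hΨe]; exact scaledBump_eq_one (hpos ⟨b, hb⟩) hxb
    have h := hasSum_orderedPartition hb1
    rw [← he.hasSum_iff fun k hk => ?_] at h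
    · exact h
    · rw [orderedPartition, hΨ0 k hk]; simp

end Partition

/-! ### Mollification in `L^p`. -/

section Mollify

variable {n : ℕ} {V : Type*} [NormedAddCommGroup V] [NormedSpace ℝ V]

/-- The convolution of `h` with a normalized bump function. -/
noncomputable def mollify (β : ContDiffBump (0 : RSpace n)) (h : RSpace n → V) : RSpace n → V :=
  convolution (β.normed volume) h (ContinuousLinearMap.lsmul ℝ ℝ) volume

theorem mollify_apply (β : ContDiffBump (0 : RSpace n)) (h : RSpace n → V) (x : RSpace n) :
    mollify β h x = ∫ t, β.normed volume t • h (x - t) := convolution_lsmul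

theorem contDiff_mollify (β : ContDiffBump (0 : RSpace n)) {h : RSpace n → V}
    (hh : LocallyIntegrable h) : ContDiff ℝ (⊤ : ℕ∞) (mollify β h) :=
  β.hasCompactSupport_normed.contDiff_convolution_left _ β.contDiff_normed hh

theorem mollify_add (β : ContDiffBump (0 : RSpace n)) {h h' : RSpace n → V}
    (hh : LocallyIntegrable h) (hh' : LocallyIntegrable h') :
    mollify β (h + h') = mollify β h + mollify β h' := by
  have hc : Continuous (β.normed (volume : Measure (RSpace n))) :=
    (β.contDiff_normed (n := 0)).continuous
  exact (β.hasCompactSupport_normed.convolutionExists_left _ hc hh).distrib_add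
    (β.hasCompactSupport_normed.convolutionExists_left _ hc hh')

theorem support_mollify_subset (β : ContDiffBump (0 : RSpace n)) {h : RSpace n → V}
    {K : Set (RSpace n)} (hK : ∀ x, x ∉ K → h x = 0) {δ : ℝ} (hδ : β.rOut ≤ δ) :
    Function.support (mollify β h) ⊆ Metric.cthickening δ K := by
  intro x hx
  obtain ⟨t, ht, y, hy, rfl⟩ := support_convolution_subset _ hx
  rw [β.support_normed_eq, mem_ball_zero_iff] at ht
  have hyK : y ∈ K := by
    by_contra h0
    exact hy (hK y h0)
  refine Metric.mem_cthickening_of_dist_le _ y _ _ hyK ?_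
  simp only [dist_add_self_left]
  linarith

/-- The normalized bump is a probability density: Jensen moves the power inside, and Tonelli with
translation invariance finishes. -/
theorem eLpNorm_mollify_le (β : ContDiffBump (0 : RSpace n)) {h : RSpace n → V}
    (hh : StronglyMeasurable h) {p : ℝ≥0∞} (hp : 1 ≤ p) (hpt : p ≠ ∞) :
    eLpNorm (mollify β h) p volume ≤ eLpNorm h p volume := by
  have hp0 : p ≠ 0 := (one_pos.trans_le hp).ne'
  have hp1 : 1 ≤ p.toReal := by
    simpa using ENNReal.toReal_mono hpt hp
  have hρm : Measurable fun t => ‖β.normed (volume : Measure (RSpace n)) t‖ₑ :=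
    ((β.contDiff_normed (n := 0)).continuous.measurable).enorm
  set ν : Measure (RSpace n) := volume.withDensity fun t => ‖β.normed volume t‖ₑ with hν
  have hprob : IsProbabilityMeasure ν := ⟨by
    rw [hν, withDensity_apply _ MeasurableSet.univ, Measure.restrict_univ]
    have : ∀ t, ‖β.normed volume t‖ₑ = ENNReal.ofReal (β.normed volume t) := fun t =>
      Real.enorm_of_nonneg (β.nonneg_normed t)
    simp_rw [this]
    rw [← ofReal_integral_eq_lintegral_ofReal β.integrable_normed
      (Filter.Eventually.of_forall fun t => β.nonneg_normed t), β.integral_normed]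
    simp⟩
  have hm2 : Measurable fun q : RSpace n × RSpace n => ‖h (q.1 - q.2)‖ₑ ^ p.toReal :=
    (hh.comp_measurable (measurable_fst.sub measurable_snd)).enorm.pow_const _
  rw [eLpNorm_eq_lintegral_rpow_enorm_toReal hp0 hpt, eLpNorm_eq_lintegral_rpow_enorm_toReal hp0 hpt]
  refine ENNReal.rpow_le_rpow ?_ (by positivity)
  calc ∫⁻ x, ‖mollify β h x‖ₑ ^ p.toReal
      ≤ ∫⁻ x, ∫⁻ t, ‖h (x - t)‖ₑ ^ p.toReal ∂ν := by
        refine lintegral_mono fun x => ?_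
        have hmx : Measurable fun t => ‖h (x - t)‖ₑ :=
          (hh.comp_measurable (measurable_const.sub measurable_id)).enorm
        refine (ENNReal.rpow_le_rpow ?_ (by positivity)).trans
          (lintegral_rpow_le_of_isProbabilityMeasure ν hmx.aemeasurable hp1)
        rw [mollify_apply, hν, lintegral_withDensity_eq_lintegral_mul _ hρm hmx]
        refine (enorm_integral_le_lintegral_enorm _).trans_eq ?_
        simp [enorm_smul]
    _ = ∫⁻ t, (∫⁻ x, ‖h (x - t)‖ₑ ^ p.toReal) ∂ν := lintegral_lintegral_swap hm2.aemeasurable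
    _ = ∫⁻ _t, (∫⁻ x, ‖h x‖ₑ ^ p.toReal) ∂ν := by
        refine lintegral_congr fun t => ?_
        exact lintegral_sub_right_eq_self (fun x => ‖h x‖ₑ ^ p.toReal) t
    _ = _ := by simp

/-- Approximate `h` in `L^p` by a continuous compactly supported `g`, for which mollification
converges uniformly on a fixed compact set; the contraction property controls the mollified
remainder. -/
theorem exists_eLpNorm_sub_mollify_le [CompleteSpace V] {h : RSpace n → V}
    (hh : StronglyMeasurable h) {p : ℝ≥0∞} (hp : 1 ≤ p) (hpt : p ≠ ∞) (hL : MemLp h p volume)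
    {ε : ℝ≥0∞} (hε : 0 < ε) :
    ∃ δ > 0, ∀ β : ContDiffBump (0 : RSpace n), β.rOut ≤ δ →
      eLpNorm (h - mollify β h) p volume ≤ ε := by
  have hε3 : 0 < ε / 3 := ENNReal.div_pos hε.ne' (by norm_num)
  obtain ⟨g, hgc, hgε, hgcont, hgL⟩ := hL.exists_hasCompactSupport_eLpNorm_sub_le hpt hε3.ne'
  have hgm : StronglyMeasurable g := hgcont.stronglyMeasurable
  set K := Metric.cthickening 1 (tsupport g) with hK
  have hKc : IsCompact K := IsCompact.cthickening hgc.isCompact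
  obtain ⟨η, hη0, hη⟩ : ∃ η : ℝ, 0 < η ∧
      volume K ^ p.toReal⁻¹ * ENNReal.ofReal η ≤ ε / 3 := by
    have hMt : volume K ^ p.toReal⁻¹ ≠ ∞ :=
      ENNReal.rpow_ne_top_of_nonneg (by positivity) hKc.measure_lt_top.ne
    have hcont : Filter.Tendsto (fun η : ℝ => volume K ^ p.toReal⁻¹ * ENNReal.ofReal η) (nhds 0)
        (nhds 0) := by
      have := ((ENNReal.continuous_const_mul hMt).comp ENNReal.continuous_ofReal).tendsto 0
      simpa [Function.comp_def] using this
    have hev := hcont.eventually (Iic_mem_nhds hε3)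
    obtain ⟨d, hd, hball⟩ := Metric.eventually_nhds_iff.1 hev
    exact ⟨d / 2, by positivity, hball (by simp [abs_of_pos hd]; linarith)⟩
  have huc : UniformContinuous g := hgc.uniformContinuous_of_continuous hgcont
  obtain ⟨δ, hδ0, hδ⟩ := Metric.uniformContinuous_iff.1 huc η hη0
  refine ⟨min δ 1, by positivity, fun β hβ => ?_⟩
  have hβδ : β.rOut ≤ δ := hβ.trans (min_le_left _ _)
  have hβ1 : β.rOut ≤ 1 := hβ.trans (min_le_right _ _)
  have hhi : LocallyIntegrable h := hL.locallyIntegrable hp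
  have hgi : LocallyIntegrable g := hgL.locallyIntegrable hp
  have hclose : ∀ x, ‖(g - mollify β g) x‖ ≤ η := by
    intro x
    have := β.dist_normed_convolution_le (g := g) (μ := volume) (x₀ := x) (ε := η)
      hgm.aestronglyMeasurable fun y hy => (hδ ((Metric.mem_ball.1 hy).trans_le hβδ)).le
    rwa [dist_comm, dist_eq_norm] at this
  have hsupp : Function.support (g - mollify β g) ⊆ K := by
    intro x hx
    by_contra h0
    have h1 : x ∉ tsupport g := fun h1 => h0 (Metric.self_subset_cthickening _ h1)
    have h2 : mollify β g x = 0 := by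
      by_contra h3
      exact h0 (support_mollify_subset β (fun y hy => image_eq_zero_of_notMem_tsupport hy) hβ1 h3)
    exact hx (by simp [h2, image_eq_zero_of_notMem_tsupport h1])
  have hmid : eLpNorm (g - mollify β g) p volume ≤ ε / 3 := by
    rw [← eLpNorm_restrict_eq_of_support_subset hsupp]
    refine (eLpNorm_le_of_ae_bound (Filter.Eventually.of_forall hclose)).trans ?_
    simpa using hη
  have hsplit : h - mollify β h = (h - g) + ((g - mollify β g) - mollify β (h - g)) := by
    have : mollify β h = mollify β (h - g) + mollify β g := by
      rw [← mollify_add β (hhi.sub hgi) hgi, sub_add_cancel]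
    rw [this]; abel
  have hm1 := (hh.sub hgm).aestronglyMeasurable (μ := (volume : Measure (RSpace n)))
  have hm2 : AEStronglyMeasurable (mollify β g) (volume : Measure (RSpace n)) :=
    (contDiff_mollify β hgi).continuous.aestronglyMeasurable
  have hm3 : AEStronglyMeasurable (mollify β (h - g)) (volume : Measure (RSpace n)) :=
    (contDiff_mollify β (hhi.sub hgi)).continuous.aestronglyMeasurable
  rw [hsplit]
  calc eLpNorm ((h - g) + ((g - mollify β g) - mollify β (h - g))) p volume
      ≤ eLpNorm (h - g) p volume + eLpNorm ((g - mollify β g) - mollify β (h - g)) p volume :=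
        eLpNorm_add_le hm1 ((hgm.aestronglyMeasurable.sub hm2).sub hm3) hp
    _ ≤ eLpNorm (h - g) p volume + (eLpNorm (g - mollify β g) p volume +
          eLpNorm (mollify β (h - g)) p volume) := by
        gcongr
        exact eLpNorm_sub_le (hgm.aestronglyMeasurable.sub hm2) hm3 hp
    _ ≤ ε / 3 + (ε / 3 + ε / 3) := by
        gcongr
        exact (eLpNorm_mollify_le β (hh.sub hgm) hp hpt).trans hgε
    _ = ε := by rw [← add_assoc, ENNReal.add_thirds]

end Mollify

/-! ### Compactly supported Sobolev functions and `W₀^{1,p}`. -/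

section SobolevZero

variable {n : ℕ} {𝕜 : Type*} [RCLike 𝕜]

theorem HasWeakGradient.locallyIntegrable {u : RSpace n → 𝕜}
    {G : RSpace n → EuclideanSpace 𝕜 (Fin n)} (h : HasWeakGradient ⊤ u G) :
    LocallyIntegrable u ∧ LocallyIntegrable G := by
  have h1 := h.1
  have h2 := h.2.1
  simp only [Opens.coe_top, locallyIntegrableOn_univ] at h1 h2
  exact ⟨h1, h2⟩

theorem HasWeakGradient.integral_eq {u : RSpace n → 𝕜}
    {G : RSpace n → EuclideanSpace 𝕜 (Fin n)} (h : HasWeakGradient ⊤ u G) (j : Fin n)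
    {φ : RSpace n → ℝ} (hφ : ContDiff ℝ (⊤ : ℕ∞) φ) (hc : HasCompactSupport φ) :
    ∫ x, fderiv ℝ φ x (basisVec j) • u x = -∫ x, φ x • G x j := by
  have := h.2.2 j ⟨φ, hφ, hc, by simp⟩
  simp only [lineDeriv_testFunction, Opens.coe_top, Measure.restrict_univ] at this
  exact this

theorem hasWeakGradient_top_of {u : RSpace n → 𝕜}
    {G : RSpace n → EuclideanSpace 𝕜 (Fin n)} (hu : LocallyIntegrable u)
    (hG : LocallyIntegrable G)
    (h : ∀ (j : Fin n) (φ : RSpace n → ℝ), ContDiff ℝ (⊤ : ℕ∞) φ → HasCompactSupport φ →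
      ∫ x, fderiv ℝ φ x (basisVec j) • u x = -∫ x, φ x • G x j) :
    HasWeakGradient ⊤ u G := by
  refine ⟨hu.locallyIntegrableOn _, hG.locallyIntegrableOn _, fun j φ => ?_⟩
  simp only [lineDeriv_testFunction, Opens.coe_top, Measure.restrict_univ]
  exact h j φ φ.contDiff φ.hasCompactSupport

theorem HasWeakGradient.restrict {u : RSpace n → 𝕜}
    {G : RSpace n → EuclideanSpace 𝕜 (Fin n)} (h : HasWeakGradient ⊤ u G)
    (U : Opens (RSpace n)) : HasWeakGradient U u G := by
  obtain ⟨hu, hG⟩ := h.locallyIntegrable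
  refine ⟨hu.locallyIntegrableOn _, hG.locallyIntegrableOn _, fun j φ => ?_⟩
  simp only [lineDeriv_testFunction]
  have h0 : ∀ x, x ∉ (U : Set (RSpace n)) → x ∉ tsupport φ := fun x hx hx' =>
    hx (φ.tsupport_subset hx')
  rw [setIntegral_eq_integral_of_forall_compl_eq_zero, setIntegral_eq_integral_of_forall_compl_eq_zero]
  · exact h.integral_eq j φ.contDiff φ.hasCompactSupport
  · intro x hx
    rw [image_eq_zero_of_notMem_tsupport (h0 x hx), zero_smul]
  · intro x hx
    have : fderiv ℝ φ x = 0 := by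
      by_contra hne
      exact h0 x hx (support_fderiv_subset ℝ hne)
    simp [this]

theorem integrable_normed_smul {V : Type*} [NormedAddCommGroup V] [NormedSpace ℝ V]
    (β : ContDiffBump (0 : RSpace n)) {H : RSpace n → V} (hH : LocallyIntegrable H)
    (x : RSpace n) : Integrable fun t => β.normed volume t • H (x - t) :=
  β.hasCompactSupport_normed.convolutionExists_left (ContinuousLinearMap.lsmul ℝ ℝ)
    (β.contDiff_normed (n := 0)).continuous hH x

theorem fderiv_convolution_lsmul {ρ : RSpace n → ℝ} (hρ : ContDiff ℝ 1 ρ)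
    (hρc : HasCompactSupport ρ) {u : RSpace n → 𝕜} (hu : LocallyIntegrable u) (x v : RSpace n) :
    fderiv ℝ (convolution ρ u (ContinuousLinearMap.lsmul ℝ ℝ) volume) x v =
      ∫ t, fderiv ℝ ρ t v • u (x - t) := by
  have hd := (hρc.hasFDerivAt_convolution_left (ContinuousLinearMap.lsmul ℝ ℝ) hρ hu x).fderiv
  have hint := (hρc.fderiv ℝ).convolutionExists_left (ContinuousLinearMap.precompL (RSpace n)
    (ContinuousLinearMap.lsmul ℝ ℝ : ℝ →L[ℝ] 𝕜 →L[ℝ] 𝕜))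
    (hρ.continuous_fderiv one_ne_zero) hu x
  rw [hd, convolution_def, ContinuousLinearMap.integral_apply hint]
  simp only [ContinuousLinearMap.precompL_apply, ContinuousLinearMap.lsmul_apply]

/-- The weak gradient is tested against `y ↦ ρ (x - y)`; the sign from the reflection cancels the
one from integration by parts. -/
theorem HasWeakGradient.integral_translate_eq {u : RSpace n → 𝕜}
    {G : RSpace n → EuclideanSpace 𝕜 (Fin n)} (h : HasWeakGradient ⊤ u G)
    {ρ : RSpace n → ℝ} (hρ : ContDiff ℝ (⊤ : ℕ∞) ρ) (hρc : HasCompactSupport ρ)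
    (x : RSpace n) (j : Fin n) :
    ∫ t, fderiv ℝ ρ t (basisVec j) • u (x - t) = ∫ t, ρ t • G (x - t) j := by
  have hρ1 : ContDiff ℝ 1 ρ := hρ.of_le (by simp)
  have hφc : HasCompactSupport fun y => ρ (x - y) := hρc.comp_homeomorph (Homeomorph.subLeft x)
  have h3 := h.integral_eq j (φ := fun y => ρ (x - y)) (hρ.comp (contDiff_const.sub contDiff_id))
    hφc
  have h4 : ∀ y, fderiv ℝ (fun y => ρ (x - y)) y = -fderiv ℝ ρ (x - y) := fun y => by
    have e1 : HasFDerivAt ρ (fderiv ℝ ρ (x - y)) (x - y) :=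
      (hρ1.differentiable one_ne_zero _).hasFDerivAt
    have e2 := (e1.comp y ((hasFDerivAt_id y).const_sub x)).fderiv
    rw [ContinuousLinearMap.comp_neg, ContinuousLinearMap.comp_id] at e2
    exact e2
  simp only [h4, neg_apply, neg_smul, integral_neg, neg_inj] at h3
  rw [← integral_sub_left_eq_self (fun t => fderiv ℝ ρ t (basisVec j) • u (x - t)) volume x,
    ← integral_sub_left_eq_self (fun t => ρ t • G (x - t) j) volume x]
  simp only [sub_sub_cancel]
  exact h3

theorem fderiv_mollify {u : RSpace n → 𝕜}
    {G : RSpace n → EuclideanSpace 𝕜 (Fin n)} (h : HasWeakGradient ⊤ u G)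
    (β : ContDiffBump (0 : RSpace n)) (x : RSpace n) (j : Fin n) :
    fderiv ℝ (mollify β u) x (basisVec j) = mollify β G x j := by
  obtain ⟨hu, hG⟩ := h.locallyIntegrable
  have h1 := fderiv_convolution_lsmul (β.contDiff_normed (n := 1) (μ := volume))
    β.hasCompactSupport_normed hu x
    (basisVec j)
  have h2 := h.integral_translate_eq (β.contDiff_normed (μ := volume)) β.hasCompactSupport_normed x j
  have h3 := (EuclideanSpace.proj (𝕜 := 𝕜) j).integral_comp_comm (integrable_normed_smul β hG x)
  rw [mollify_apply]
  exact (h1.trans h2).trans h3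

/-- A compactly supported Sobolev function belongs to `W₀^{1,p}`. -/
theorem memW1pZero_of_compact {u : RSpace n → 𝕜}
    {G : RSpace n → EuclideanSpace 𝕜 (Fin n)} (h : HasWeakGradient ⊤ u G)
    (hum : StronglyMeasurable u) (hGm : StronglyMeasurable G) {p : ℝ≥0∞} (hp : 1 ≤ p)
    (hpt : p ≠ ∞) (hu : MemLp u p volume) (hG : MemLp G p volume) {K : Set (RSpace n)}
    (hK : IsCompact K) (huK : ∀ x, x ∉ K → u x = 0) {U : Opens (RSpace n)}
    (hKU : K ⊆ (U : Set (RSpace n))) : MemW1pZero U p u G := by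
  refine ⟨⟨h.restrict U, hu.restrict _, hG.restrict _⟩, fun x hx => huK x fun hx' => hx (hKU hx'),
    fun ε hε => ?_⟩
  obtain ⟨δ₀, hδ₀, hδ₀U⟩ := hK.exists_cthickening_subset_open U.isOpen hKU
  obtain ⟨δ₁, hδ₁, h1⟩ := exists_eLpNorm_sub_mollify_le hum hp hpt hu hε
  obtain ⟨δ₂, hδ₂, h2⟩ := exists_eLpNorm_sub_mollify_le hGm hp hpt hG hε
  -- A single mollifier must approximate `u`, approximate `G`, and keep the support inside `U`; it
  -- works for both because mollification commutes with the weak gradient.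
  set δ := min δ₀ (min δ₁ δ₂) with hδ
  have hδpos : 0 < δ := lt_min hδ₀ (lt_min hδ₁ hδ₂)
  let β : ContDiffBump (0 : RSpace n) := ⟨δ / 2, δ, by positivity, by linarith⟩
  have hβ : β.rOut = δ := rfl
  have hsupp : tsupport (mollify β u) ⊆ Metric.cthickening δ₀ K :=
    closure_minimal (support_mollify_subset β huK (min_le_left _ _))
      Metric.isClosed_cthickening
  let φ : 𝓓(U, 𝕜) := ⟨mollify β u, contDiff_mollify β h.locallyIntegrable.1,
    HasCompactSupport.of_support_subset_isCompact (hK.cthickening (r := δ₀))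
      ((subset_tsupport _).trans hsupp), hsupp.trans hδ₀U⟩
  have hφ : ∀ x, φ x = mollify β u x := fun _ => rfl
  have hφG : ∀ x, testGradient φ x = mollify β G x := fun x => by
    ext j
    change (∂_{basisVec j} φ) x = _
    rw [lineDeriv_testFunction]
    exact fderiv_mollify h β x j
  refine ⟨φ, ?_, ?_⟩
  · refine (eLpNorm_mono_measure _ Measure.restrict_le_self).trans (h1 β ?_)
    exact (min_le_right _ _).trans (min_le_left _ _)
  · simp only [hφG]
    refine (eLpNorm_mono_measure _ Measure.restrict_le_self).trans (h2 β ?_)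
    exact (min_le_right _ _).trans (min_le_right _ _)

end SobolevZero

/-! ### Weak gradients of differences, products and Lipschitz functions. -/

section WeakGradient

variable {n : ℕ} {𝕜 : Type*} [RCLike 𝕜]

theorem norm_le_sum_norm (w : EuclideanSpace 𝕜 (Fin n)) : ‖w‖ ≤ ∑ j, ‖w j‖ := by
  have h : w = ∑ j, EuclideanSpace.single j (w j) := by
    ext i
    simp [Finset.sum_apply, Pi.single_apply]
  conv_lhs => rw [h]
  refine (norm_sum_le _ _).trans (Finset.sum_le_sum fun j _ => ?_)
  rw [PiLp.norm_single]

theorem norm_basisVec (j : Fin n) : ‖(basisVec j : RSpace n)‖ = 1 := by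
  rw [basisVec, PiLp.norm_single, norm_one]

theorem HasWeakGradient.sub {u u' : RSpace n → 𝕜} {G G' : RSpace n → EuclideanSpace 𝕜 (Fin n)}
    (h : HasWeakGradient ⊤ u G) (h' : HasWeakGradient ⊤ u' G') :
    HasWeakGradient ⊤ (u - u') (G - G') := by
  obtain ⟨hu, hG⟩ := h.locallyIntegrable
  obtain ⟨hu', hG'⟩ := h'.locallyIntegrable
  refine hasWeakGradient_top_of (hu.sub hu') (hG.sub hG') fun j φ hφ hc => ?_
  have hd : Continuous fun x => fderiv ℝ φ x (basisVec j) :=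
    (hφ.continuous_fderiv (by simp)).clm_apply continuous_const
  have hdc : HasCompactSupport fun x => fderiv ℝ φ x (basisVec j) :=
    (hc.fderiv ℝ).comp_left (g := fun L : RSpace n →L[ℝ] ℝ => L (basisVec j)) (by simp)
  have e1 := integral_sub (integrable_testFunction_smul hd hdc hu)
    (integrable_testFunction_smul hd hdc hu')
  have e2 := integral_sub
    (integrable_testFunction_smul hφ.continuous hc (LocallyIntegrable.coord hG j))
    (integrable_testFunction_smul hφ.continuous hc (LocallyIntegrable.coord hG' j))
  simp only [← smul_sub] at e1 e2
  have e3 : ∀ x, (G - G') x j = G x j - G' x j := fun x => rfl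
  simp only [Pi.sub_apply u u', e3]
  rw [e1, e2, h.integral_eq j hφ hc, h'.integral_eq j hφ hc]
  abel

/-- The weak gradient of the product of `u`, with weak gradient `H`, and a smooth function. -/
noncomputable def productGradient (χ : RSpace n → ℝ) (u : RSpace n → 𝕜)
    (H : RSpace n → EuclideanSpace 𝕜 (Fin n)) (x : RSpace n) : EuclideanSpace 𝕜 (Fin n) :=
  WithLp.toLp 2 fun j => χ x • H x j + fderiv ℝ χ x (basisVec j) • u x

theorem norm_productGradient_le (χ : RSpace n → ℝ) (u : RSpace n → 𝕜)
    (H : RSpace n → EuclideanSpace 𝕜 (Fin n)) (x : RSpace n) :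
    ‖productGradient χ u H x‖ ≤ |χ x| * ‖H x‖ + n * (‖fderiv ℝ χ x‖ * ‖u x‖) := by
  have e : productGradient χ u H x = χ x • H x +
      WithLp.toLp 2 (fun j => fderiv ℝ χ x (basisVec j) • u x) := rfl
  rw [e]
  refine (norm_add_le _ _).trans (add_le_add (norm_smul_le _ _) ?_)
  refine (norm_le_sum_norm _).trans ?_
  calc ∑ j, ‖fderiv ℝ χ x (basisVec j) • u x‖ ≤ ∑ _j : Fin n, ‖fderiv ℝ χ x‖ * ‖u x‖ := by
        refine Finset.sum_le_sum fun j _ => ?_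
        rw [norm_smul]
        gcongr
        simpa [norm_basisVec] using (fderiv ℝ χ x).le_opNorm (basisVec j)
    _ = _ := by simp

theorem stronglyMeasurable_toLp {X : Type*} [MeasurableSpace X] {a : X → Fin n → 𝕜}
    (h : ∀ j, StronglyMeasurable fun x => a x j) :
    StronglyMeasurable fun x => (WithLp.toLp 2 (a x) : EuclideanSpace 𝕜 (Fin n)) := by
  have h1 : StronglyMeasurable fun x => a x :=
    (measurable_pi_lambda _ fun j => (h j).measurable).stronglyMeasurable
  exact (PiLp.continuous_toLp 2 _).comp_stronglyMeasurable h1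

theorem stronglyMeasurable_productGradient {χ : RSpace n → ℝ} (hχ : ContDiff ℝ (⊤ : ℕ∞) χ)
    {u : RSpace n → 𝕜} (hu : StronglyMeasurable u) {H : RSpace n → EuclideanSpace 𝕜 (Fin n)}
    (hH : StronglyMeasurable H) : StronglyMeasurable (productGradient χ u H) := by
  refine stronglyMeasurable_toLp fun j => ?_
  have hd : Continuous fun x => fderiv ℝ χ x (basisVec j) :=
    (hχ.continuous_fderiv (by simp)).clm_apply continuous_const
  exact (hχ.continuous.stronglyMeasurable.smul (StronglyMeasurable.coord hH j)).add
    (hd.stronglyMeasurable.smul hu)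

theorem LocallyIntegrable.toLp {a : RSpace n → Fin n → 𝕜}
    (h : ∀ j, LocallyIntegrable fun x => a x j) :
    LocallyIntegrable fun x => (WithLp.toLp 2 (a x) : EuclideanSpace 𝕜 (Fin n)) := by
  have e : (fun x => (WithLp.toLp 2 (a x) : EuclideanSpace 𝕜 (Fin n))) =
      fun x => ∑ j, a x j • EuclideanSpace.single j (1 : 𝕜) := by
    funext x
    ext i
    simp [Finset.sum_apply, Pi.single_apply]
  rw [e]
  refine locallyIntegrable_finsetSum _ fun j _ x => ?_
  obtain ⟨s, hs, hi⟩ := h j x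
  exact ⟨s, hs, Integrable.smul_const hi _⟩

/-- Test the weak gradient of `u` against `φ χ` and apply the Leibniz rule. -/
theorem HasWeakGradient.smul {u : RSpace n → 𝕜} {H : RSpace n → EuclideanSpace 𝕜 (Fin n)}
    (h : HasWeakGradient ⊤ u H) {χ : RSpace n → ℝ} (hχ : ContDiff ℝ (⊤ : ℕ∞) χ)
    (hχc : HasCompactSupport χ) :
    HasWeakGradient ⊤ (fun x => χ x • u x) (productGradient χ u H) := by
  obtain ⟨hu, hH⟩ := h.locallyIntegrable
  have hd : ∀ j, Continuous fun x => fderiv ℝ χ x (basisVec j) := fun j =>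
    (hχ.continuous_fderiv (by simp)).clm_apply continuous_const
  have hdc : ∀ j, HasCompactSupport fun x => fderiv ℝ χ x (basisVec j) := fun j =>
    (hχc.fderiv ℝ).comp_left (g := fun L : RSpace n →L[ℝ] ℝ => L (basisVec j)) (by simp)
  have i1 := fun j => integrable_testFunction_smul hχ.continuous hχc (LocallyIntegrable.coord hH j)
  have i2 := fun j => integrable_testFunction_smul (hd j) (hdc j) hu
  refine hasWeakGradient_top_of (integrable_testFunction_smul hχ.continuous hχc
    hu).locallyIntegrable (LocallyIntegrable.toLp fun j => ((i1 j).add (i2 j)).locallyIntegrable)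
    fun j φ hφ hc => ?_
  have h1 := h.integral_eq j (hφ.mul hχ) hc.mul_right
  have h2 : ∀ x, fderiv ℝ (fun x => φ x * χ x) x (basisVec j) =
      φ x * fderiv ℝ χ x (basisVec j) + fderiv ℝ φ x (basisVec j) * χ x := fun x => by
    rw [fderiv_fun_mul (hφ.differentiable (by simp) x) (hχ.differentiable (by simp) x)]
    simp [mul_comm]
  have hdφ : Continuous fun x => fderiv ℝ φ x (basisVec j) :=
    (hφ.continuous_fderiv (by simp)).clm_apply continuous_const
  have hdφc : HasCompactSupport fun x => fderiv ℝ φ x (basisVec j) :=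
    (hc.fderiv ℝ).comp_left (g := fun L : RSpace n →L[ℝ] ℝ => L (basisVec j)) (by simp)
  have i3 : Integrable fun x => φ x • (fderiv ℝ χ x (basisVec j) • u x) :=
    integrable_testFunction_smul hφ.continuous hc (i2 j).locallyIntegrable
  have i4 : Integrable fun x => fderiv ℝ φ x (basisVec j) • (χ x • u x) :=
    integrable_testFunction_smul hdφ hdφc
      (integrable_testFunction_smul hχ.continuous hχc hu).locallyIntegrable
  have i5 : Integrable fun x => φ x • (χ x • H x j) :=
    integrable_testFunction_smul hφ.continuous hc (i1 j).locallyIntegrable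
  have h3 : (∫ x, φ x • (fderiv ℝ χ x (basisVec j) • u x)) +
      ∫ x, fderiv ℝ φ x (basisVec j) • (χ x • u x) = -∫ x, φ x • (χ x • H x j) := by
    rw [← integral_add i3 i4]
    simp only [h2, add_smul, mul_smul] at h1
    exact h1
  have h4 : ∫ x, φ x • productGradient χ u H x j = (∫ x, φ x • (χ x • H x j)) +
      ∫ x, φ x • (fderiv ℝ χ x (basisVec j) • u x) := by
    rw [← integral_add i5 i3]
    simp only [← smul_add]
    rfl
  rw [h4, neg_add, ← h3]
  abel

theorem LipschitzWith.integral_fderiv_smul_eq {g : RSpace n → ℝ} {L : ℝ≥0}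
    (hg : LipschitzWith L g) {φ : RSpace n → ℝ} (hφ : ContDiff ℝ (⊤ : ℕ∞) φ)
    (hc : HasCompactSupport φ) (v : RSpace n) :
    ∫ x, fderiv ℝ φ x v * g x = -∫ x, φ x * lineDeriv ℝ g x v := by
  obtain ⟨D, hD⟩ := ContDiff.lipschitzWith_of_hasCompactSupport hc hφ (by simp)
  have h := hg.integral_lineDeriv_mul_eq (μ := volume) hD hc v
  have e : ∀ x, lineDeriv ℝ φ x (-v) = -fderiv ℝ φ x v := fun x => by
    rw [(hφ.differentiable (by simp) x).lineDeriv_eq_fderiv, map_neg]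
  simp only [e, neg_mul, integral_neg] at h
  simp only [mul_comm (φ _)]
  rw [h, neg_neg]

/-- A Lipschitz function has a bounded weak gradient. -/
theorem LipschitzWith.exists_hasWeakGradient {g : RSpace n → 𝕜} {L : ℝ≥0}
    (hg : LipschitzWith L g) : ∃ G : RSpace n → EuclideanSpace 𝕜 (Fin n),
      StronglyMeasurable G ∧ HasWeakGradient ⊤ g G ∧ ∀ x, ‖G x‖ ≤ 2 * n * L := by
  have hre : LipschitzWith L (fun x => RCLike.re (g x)) :=
    LipschitzWith.of_dist_le_mul fun x y => by
      rw [Real.dist_eq, ← map_sub]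
      exact (RCLike.abs_re_le_norm _).trans (dist_eq_norm (g x) (g y) ▸ hg.dist_le_mul x y)
  have him : LipschitzWith L (fun x => RCLike.im (g x)) :=
    LipschitzWith.of_dist_le_mul fun x y => by
      rw [Real.dist_eq, ← map_sub]
      exact (RCLike.abs_im_le_norm _).trans (dist_eq_norm (g x) (g y) ▸ hg.dist_le_mul x y)
  -- Line derivatives take the value 0 where they do not exist, so the Lipschitz bound holds at
  -- every point, not only almost everywhere.
  set a : Fin n → RSpace n → ℝ := fun j x => lineDeriv ℝ (fun x => RCLike.re (g x)) x (basisVec j)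
  set b : Fin n → RSpace n → ℝ := fun j x => lineDeriv ℝ (fun x => RCLike.im (g x)) x (basisVec j)
  have ha : ∀ j, StronglyMeasurable (a j) := fun j =>
    (measurable_lineDeriv hre.continuous).stronglyMeasurable
  have hb : ∀ j, StronglyMeasurable (b j) := fun j =>
    (measurable_lineDeriv him.continuous).stronglyMeasurable
  have hal : ∀ j x, ‖a j x‖ ≤ L := fun j x => by
    simpa [norm_basisVec] using norm_lineDeriv_le_of_lipschitz ℝ hre (x₀ := x) (v := basisVec j)
  have hbl : ∀ j x, ‖b j x‖ ≤ L := fun j x => by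
    simpa [norm_basisVec] using norm_lineDeriv_le_of_lipschitz ℝ him (x₀ := x) (v := basisVec j)
  have hI : ‖(RCLike.I : 𝕜)‖ ≤ 1 := by
    by_cases h : (RCLike.I : 𝕜) = 0
    · simp [h]
    · rw [RCLike.norm_I_of_ne_zero h]
  have hai : ∀ j, LocallyIntegrable (a j) := fun j => hre.locallyIntegrable_lineDeriv _
  have hbi : ∀ j, LocallyIntegrable (b j) := fun j => him.locallyIntegrable_lineDeriv _
  set c : RSpace n → Fin n → 𝕜 := fun x j => a j x • (1 : 𝕜) + b j x • RCLike.I with hcdef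
  have hcl : ∀ x j, ‖c x j‖ ≤ 2 * L := fun x j => by
    refine (norm_add_le _ _).trans ?_
    rw [norm_smul, norm_smul, norm_one, mul_one]
    have := mul_le_of_le_one_right (norm_nonneg (b j x)) hI
    linarith [hal j x, hbl j x]
  have hcm : ∀ j, StronglyMeasurable fun x => c x j := fun j =>
    ((ha j).smul stronglyMeasurable_const).add ((hb j).smul stronglyMeasurable_const)
  have hGm := stronglyMeasurable_toLp hcm
  have hGb : ∀ x, ‖(WithLp.toLp 2 (c x) : EuclideanSpace 𝕜 (Fin n))‖ ≤ 2 * n * L := fun x => by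
    refine (norm_le_sum_norm _).trans ((Finset.sum_le_sum fun j _ => hcl x j).trans_eq ?_)
    simp; ring
  refine ⟨fun x => WithLp.toLp 2 (c x), hGm, hasWeakGradient_top_of
    hg.continuous.locallyIntegrable ?_ fun j φ hφ hc => ?_, hGb⟩
  · exact (memLp_top_of_bound hGm.aestronglyMeasurable _
      (Filter.Eventually.of_forall hGb)).locallyIntegrable le_top
  · have hd : Continuous fun x => fderiv ℝ φ x (basisVec j) :=
      (hφ.continuous_fderiv (by simp)).clm_apply continuous_const
    have hdc : HasCompactSupport fun x => fderiv ℝ φ x (basisVec j) :=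
      (hc.fderiv ℝ).comp_left (g := fun L : RSpace n →L[ℝ] ℝ => L (basisVec j)) (by simp)
    have e1 : ∀ x, fderiv ℝ φ x (basisVec j) • g x =
        (fderiv ℝ φ x (basisVec j) * RCLike.re (g x)) • (1 : 𝕜) +
        (fderiv ℝ φ x (basisVec j) * RCLike.im (g x)) • (RCLike.I : 𝕜) := fun x => by
      conv_lhs => rw [← RCLike.re_add_im (g x)]
      simp only [RCLike.real_smul_eq_coe_mul, RCLike.ofReal_mul]
      ring
    have e2 : ∀ x, φ x • (WithLp.toLp 2 (c x) : EuclideanSpace 𝕜 (Fin n)) j =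
        (φ x * a j x) • (1 : 𝕜) + (φ x * b j x) • (RCLike.I : 𝕜) := fun x => by
      change φ x • (a j x • (1 : 𝕜) + b j x • RCLike.I) = _
      rw [smul_add, smul_smul, smul_smul]
    simp only [e1, e2]
    rw [integral_add, integral_add, integral_smul_const, integral_smul_const, integral_smul_const,
      integral_smul_const, hre.integral_fderiv_smul_eq hφ hc, him.integral_fderiv_smul_eq hφ hc,
      neg_smul, neg_smul, neg_add]
    · exact (integrable_testFunction_smul hφ.continuous hc (hai j)).smul_const _
    · exact (integrable_testFunction_smul hφ.continuous hc (hbi j)).smul_const _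
    · exact (integrable_testFunction_smul hd hdc
        hre.continuous.locallyIntegrable).smul_const _
    · exact (integrable_testFunction_smul hd hdc
        him.continuous.locallyIntegrable).smul_const _

end WeakGradient

/-! ### `L^p` estimates of the error and of its localized gradient. -/

section

variable {n : ℕ} {𝕜 : Type*} [RCLike 𝕜]

theorem eLpNorm_restrict_le_of_lintegral_le {V : Type*} [NormedAddCommGroup V] {p : ℝ≥0∞}
    (hp : 1 ≤ p) (hpt : p ≠ ∞) {S : Set (RSpace n)} {w : RSpace n → V} {K : ℝ≥0∞}
    (h : ∫⁻ x in S, ‖w x‖ₑ ^ p.toReal ≤ K ^ p.toReal * volume S) :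
    eLpNorm w p (volume.restrict S) ≤ K * volume S ^ (1 / p.toReal) := by
  have hp0 : p ≠ 0 := (zero_lt_one.trans_le hp).ne'
  have hq : 0 < p.toReal := ENNReal.toReal_pos hp0 hpt
  rw [eLpNorm_eq_lintegral_rpow_enorm_toReal hp0 hpt]
  refine (ENNReal.rpow_le_rpow h (by positivity)).trans ?_
  rw [ENNReal.mul_rpow_of_nonneg _ _ (by positivity), ← ENNReal.rpow_mul,
    mul_one_div_cancel hq.ne', ENNReal.rpow_one]

theorem eLpNorm_restrict_le_of_enorm_le {V : Type*} [NormedAddCommGroup V] {p : ℝ≥0∞}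
    (hp : 1 ≤ p) (hpt : p ≠ ∞) {S : Set (RSpace n)} (hS : MeasurableSet S) {w : RSpace n → V}
    {K : ℝ≥0∞} (h : ∀ x ∈ S, ‖w x‖ₑ ≤ K) :
    eLpNorm w p (volume.restrict S) ≤ K * volume S ^ (1 / p.toReal) := by
  refine eLpNorm_restrict_le_of_lintegral_le hp hpt ?_
  refine (setLIntegral_mono' hS fun x hx =>
    ENNReal.rpow_le_rpow (h x hx) ENNReal.toReal_nonneg).trans ?_
  rw [setLIntegral_const]

variable {u : RSpace n → 𝕜} {F : RSpace n → EuclideanSpace 𝕜 (Fin n)}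

/-- The oscillation of `u` around its Lipschitz approximation on a ball centred at a good point. -/
theorem IncrementBound.eLpNorm_sub_le (hT : IncrementBound u F) (hF : StronglyMeasurable F)
    (hu : StronglyMeasurable u) (hui : LocallyIntegrable u) {p : ℝ≥0∞} (hp : 1 ≤ p)
    (hpt : p ≠ ∞) {α : ℝ≥0} {z : RSpace n} (hz : z ∈ goodSet F p.toReal α) {g : RSpace n → 𝕜}
    (hg : LipschitzWith (8 * averageConst n * α) g)
    (hgz : ∀ r, 0 < r → ‖(⨍ y in Metric.closedBall z r, u y) - g z‖ ≤ averageConst n * α * r)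
    {R : ℝ} (hR : 0 < R) :
    eLpNorm (u - g) p (volume.restrict (Metric.closedBall z R)) ≤
      ENNReal.ofReal ((2 * n * 2 ^ n + 9 * averageConst n) * R * α) *
        volume (Metric.closedBall z R) ^ (1 / p.toReal) := by
  have hq : 1 ≤ p.toReal := by
    simpa using ENNReal.toReal_mono hpt hp
  set a := ⨍ y in Metric.closedBall z R, u y with ha
  have h1 : eLpNorm (fun x => u x - a) p (volume.restrict (Metric.closedBall z R)) ≤
      ENNReal.ofReal (2 * n * 2 ^ n * R * α) *
        volume (Metric.closedBall z R) ^ (1 / p.toReal) := by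
    refine eLpNorm_restrict_le_of_lintegral_le hp hpt ?_
    refine (hT.poincare hF hu hui hq z hR).trans ?_
    have e : ENNReal.ofReal (2 * n * 2 ^ n * R * α) =
        n * ENNReal.ofReal (2 * R) * 2 ^ n * α := by
      rw [show 2 * n * 2 ^ n * R * α = n * (2 * R) * 2 ^ n * (α : ℝ) by ring,
        ENNReal.ofReal_mul (by positivity), ENNReal.ofReal_mul (by positivity),
        ENNReal.ofReal_mul (by positivity), ENNReal.ofReal_natCast,
        ENNReal.ofReal_pow (by positivity), ENNReal.ofReal_ofNat, ENNReal.ofReal_coe_nnreal]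
    rw [e, ENNReal.mul_rpow_of_nonneg _ (α : ℝ≥0∞) (by positivity),
      ENNReal.mul_rpow_of_nonneg (_ * _) (2 ^ n) (by positivity)]
    -- The Poincaré factor `2^n` is not raised to the exponent `p`; replacing it by the larger
    -- `(2^n)^p` keeps the constant after the `p`-th root independent of `p`.
    have h1 : (1 : ℝ≥0∞) ≤ 2 ^ n := one_le_pow₀ (by norm_num)
    have h2 : (2 : ℝ≥0∞) ^ n ≤ (2 ^ n) ^ p.toReal := by
      simpa only [ENNReal.rpow_one] using ENNReal.rpow_le_rpow_of_exponent_le h1 hq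
    exact (mul_le_mul' (mul_le_mul' le_rfl h2) (hz R hR)).trans_eq (mul_assoc _ _ _).symm
  -- The 9 is 1, for the average against `g z`, plus 8, for the Lipschitz constant of `g` over the
  -- ball.
  have h2 : eLpNorm (fun x => a - g x) p (volume.restrict (Metric.closedBall z R)) ≤
      ENNReal.ofReal (9 * averageConst n * R * α) *
        volume (Metric.closedBall z R) ^ (1 / p.toReal) := by
    refine eLpNorm_restrict_le_of_enorm_le hp hpt Metric.isClosed_closedBall.measurableSet
      fun x hx => ?_
    rw [← ofReal_norm]
    refine ENNReal.ofReal_le_ofReal ?_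
    have h3 := hg.dist_le_mul z x
    rw [dist_eq_norm] at h3
    have h4 : dist z x ≤ R := by rw [dist_comm]; exact hx
    have h5 : ((8 * averageConst n * α : ℝ≥0) : ℝ) * dist z x ≤
        ((8 * averageConst n * α : ℝ≥0) : ℝ) * R := by gcongr
    calc ‖a - g x‖ = ‖(a - g z) + (g z - g x)‖ := by congr 1; ring
      _ ≤ averageConst n * α * R + ((8 * averageConst n * α : ℝ≥0) : ℝ) * R :=
        (norm_add_le _ _).trans (add_le_add (hgz R hR) (h3.trans h5))
      _ = 9 * averageConst n * R * α := by push_cast; ring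
  calc eLpNorm (u - g) p (volume.restrict (Metric.closedBall z R))
      = eLpNorm ((fun x => u x - a) + fun x => a - g x) p
        (volume.restrict (Metric.closedBall z R)) := by
        congr 1; ext x; simp
    _ ≤ _ := eLpNorm_add_le (hu.sub stronglyMeasurable_const).aestronglyMeasurable
        (continuous_const.sub hg.continuous).aestronglyMeasurable hp
    _ ≤ _ := add_le_add h1 h2
    _ = _ := by
        rw [← add_mul, ← ENNReal.ofReal_add (by positivity) (by positivity)]
        congr 2; ring

/-- The gradient of the piece consists of `χ F`, `χ G` and `∇χ (u - g)`. The last has size `A` times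
the oscillation `R α`, so only the scale-invariant product `A R` enters. -/
theorem IncrementBound.eLpNorm_productGradient_le (hT : IncrementBound u F)
    (hF : StronglyMeasurable F) (hu : StronglyMeasurable u) (hui : LocallyIntegrable u)
    {p : ℝ≥0∞} (hp : 1 ≤ p) (hpt : p ≠ ∞) {α : ℝ≥0} {z : RSpace n}
    (hz : z ∈ goodSet F p.toReal α) {g : RSpace n → 𝕜}
    (hg : LipschitzWith (8 * averageConst n * α) g)
    (hgz : ∀ r, 0 < r → ‖(⨍ y in Metric.closedBall z r, u y) - g z‖ ≤ averageConst n * α * r)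
    {G : RSpace n → EuclideanSpace 𝕜 (Fin n)} (hGm : StronglyMeasurable G)
    (hG : ∀ x, ‖G x‖ ≤ 2 * n * (8 * averageConst n * α : ℝ≥0)) {χ : RSpace n → ℝ}
    (h01 : ∀ x, |χ x| ≤ 1) {A : ℝ} (hA : ∀ x, ‖fderiv ℝ χ x‖ ≤ A) {R : ℝ} (hR : 0 < R) :
    eLpNorm (productGradient χ (u - g) (F - G)) p (volume.restrict (Metric.closedBall z R)) ≤
      ENNReal.ofReal ((1 + 16 * n * averageConst n +
          n * (A * R) * (2 * n * 2 ^ n + 9 * averageConst n)) * α) *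
        volume (Metric.closedBall z R) ^ (1 / p.toReal) := by
  have hA0 : 0 ≤ A := (norm_nonneg _).trans (hA 0)
  have h1 : eLpNorm F p (volume.restrict (Metric.closedBall z R)) ≤
      ENNReal.ofReal α * volume (Metric.closedBall z R) ^ (1 / p.toReal) :=
    eLpNorm_restrict_le_of_lintegral_le hp hpt (by
      rw [ENNReal.ofReal_coe_nnreal]; exact hz R hR)
  have h2 : eLpNorm G p (volume.restrict (Metric.closedBall z R)) ≤
      ENNReal.ofReal (16 * n * averageConst n * α) *
        volume (Metric.closedBall z R) ^ (1 / p.toReal) := by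
    refine eLpNorm_restrict_le_of_enorm_le hp hpt Metric.isClosed_closedBall.measurableSet
      fun x _ => ?_
    rw [← ofReal_norm]
    refine ENNReal.ofReal_le_ofReal ((hG x).trans_eq ?_)
    push_cast; ring
  have h3 := hT.eLpNorm_sub_le hF hu hui hp hpt hz hg hgz hR
  have hug : StronglyMeasurable (u - g) := hu.sub hg.continuous.stronglyMeasurable
  calc eLpNorm (productGradient χ (u - g) (F - G)) p (volume.restrict (Metric.closedBall z R))
      ≤ eLpNorm ((fun x => ‖F x‖) + (fun x => ‖G x‖) + (n * A) • fun x => ‖(u - g) x‖) p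
        (volume.restrict (Metric.closedBall z R)) := by
        refine eLpNorm_mono_real fun x => (norm_productGradient_le _ _ _ _).trans ?_
        simp only [Pi.add_apply, Pi.smul_apply, smul_eq_mul]
        refine add_le_add ?_ ?_
        · calc |χ x| * ‖(F - G) x‖ ≤ 1 * ‖(F - G) x‖ := by gcongr; exact h01 x
            _ ≤ _ := by rw [one_mul]; exact norm_sub_le _ _
        · rw [mul_assoc]
          gcongr
          exact hA x
    _ ≤ eLpNorm F p (volume.restrict (Metric.closedBall z R)) +
          eLpNorm G p (volume.restrict (Metric.closedBall z R)) +
          ENNReal.ofReal (n * A) *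
            eLpNorm (u - g) p (volume.restrict (Metric.closedBall z R)) := by
        refine (eLpNorm_add_le (hF.norm.add hGm.norm).aestronglyMeasurable
          (hug.norm.const_smul _).aestronglyMeasurable hp).trans (add_le_add ?_ ?_)
        · refine (eLpNorm_add_le hF.norm.aestronglyMeasurable
            hGm.norm.aestronglyMeasurable hp).trans ?_
          rw [eLpNorm_norm, eLpNorm_norm]
        · rw [eLpNorm_const_smul, eLpNorm_norm, ← ofReal_norm, Real.norm_of_nonneg (by positivity)]
    _ ≤ _ := add_le_add (add_le_add h1 h2) (mul_le_mul_right h3 _)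
    _ = _ := by
        rw [← mul_assoc, ← ENNReal.ofReal_mul (by positivity), ← add_mul,
          ← ENNReal.ofReal_add (by positivity) (by positivity), ← add_mul,
          ← ENNReal.ofReal_add (by positivity) (by positivity)]
        congr 2; ring

end

/-! ### Localized pieces and their sum. -/

section

variable {n : ℕ} {𝕜 : Type*} [RCLike 𝕜]

theorem productGradient_eq_zero {χ : RSpace n → ℝ} {x : RSpace n} (hx : x ∉ tsupport χ)
    (u : RSpace n → 𝕜) (H : RSpace n → EuclideanSpace 𝕜 (Fin n)) :
    productGradient χ u H x = 0 := by
  have h := norm_productGradient_le χ u H x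
  rw [image_eq_zero_of_notMem_tsupport hx,
    image_eq_zero_of_notMem_tsupport fun h => hx (tsupport_fderiv_subset ℝ h)] at h
  simpa using h

/-- The constant in the estimate of the gradient of a localized piece; `M` controls the gradient of
the partition of unity. -/
noncomputable def pieceConst (n : ℕ) (M : ℝ≥0) : ℝ≥0 :=
  1 + 16 * n * averageConst n + n * (28 * n * M) * (2 * n * 2 ^ n + 9 * averageConst n)

variable {u : RSpace n → 𝕜} {F : RSpace n → EuclideanSpace 𝕜 (Fin n)}

/-- The radius is twice the distance from `b` to `E`: a nearest point of `E` is at that distance,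
and the cube extends at most half as far from `b`. Centring at a point of `E` makes the good-set
estimates available. -/
theorem exists_whitneyCube_subset_closedBall (hn : 1 ≤ n) {E : Set (RSpace n)} (hE : IsClosed E)
    (hne : E.Nonempty) (b : RSpace n) :
    ∃ z ∈ E, (whitneyCube E b : Set (RSpace n)) ⊆
      Metric.closedBall z (28 * n * whitneyRadius E b) := by
  obtain ⟨z, hz, hd⟩ := hE.exists_infDist_eq_dist hne b
  refine ⟨z, hz, fun x hx => ?_⟩
  have h1 := dist_le_of_mem_whitneyCube hn hx
  have h2 := infDist_eq (E := E) hn b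
  have h3 := dist_triangle x b z
  have h4 : 0 ≤ Metric.infDist b E := Metric.infDist_nonneg
  rw [Metric.mem_closedBall]
  linarith

theorem closedBall_subset_whitneyCube {E : Set (RSpace n)} {b : RSpace n}
    (hr : 0 < whitneyRadius E b) :
    Metric.closedBall b (6 * whitneyRadius E b) ⊆ (whitneyCube E b : Set (RSpace n)) :=
  closedBall_subset_openCube b (by linarith)

theorem volume_closedBall_le_whitneyCube {E : Set (RSpace n)} {b : RSpace n}
    (hr : 0 < whitneyRadius E b) (z : RSpace n) :
    volume (Metric.closedBall z (28 * n * whitneyRadius E b)) ≤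
      (28 * n) ^ n * volume (whitneyCube E b : Set (RSpace n)) := by
  rw [volume_closedBall_mul z b (by positivity) hr.le, ENNReal.ofReal_pow (by positivity),
    ENNReal.ofReal_mul (by positivity), ENNReal.ofReal_natCast, ENNReal.ofReal_ofNat]
  gcongr
  exact (Metric.closedBall_subset_closedBall (by linarith)).trans
    (closedBall_subset_whitneyCube hr)

/-- A localized piece of `u - g` lies in `W₀^{1,p}` of its cube, with the right gradient bound. -/
theorem IncrementBound.memW1pZero_piece (hT : IncrementBound u F) (hF : StronglyMeasurable F)
    (hu : StronglyMeasurable u) (hui : LocallyIntegrable u) (hW : HasWeakGradient ⊤ u F)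
    (hn : 1 ≤ n) {p : ℝ≥0∞} (hp : 1 ≤ p) (hpt : p ≠ ∞) {α : ℝ≥0}
    (hne : (goodSet F p.toReal α).Nonempty)
    {g : RSpace n → 𝕜} (hg : LipschitzWith (8 * averageConst n * α) g)
    (hgz : ∀ z ∈ goodSet F p.toReal α, ∀ r, 0 < r →
      ‖(⨍ y in Metric.closedBall z r, u y) - g z‖ ≤ averageConst n * α * r)
    {G : RSpace n → EuclideanSpace 𝕜 (Fin n)} (hGm : StronglyMeasurable G)
    (hgW : HasWeakGradient ⊤ g G)
    (hG : ∀ x, ‖G x‖ ≤ 2 * n * (8 * averageConst n * α : ℝ≥0))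
    {b : RSpace n} (hb : b ∈ (goodSet F p.toReal α)ᶜ) {χ : RSpace n → ℝ}
    (hχ : ContDiff ℝ (⊤ : ℕ∞) χ) (h01 : ∀ x, |χ x| ≤ 1)
    (hs : tsupport χ ⊆ Metric.closedBall b (6 * whitneyRadius (goodSet F p.toReal α) b))
    {M : ℝ≥0} (hA : ∀ x, ‖fderiv ℝ χ x‖ ≤ M / whitneyRadius (goodSet F p.toReal α) b) :
    MemW1pZero (whitneyCube (goodSet F p.toReal α) b) p (fun x => χ x • (u - g) x)
        (productGradient χ (u - g) (F - G)) ∧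
      ∫⁻ x in (whitneyCube (goodSet F p.toReal α) b : Set (RSpace n)),
          ‖productGradient χ (u - g) (F - G) x‖ₑ ^ p.toReal ≤
        (pieceConst n M : ℝ≥0∞) ^ p.toReal * (28 * n) ^ n * (α : ℝ≥0∞) ^ p.toReal *
          volume (whitneyCube (goodSet F p.toReal α) b : Set (RSpace n)) := by
  have hq : 1 ≤ p.toReal := by
    simpa using ENNReal.toReal_mono hpt hp
  have hp0 : p ≠ 0 := (zero_lt_one.trans_le hp).ne'
  have hE := isClosed_goodSet F (zero_le_one.trans hq) α
  set E := goodSet F p.toReal α with hEdef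
  set r := whitneyRadius E b with hr_def
  have hr : 0 < r := whitneyRadius_pos hn hE hne hb
  have hn' : (0 : ℝ) < n := by exact_mod_cast hn
  obtain ⟨z, hz, hQ⟩ := exists_whitneyCube_subset_closedBall hn hE hne b
  have hR : 0 < 28 * n * r := by positivity
  set S := Metric.closedBall z (28 * n * r) with hS
  have hKQ : Metric.closedBall b (6 * r) ⊆ (whitneyCube E b : Set (RSpace n)) :=
    closedBall_subset_whitneyCube hr
  have hχS : tsupport χ ⊆ S := hs.trans (hKQ.trans hQ)
  have hχc : HasCompactSupport χ := (isCompact_closedBall b (6 * r)).of_isClosed_subset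
    (isClosed_tsupport χ) hs
  have hST : volume S ^ (1 / p.toReal) ≠ ∞ :=
    ENNReal.rpow_ne_top_of_nonneg (by positivity) (volume_closedBall_ne_top _ _)
  have hugm : StronglyMeasurable (u - g) := hu.sub hg.continuous.stronglyMeasurable
  have hB := hT.eLpNorm_productGradient_le hF hu hui hp hpt hz hg (hgz z hz) hGm hG h01 hA hR
  -- Here `A = M / r` and `R = 28 n r`, so `r` cancels in `A R` and the constant becomes `pieceConst
  -- n M`.
  rw [show ((1 : ℝ) + 16 * n * averageConst n +
      n * (M / r * (28 * n * r)) * (2 * n * 2 ^ n + 9 * averageConst n)) * α =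
      ((pieceConst n M * α : ℝ≥0) : ℝ) by
        simp only [pieceConst]; push_cast; field_simp,
    ENNReal.ofReal_coe_nnreal] at hB
  have hum : StronglyMeasurable fun x => χ x • (u - g) x :=
    hχ.continuous.stronglyMeasurable.smul hugm
  have hBm := stronglyMeasurable_productGradient hχ hugm (hF.sub hGm)
  have hub : MemLp (fun x => χ x • (u - g) x) p volume := by
    refine ⟨hum.aestronglyMeasurable, ?_⟩
    rw [← eLpNorm_restrict_eq_of_support_subset (s := S)]
    · refine (eLpNorm_mono (g := u - g) fun x => ?_).trans_lt
        ((hT.eLpNorm_sub_le hF hu hui hp hpt hz hg (hgz z hz) hR).trans_lt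
          (ENNReal.mul_lt_top ENNReal.ofReal_lt_top hST.lt_top))
      rw [norm_smul]
      exact mul_le_of_le_one_left (norm_nonneg _) (h01 x)
    · intro x hx
      by_contra hxS
      exact hx (by simp [image_eq_zero_of_notMem_tsupport fun h => hxS (hχS h)])
  have hBb : MemLp (productGradient χ (u - g) (F - G)) p volume := by
    refine ⟨hBm.aestronglyMeasurable, ?_⟩
    rw [← eLpNorm_restrict_eq_of_support_subset (s := S)]
    · exact hB.trans_lt (ENNReal.mul_lt_top ENNReal.coe_lt_top hST.lt_top)
    · intro x hx
      by_contra hxS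
      exact hx (productGradient_eq_zero (fun h => hxS (hχS h)) _ _)
  refine ⟨memW1pZero_of_compact ((hW.sub hgW).smul hχ hχc) hum hBm hp hpt hub hBb
    (isCompact_closedBall b (6 * r)) (fun x hx => ?_) hKQ, ?_⟩
  · simp [image_eq_zero_of_notMem_tsupport fun h => hx (hs h)]
  · calc _ ≤ ∫⁻ x in S, ‖productGradient χ (u - g) (F - G) x‖ₑ ^ p.toReal :=
          lintegral_mono_set hQ
      _ = eLpNorm (productGradient χ (u - g) (F - G)) p (volume.restrict S) ^ p.toReal := by
          rw [eLpNorm_eq_lintegral_rpow_enorm_toReal hp0 hpt, ← ENNReal.rpow_mul,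
            one_div_mul_cancel (by positivity), ENNReal.rpow_one]
      _ ≤ (((pieceConst n M * α : ℝ≥0) : ℝ≥0∞) * volume S ^ (1 / p.toReal)) ^ p.toReal :=
          ENNReal.rpow_le_rpow hB (by positivity)
      _ = (pieceConst n M : ℝ≥0∞) ^ p.toReal * (α : ℝ≥0∞) ^ p.toReal * volume S := by
          rw [ENNReal.mul_rpow_of_nonneg _ _ (by positivity), ← ENNReal.rpow_mul,
            one_div_mul_cancel (by positivity), ENNReal.rpow_one, ENNReal.coe_mul,
            ENNReal.mul_rpow_of_nonneg _ _ (by positivity)]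
      _ ≤ (pieceConst n M : ℝ≥0∞) ^ p.toReal * (α : ℝ≥0∞) ^ p.toReal *
          ((28 * n) ^ n * volume (whitneyCube E b : Set (RSpace n))) := by
          gcongr
          exact volume_closedBall_le_whitneyCube hr z
      _ = _ := by ring

/-- Summing the localized pieces of a locally integrable function vanishing a.e. on `E`. -/
theorem IsWhitneyPartition.hasSum_integral {E v : Set (RSpace n)} {M : ℝ}
    {χ : v → RSpace n → ℝ} (hχ : IsWhitneyPartition E v M χ) (hv : v.Countable)
    {w : RSpace n → 𝕜} (hw : LocallyIntegrable w) (hwE : ∀ᵐ x, x ∈ E → w x = 0)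
    (φ : 𝓓((⊤ : Opens (RSpace n)), ℝ)) :
    HasSum (fun b => ∫ x, φ x • (χ b x • w x)) (∫ x, φ x • w x) := by
  have := hv.to_subtype
  have hφw : Integrable fun x => φ x • w x :=
    integrable_testFunction_smul φ.continuous φ.hasCompactSupport hw
  -- The terms `χ b x * ‖φ x • w x‖` dominate the pieces and sum to an integrable function: on `Eᶜ`
  -- the cutoffs sum to 1, and on `E` everything vanishes almost everywhere because `w` does.
  have hsum : ∀ᵐ x, HasSum (fun b => χ b x * ‖φ x • w x‖) ‖φ x • w x‖ := by
    filter_upwards [hwE] with x hx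
    by_cases h : x ∈ E
    · simp [hx h, hasSum_zero]
    · simpa using (hχ.hasSum x h).mul_right ‖φ x • w x‖
  refine hasSum_integral_of_dominated_convergence (fun b x => χ b x * ‖φ x • w x‖)
    (fun b => ?_) (fun b => .of_forall fun x => ?_) (hsum.mono fun x hx => hx.summable) ?_ ?_
  · have h := ((hχ.contDiff b).continuous.aestronglyMeasurable (μ := volume)).fun_smul
      hφw.aestronglyMeasurable
    exact h.congr (.of_forall fun x => smul_comm _ _ _)
  · rw [smul_comm, norm_smul, Real.norm_of_nonneg (hχ.nonneg b x)]
  · exact hφw.norm.congr (hsum.mono fun x hx => hx.tsum_eq.symm)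
  · filter_upwards [hwE] with x hx
    by_cases h : x ∈ E
    · simp [hx h, hasSum_zero]
    · have := (hχ.hasSum x h).smul_const (φ x • w x)
      rw [one_smul] at this
      simpa only [smul_comm (φ x)] using this

end

/-! ### The endpoint `p = ∞` and the decomposition. -/

section

variable {n : ℕ} {𝕜 : Type*} [RCLike 𝕜]

theorem volume_univ_rspace (hn : 1 ≤ n) : volume (Set.univ : Set (RSpace n)) = ∞ := by
  have : Nonempty (Fin n) := ⟨⟨0, hn⟩⟩
  have : Nontrivial (RSpace n) := inferInstance
  exact measure_univ_of_isAddLeftInvariant _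

theorem lintegral_closedBall_le_of_eLpNorm_top_le {F : RSpace n → EuclideanSpace 𝕜 (Fin n)}
    {α : ℝ≥0} (h : eLpNorm F ∞ volume ≤ α) (z : RSpace n) (r : ℝ) :
    ∫⁻ x in Metric.closedBall z r, ‖F x‖ₑ ≤ α * volume (Metric.closedBall z r) := by
  rw [eLpNorm_exponent_top] at h
  calc _ ≤ ∫⁻ _ in Metric.closedBall z r, (α : ℝ≥0∞) := by
        refine lintegral_mono_ae (ae_restrict_of_ae ?_)
        filter_upwards [ae_le_eLpNormEssSup (f := F) (μ := volume)] with x hx using hx.trans h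
    _ = _ := setLIntegral_const _ _

theorem eLpNorm_top_le_of_norm_le {G : RSpace n → EuclideanSpace 𝕜 (Fin n)} {K : ℝ≥0}
    (h : ∀ x, ‖G x‖ ≤ K) : eLpNorm G ∞ volume ≤ K := by
  rw [eLpNorm_exponent_top]
  exact eLpNormEssSup_le_of_ae_nnnorm_bound (.of_forall h)

end

/-- Calderón–Zygmund decomposition of Sobolev functions. -/
theorem lemma1 (n : ℕ) (hn : 1 ≤ n) (p : ℝ≥0∞) (hp : 1 ≤ p) :
    ∃ (C : ℝ≥0) (N : ℕ),
      ∀ (𝕜 : Type*) [RCLike 𝕜] (f : 𝓓'((⊤ : Opens (RSpace n)), 𝕜))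
        (F : RSpace n → EuclideanSpace 𝕜 (Fin n)),
        IsDistribGradient f F → MemLp F p volume →
      ∀ α : ℝ≥0, 0 < α → (p = ∞ → eLpNorm F ∞ volume ≤ α) →
      ∃ (ι : Type) (_ : Countable ι) (c : ι → RSpace n) (ℓ : ι → ℝ)
        (g : RSpace n → 𝕜) (G : RSpace n → EuclideanSpace 𝕜 (Fin n))
        (b : ι → RSpace n → 𝕜) (B : ι → RSpace n → EuclideanSpace 𝕜 (Fin n)),
        (∀ i, 0 < ℓ i) ∧
        -- `f = g + ∑ b i` in the sense of distributions
        (∀ φ : 𝓓((⊤ : Opens (RSpace n)), ℝ),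
          HasSum (fun i => ∫ x, φ x • b i x) (f φ - ∫ x, φ x • g x)) ∧
        -- `‖∇g‖_∞ ≤ C α`, and `g` is Lipschitz continuous
        HasWeakGradient ⊤ g G ∧ eLpNorm G ∞ volume ≤ C * α ∧ LipschitzWith (C * α) g ∧
        -- `b i ∈ W₀^{1,p}(Q i)` with weak gradient `B i`, and the bound on `∫ |∇(b i)|^p`
        (∀ i, MemW1pZero (openCube (c i) (ℓ i)) p (b i) (B i)) ∧
        (p ≠ ∞ → ∀ i, ∫⁻ x in (openCube (c i) (ℓ i) : Set (RSpace n)), ‖B i x‖ₑ ^ p.toReal ≤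
          C * (α : ℝ≥0∞) ^ p.toReal * volume (openCube (c i) (ℓ i) : Set (RSpace n))) ∧
        -- the bound on `∑ |Q i|`
        (p ≠ ∞ → ∑' i, volume (openCube (c i) (ℓ i) : Set (RSpace n)) ≤
          C * (α : ℝ≥0∞) ^ (-p.toReal) * ∫⁻ x, ‖F x‖ₑ ^ p.toReal) ∧
        -- for `p = ∞` there are no cubes at all, so `f = g`
        (p = ∞ → IsEmpty ι) ∧
        -- bounded overlap
        (∀ x, {i | x ∈ openCube (c i) (ℓ i)}.encard ≤ N) := by
  obtain ⟨M, hM0, hM⟩ := exists_isWhitneyPartition (n := n) hn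
  lift M to ℝ≥0 using hM0
  -- The four constants serve the Lipschitz bound, the gradient of `g`, the pieces and the total
  -- volume. `C₃` is used only for `p < ∞`, so the value `p.toReal = 0` at `p = ∞` is harmless.
  set C₁ : ℝ≥0 := 8 * averageConst n with hC₁
  set C₂ : ℝ≥0 := 2 * n * (8 * averageConst n) with hC₂
  set C₃ : ℝ≥0 := pieceConst n M ^ p.toReal * (28 * n) ^ n with hC₃
  set C₄ : ℝ≥0 := (7 * n) ^ n * 5 ^ n with hC₄
  set C : ℝ≥0 := C₁ + C₂ + C₃ + C₄ with hC
  have h1C : C₁ ≤ C := by rw [hC, add_assoc, add_assoc]; exact le_self_add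
  have h2C : C₂ ≤ C := by
    rw [hC, add_assoc, add_comm C₁, add_assoc]; exact le_self_add
  have h3C : C₃ ≤ C := by
    rw [hC, add_comm _ C₃, add_assoc]; exact le_self_add
  have h4C : C₄ ≤ C := le_add_self
  refine ⟨C, (42 * n) ^ n, fun 𝕜 _ f F₀ hf₀ hF₀ α hα hinf => ?_⟩
  -- The pointwise estimates use a strongly measurable representative of the gradient; changing it
  -- on a null set affects neither hypotheses nor conclusions.
  obtain ⟨F, hFm, hFF⟩ := hF₀.1
  have hf := hf₀.congr_ae hFF
  obtain ⟨u, hum, hui, hfu⟩ := hf.exists_function hFm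
  have hT : IncrementBound u F := fun h => hf.enorm_translate_sub_le hFm hui hum hfu h
  have hW := hf.hasWeakGradient hui hfu
  have hGb : ∀ {G : RSpace n → EuclideanSpace 𝕜 (Fin n)},
      (∀ x, ‖G x‖ ≤ 2 * n * (8 * averageConst n * α : ℝ≥0)) →
        eLpNorm G ∞ volume ≤ C * α := by
    intro G hG
    refine (eLpNorm_top_le_of_norm_le (K := C₂ * α) fun x => (hG x).trans_eq ?_).trans ?_
    · rw [hC₂]; push_cast; ring
    · exact_mod_cast mul_le_mul_left h2C α
  rcases eq_or_ne p ∞ with rfl | hpt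
  · have hFα : eLpNorm F ∞ volume ≤ α := by
      rw [← eLpNorm_congr_ae hFF]; exact hinf rfl
    obtain ⟨g, hg, -, hgu⟩ := hT.exists_lipschitz hFm hum hui (α := α) (E := Set.univ)
      fun z _ r _ => lintegral_closedBall_le_of_eLpNorm_top_le hFα z r
    obtain ⟨G, hGm, hgG, hG⟩ := hg.exists_hasWeakGradient
    refine ⟨Empty, inferInstance, Empty.elim, Empty.elim, g, G, Empty.elim, Empty.elim,
      fun i => i.elim, fun φ => ?_, hgG, hGb hG, hg.weaken (mul_le_mul_left h1C α),
      fun i => i.elim, fun h => (h rfl).elim, fun h => (h rfl).elim, fun _ => inferInstance,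
      fun x => ?_⟩
    · have : ∫ x, φ x • g x = ∫ x, φ x • u x := integral_congr_ae <| by
        filter_upwards [hgu] with x hx
        rw [hx (Set.mem_univ x)]
      rw [this, hfu, sub_self]
      exact hasSum_empty
    · rw [Set.eq_empty_of_isEmpty {i : Empty | _}]
      simp
  · have hp0 : p ≠ 0 := (zero_lt_one.trans_le hp).ne'
    have hq : 1 ≤ p.toReal := by
      simpa using ENNReal.toReal_mono hpt hp
    have hFp : MemLp F p volume := hF₀.ae_eq hFF
    have hFfin : ∫⁻ x, ‖F x‖ₑ ^ p.toReal ≠ ∞ :=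
      ((eLpNorm_lt_top_iff_lintegral_rpow_enorm_lt_top hp0 hpt).1 hFp.2).ne
    have hFint : ∫⁻ x, ‖F₀ x‖ₑ ^ p.toReal = ∫⁻ x, ‖F x‖ₑ ^ p.toReal :=
      lintegral_congr_ae <| by filter_upwards [hFF] with x hx; rw [hx]
    set E := goodSet F p.toReal α with hEdef
    have hE : IsClosed E := isClosed_goodSet F (zero_le_one.trans hq) α
    have hvol := volume_compl_goodSet_le hn (zero_le_one.trans hq) hα hFfin
    have hvfin : volume Eᶜ ≠ ∞ := by
      refine (hvol.trans_lt (ENNReal.mul_lt_top (ENNReal.mul_lt_top (by simp) ?_)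
        hFfin.lt_top)).ne
      exact (ENNReal.rpow_ne_top_of_ne_zero (by exact_mod_cast hα.ne') ENNReal.coe_ne_top).lt_top
    -- Were `E` empty, its complement would be the whole space, which has infinite volume because `n
    -- ≥ 1`.
    have hne : E.Nonempty := by
      by_contra h
      rw [Set.not_nonempty_iff_eq_empty] at h
      exact hvfin (by rw [h, Set.compl_empty, volume_univ_rspace hn])
    obtain ⟨v, hv⟩ := exists_isWhitney hn hE hne hvfin
    obtain ⟨χ, hχ⟩ := hM E v hE hne hv
    obtain ⟨g, hg, hgz, hgu⟩ := hT.exists_lipschitz hFm hum hui (α := α) (E := E)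
      fun z hz r hr => lintegral_enorm_le_of_mem_goodSet hFm hq hz hr
    obtain ⟨G, hGm, hgG, hG⟩ := hg.exists_hasWeakGradient
    have hpiece := fun b : v => hT.memW1pZero_piece hFm hum hui hW hn hp hpt hne hg hgz hGm hgG hG
      (hv.subset b.2) (hχ.contDiff b)
      (fun x => abs_le.2 ⟨by linarith [hχ.nonneg b x], hχ.le_one b x⟩) (hχ.tsupport_subset b)
      (hχ.norm_fderiv_le b)
    have hgi : LocallyIntegrable g := hg.continuous.locallyIntegrable
    refine ⟨v, hv.countable.to_subtype, fun b => b, fun b => 14 * whitneyRadius E b, g, G,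
      fun b x => χ b x • (u - g) x, fun b => productGradient (χ b) (u - g) (F - G),
      fun b => mul_pos (by norm_num) (whitneyRadius_pos hn hE hne (hv.subset b.2)), fun φ => ?_,
      hgG, hGb hG, hg.weaken (mul_le_mul_left h1C α), fun b => (hpiece b).1,
      fun _ b => (hpiece b).2.trans ?_, fun _ => ?_, fun h => (hpt h).elim,
      hv.encard_le hn hE hne⟩
    -- The summed function is `u - g`, which vanishes almost everywhere on `E` because `g` agrees
    -- with `u` there.
    · have h := hχ.hasSum_integral hv.countable (hui.sub hgi)
        (hgu.mono fun x hx hxE => by simp [hx hxE]) φ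
      convert h using 1
      rw [hfu, ← integral_sub
        (integrable_testFunction_smul φ.continuous φ.hasCompactSupport hui)
        (integrable_testFunction_smul φ.continuous φ.hasCompactSupport hgi)]
      simp only [Pi.sub_apply, smul_sub]
    · have : (pieceConst n M : ℝ≥0∞) ^ p.toReal * (28 * n) ^ n = C₃ := by
        rw [hC₃]; push_cast
        rw [ENNReal.coe_rpow_of_nonneg _ (by positivity)]
      rw [this]
      gcongr
    · refine (hv.tsum_volume_le hn hE hne).trans ?_
      rw [hFint]
      calc _ ≤ (7 * n : ℝ≥0∞) ^ n *
            (5 ^ n * (α : ℝ≥0∞) ^ (-p.toReal) * ∫⁻ x, ‖F x‖ₑ ^ p.toReal) := by gcongr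
        _ = C₄ * (α : ℝ≥0∞) ^ (-p.toReal) * ∫⁻ x, ‖F x‖ₑ ^ p.toReal := by
            rw [hC₄]; push_cast; ring
        _ ≤ _ := by gcongr
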